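/- Let $U\subset\mathbb C\setminus\{0\}$ be open and let $q_0$ be a holomorphic function on $U$ with $6q_0(t)^2+t=0$ (a branch of $\sqrt{-t/6}$). *Painlevé side.* Let $q(t,\hbar)=\sum_{k\ge 0}\hbar^{2k}q_{2k}(t)$ be the $0$-parameter formal solution of $P_{\rm I}:\ \hbar^2 q''=6q^2+t$ with leading term $q_0$, i.e. for $k\ge 0$ $$q_{2(k+1)}=\frac1{12q_0}\Bigl(q_{2k}''-6\sum_{k_1+k_2=k+1,\ k_1,k_2>0}q_{2k_1}q_{2k_2}\Bigr).$$ Put $p=\hbar\,dq/dt$, $H(q,p,t)=\tfrac12p^2-2q^3-tq$, and $\sigma(t,\hbar)=H(q(t,\hbar),p(t,\hbar),t)=\sum_{n\ge0}\hbar^{2n}\sigma_{2n}(t)$. A formal Laurent series $\log\tau(t,\hbar)$ in $\hbar$, with coefficients functions on $U$, is the logarithm of a $\tau$-function of $P_{\rm I}$ (for this formal solution) if $\hbar^2\frac{d}{dt}\log\tau=\sigma$. *Spectral curve side.* Consider the curve $y^2=4(x-q_0)^2(x+2q_0)$, parametrized by $x(z)=z^2-2q_0$, $y(z)=2z(z^2-3q_0)$,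 $z\in\mathbb P^1$. Write $\bar z=-z$, $B(z_1,z_2)=dz_1dz_2/(z_1-z_2)^2$, and $$K(z,z_1)=-\frac{\int_z^{\bar z}B(\cdot,z_1)}{2\,(y(z)-y(\bar z))\,dx(z)}.$$ The Eynard–Orantin differentials $W_{g,n}$ ($g\ge0$, $n\ge1$) are defined by $W_{0,1}=y\,dx$, $W_{0,2}=B$ and, for $2g-2+n\ge1$, $$W_{g,n}(z_1,\dots,z_n)=\mathop{\rm Res}_{z=0}K(z,z_1)\Bigl[W_{g-1,n+1}(z,\bar z,z_2,\dots,z_n)+\sum W_{g_1,|I|+1}(z,z_I)\,W_{g_2,|J|+1}(\bar z,z_J)\Bigr],$$ where the first term is absent for $g=0$, and the sum is over $g_1+g_2=g$ and $I\sqcup J=\{2,\dots,n\}$ such that no factor is $W_{0,1}$. The closed free energies $F_g(t)$ are the following. * For $g\ge2$: $F_g=\frac1{2-2g}\mathop{\rm Res}_{z=0}\Phi(z)W_{g,1}(z)$, where $\Phi(z)=\int_{z_0}^z y\,dx$ and $z_0\in\mathbb C$ is any base point. * $F_0=-\frac12\mathop{\rm Res}_{\infty}V\,y\,dx$, where $V$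 is the polynomial in $\zeta=\sqrt x$ (the local parameter $\zeta\sim z$ near $z=\infty$) with $V(0)=0$ and $y\,dx-dV=O(\zeta^{-2})\,d\zeta$ at $z=\infty$. * $F_1=-\frac12\log\tau_B-\frac1{24}\log\frac{dy}{dz}(0)$, with any continuous branch on $U$ of $\log\frac{dy}{dz}(0)$ (assumed to exist), where $\tau_B$ is the Bergman $\tau$-function, given up to a constant factor by $d\log\tau_B=\bigl(\mathop{\rm Res}_{z=0}B(z,\bar z)/dx(z)\bigr)\,d(x(0))$. Thus $F_1$ is defined up to an additive constant on each connected component of $U$. **Theorem.** For every $g\ge0$, $F_g$ is differentiable on $U$ and $$\frac{dF_g}{dt}(t)=\sigma_{2g}(t)\qquad(t\in U).$$ Consequently the formal series $\log\tau(t,\hbar)=\sum_{g\ge0}\hbar^{2g-2}F_g(t)$ is the logarithm of a $\tau$-function of $P_{\rm I}$, i.e. $\hbar^2\frac{d}{dt}\sum_{g\ge0}\hbar^{2g-2}F_g(t)=\sigma(t,\hbar)$. -/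

import Mathlib

noncomputable section

namespace PainleveOne

/-! ### Residues -/

/-- `(1 / 2πi) ∮ f(z) dz` over a small positively oriented circle around `0` (the value for all
small radii, if `f` is holomorphic in a punctured neighbourhood of `0`). -/
def residueZero (f : ℂ → ℂ) : ℂ :=
  Filter.limUnder (nhdsWithin (0 : ℝ) (Set.Ioi 0))
    fun r : ℝ => (2 * (Real.pi : ℂ) * Complex.I)⁻¹ * ∮ z in C(0, r), f z

/-- `(1 / 2πi) ∮ f(z) dz` over a large positively oriented circle (the value for all large radii,
if `f` is holomorphic near `∞`), that is, minus the residue of `f(z) dz` at `z = ∞`. -/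
def contourInfinity (f : ℂ → ℂ) : ℂ :=
  Filter.limUnder Filter.atTop
    fun R : ℝ => (2 * (Real.pi : ℂ) * Complex.I)⁻¹ * ∮ z in C(0, R), f z

/-! ### The formal solution, the Hamiltonian and the tau-function

Formal series in `ħ` whose coefficients are functions of `t` are elements of
`PowerSeries (ℂ → ℂ)` or `LaurentSeries (ℂ → ℂ)`; the variable of the series is `ħ`. -/

/-- The coefficient `q_{2k}(t)` of the formal solution of `ħ² q'' = 6 q² + t` with leading term
`q₀`: for `k ≥ 0`,
`q_{2(k+1)} = (12 q₀)⁻¹ (q_{2k}'' - 6 ∑_{k₁ + k₂ = k + 1, kᵢ > 0} q_{2k₁} q_{2k₂})`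
(below `k₁ = i + 1` and `k₂ = k - i`). -/
def qCoeff (q₀ : ℂ → ℂ) : ℕ → ℂ → ℂ
  | 0 => q₀
  | k + 1 => fun t =>
      1 / (12 * q₀ t) *
        (deriv (deriv (qCoeff q₀ k)) t
          - 6 * ∑ i : Fin k, qCoeff q₀ (i + 1) t * qCoeff q₀ (k - i) t)
  decreasing_by all_goals omega

/-- `q(t, ħ) = ∑ ħ^{2k} q_{2k}(t)`. -/
def qSeries (q₀ : ℂ → ℂ) : PowerSeries (ℂ → ℂ) :=
  PowerSeries.mk fun n => if Even n then qCoeff q₀ (n / 2) else 0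

/-- Coefficientwise `d/dt`. -/
def ddt (f : PowerSeries (ℂ → ℂ)) : PowerSeries (ℂ → ℂ) :=
  PowerSeries.mk fun n => deriv (PowerSeries.coeff n f)

/-- `p(t, ħ) = ħ dq/dt`. -/
def pSeries (q₀ : ℂ → ℂ) : PowerSeries (ℂ → ℂ) :=
  PowerSeries.X * ddt (qSeries q₀)

/-- The Hamiltonian `H(q, p, t) = p² / 2 - 2 q³ - t q`. -/
def hamiltonian (q p : PowerSeries (ℂ → ℂ)) : PowerSeries (ℂ → ℂ) :=
  PowerSeries.C (fun _ : ℂ => (1 / 2 : ℂ)) * p ^ 2 - 2 * q ^ 3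
    - PowerSeries.C (fun t : ℂ => t) * q

/-- `σ(t, ħ) = H(q(t, ħ), p(t, ħ), t)`. -/
def sigmaSeries (q₀ : ℂ → ℂ) : PowerSeries (ℂ → ℂ) :=
  hamiltonian (qSeries q₀) (pSeries q₀)

/-- The formal Laurent series `L` is the logarithm of a tau-function on `U`:
`ħ² dL/dt = σ`, coefficient by coefficient. -/
def IsLogTau (U : Set ℂ) (q₀ : ℂ → ℂ) (L : LaurentSeries (ℂ → ℂ)) : Prop :=
  ∀ t ∈ U, ∀ n : ℤ,
    HasDerivAt (L.coeff n)
      ((HahnSeries.ofPowerSeries ℤ (ℂ → ℂ) (sigmaSeries q₀)).coeff (n + 2) t) t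

/-! ### The spectral curve and the topological recursion

Here `a : ℂ` is the value of `q₀` at a given `t`. Multi-differentials on copies of `ℙ¹` are
represented by their coefficients with respect to `dz₁ ⋯ dzₙ`. -/

/-- `x(z) = z² - 2 q₀`. -/
def xMap (a z : ℂ) : ℂ := z ^ 2 - 2 * a

/-- `y(z) = 2 z (z² - 3 q₀)`. -/
def yMap (a z : ℂ) : ℂ := 2 * z * (z ^ 2 - 3 * a)

/-- The coefficient of the Bergman kernel `B(z₁, z₂) = dz₁ dz₂ / (z₁ - z₂)²`. -/
def bergman (z₁ z₂ : ℂ) : ℂ := 1 / (z₁ - z₂) ^ 2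

/-- The coefficient of the recursion kernel
`K(z, z₁) = - ω(z₁) / (2 (y(z) - y(-z)) dx(z))`, where `ω(z₁)` is the integral of
`B(·, z₁)` from `z` to `-z`, evaluated through the primitive `w ↦ - 1 / (w - z₁)`. -/
def recKernel (a z z₁ : ℂ) : ℂ :=
  -((-1 / (-z - z₁)) - (-1 / (z - z₁)))
    / (2 * (yMap a z - yMap a (-z)) * deriv (xMap a) z)

/-- `eoW a g n z₁ (z₂, …, z_{n+1})` is the coefficient of the Eynard-Orantin differential
`W_{g,n+1}(z₁, …, z_{n+1})`. One has `W_{0,1} = y dx`, `W_{0,2} = B`, and otherwise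
`W_{g,n+1}(z₁, …) = Res_{z = 0} K(z, z₁) [ W_{g-1,n+2}(z, z̄, z₂, …)
  + ∑ W_{g₁,|I|+1}(z, z_I) W_{g₂,|J|+1}(z̄, z_J) ]`
with `z̄ = -z`, the sum being over `g₁ + g₂ = g` and `I ⊔ J = {2, …, n+1}` such that no factor
is `W_{0,1}`. The terms of the sum with a factor `W_{0,2}` are those that are often written
separately, as `∑ⱼ (W_{0,2}(z, zⱼ) W_{g,n}(z̄, …) + W_{0,2}(z̄, zⱼ) W_{g,n}(z, …))` if
`2g - 2 + (n + 1) ≥ 2`. Every term contains `z̄` once, and `dz̄ = - dz` gives the minus sign in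
front of the bracket. -/
def eoW (a : ℂ) : (g n : ℕ) → ℂ → (Fin n → ℂ) → ℂ
  | 0, 0 => fun z₁ _ => yMap a z₁ * deriv (xMap a) z₁
  | 0, 1 => fun z₁ zs => bergman z₁ (zs 0)
  | g, n => fun z₁ zs => residueZero fun z =>
      recKernel a z z₁ *
        -((if _h : 1 ≤ g then
              eoW a (g - 1) (n + 1) z (Fin.cons (-z) zs : Fin (n + 1) → ℂ) else 0)
          + ∑ g₁ : Fin (g + 1), ∑ I : Finset (Fin n),
              if _h : 1 ≤ 2 * (g₁ : ℕ) + I.card ∧ 1 ≤ 2 * (g - (g₁ : ℕ)) + Iᶜ.card then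
                eoW a g₁ I.card z (fun i => zs (I.orderEmbOfFin rfl i))
                  * eoW a (g - (g₁ : ℕ)) Iᶜ.card (-z) (fun i => zs (Iᶜ.orderEmbOfFin rfl i))
              else 0)
  termination_by g n => 2 * g + n
  decreasing_by
    · omega
    · have h2 := Finset.card_compl_add_card I
      simp only [Fintype.card_fin] at h2
      omega
    · have h2 := Finset.card_compl_add_card I
      simp only [Fintype.card_fin] at h2
      omega

/-! ### Closed free energies -/

/-- `Φ(z) = ∫ y dx` from `z₀` to `z`, where `y dx = (4 z⁴ - 12 q₀ z²) dz`. -/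
def phi (a z₀ z : ℂ) : ℂ :=
  (4 / 5 * z ^ 5 - 4 * a * z ^ 3) - (4 / 5 * z₀ ^ 5 - 4 * a * z₀ ^ 3)

/-- `F_g` for `g ≥ 2`. -/
def freeEnergyHigher (a z₀ : ℂ) (g : ℕ) : ℂ :=
  1 / (2 - 2 * (g : ℂ)) * residueZero fun z => phi a z₀ z * eoW a g 0 z ![]

/-- The coefficient of `y dx` in the coordinate `ζ = √x` near the point `∞` of the spectral curve,
where `z = ζ (1 + 2 q₀ / ζ²)^{1/2}` and `dx = 2 ζ dζ`. -/
def ydxZeta (a ζ : ℂ) : ℂ :=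
  yMap a (ζ * (1 + 2 * a / ζ ^ 2) ^ (1 / 2 : ℂ)) * (2 * ζ)

/-- The polynomial `V` in `ζ = √x` with `V(0) = 0` such that `y dx - dV = O(ζ⁻²) dζ` at `∞`
(the polar part at `∞` of a primitive of `y dx`). As `y dx = (4 ζ⁴ + O(ζ²)) dζ`, it has degree 5;
its coefficient of `ζ^{k+1}` is the Laurent coefficient of `ζ^k` in `y dx / dζ`, divided by
`k + 1`. -/
def polarPrimitive (a ζ : ℂ) : ℂ :=
  ∑ k ∈ Finset.range 5,
    contourInfinity (fun w => ydxZeta a w / w ^ (k + 1)) / ((k : ℂ) + 1) * ζ ^ (k + 1)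

/-- `F_0 = - (1/2) Res_∞ V y dx`. The form `y dx` has its only pole at `∞`, without residue, and
the curve has genus zero, so that the other terms of the general definition are absent. -/
def freeEnergyZero (a : ℂ) : ℂ :=
  1 / 2 * contourInfinity fun ζ => polarPrimitive a ζ * ydxZeta a ζ

/-- `F₁` is a genus one free energy on `U`:
`F₁ = - (1/2) log τ_B - (1/24) log y'(0)`. Here `y'(0)` is the derivative of `y` at the
ramification point `z = 0` with respect to the local coordinate `√(x - x(0)) = z`, and `τ_B` is the
Bergman tau-function (unique up to a constant factor):
`d log τ_B = (Res_{z = 0} B(z, z̄) / dx(z)) d(x(0))`, where `z̄ = -z` and `dz̄ = - dz`.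
The functions `lt` and `ly` are the two logarithms; the branch of the second one is arbitrary. -/
def IsFreeEnergyOne (U : Set ℂ) (q₀ F₁ : ℂ → ℂ) : Prop :=
  ∃ lt ly : ℂ → ℂ,
    (∀ t ∈ U, HasDerivAt lt
      (residueZero (fun z => -bergman z (-z) / deriv (xMap (q₀ t)) z)
        * deriv (fun s => xMap (q₀ s) 0) t) t) ∧
    ContinuousOn ly U ∧
    (∀ t ∈ U, Complex.exp (ly t) = deriv (yMap (q₀ t)) 0) ∧
    ∀ t ∈ U, F₁ t = -(1 / 2) * lt t - 1 / 24 * ly t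

/-- The closed free energies `F_g(t)`; the genus one free energy, which involves the choice of a
branch of a logarithm and of a constant, is an argument. -/
def closedFreeEnergy (q₀ F₁ : ℂ → ℂ) (z₀ : ℂ) : ℕ → ℂ → ℂ
  | 0 => fun t => freeEnergyZero (q₀ t)
  | 1 => F₁
  | g + 2 => fun t => freeEnergyHigher (q₀ t) z₀ (g + 2)

/-- The formal Laurent series `∑_{g ≥ 0} ħ^{2g-2} F_g(t)`. -/
def freeEnergySeries (F : ℕ → ℂ → ℂ) : LaurentSeries (ℂ → ℂ) :=
  HahnSeries.single (-2 : ℤ) (1 : ℂ → ℂ) *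
    HahnSeries.ofPowerSeries ℤ (ℂ → ℂ)
      (PowerSeries.mk fun n => if Even n then F (n / 2) else 0)

end PainleveOne

end

/-! Both sides are read off from one partition function Z = Σ r^m `zCoeff m`, whose coefficients are
polynomials in times x₀, x₁, …. It satisfies Virasoro-type constraints (∂_d - ∂_{d+1}) Z = r · `vir
d` Z and equals 1 at the origin. With s = 1/(3q₀) one has y dx = -(4/s) z² (1 - s z²) dz; the two
powers of z are the reason for the two neighbouring derivatives. The constraints are integrable
because the operators `vir d` close under commutators, so a polynomial Poincaré lemma produces Z
order by order (`shiftDiff_vir_comm`, `exists_next`).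

Spectral side. Let F = r log Z. Weighting the constraints with y^{d+1}, y = 1/(s z²), and summing
over d gives a loop equation. Its polar part at z = 0 is the topological recursion, so W_{g,n+1} is
s^{5g-5} times an (n+1)-fold derivative of F at the origin (`eoW_eq`). For g ≥ 2 the residue
defining F_g then reduces to the one-point number ∂₀F at the origin (`freeEnergyHigher_eq`); F_0 and
F_1 are computed directly.

Painlevé side. By homogeneity everything depends on ħ through r = ħ s^{5/2}. The specialization x_k
= -u^{2k+1}/(2k+1) turns the summed constraints into a second order equation in u for a function
ψ(u, r), and the string and dilaton equations eliminate ∂₀ from it. In terms of logarithmic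
derivatives this is the system `HeatEq`, `TimeEq`, which determines φ as a series in r with
coefficients polynomial in u (`heat_time_unique`). A second solution comes from the Lax pair ħ²Ψ_tt
= (x + 2q)Ψ, ħΨ_x = pΨ + 2(x - q)ħΨ_t, with u⁻² = s(x + 2q₀); there `tDer` is 8s⁻² ∂_t at fixed x,
and the determinant of the Lax matrix brings in the Hamiltonian. Comparing the two values of φ at u
= 0 gives s³(σ - σ₀) = r ∂₀ log Z at the origin (`hamiltonian_eq_zDerivSeries`).

Finally ds/dt = (3/4) s³, so t-derivatives of powers of s are again powers of s, and the two
computations agree genus by genus. -/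

noncomputable section
namespace PainleveOne

open MvPolynomial

/-! ### Virasoro operators on polynomials in the times -/

/-- Polynomials in the times `x₀, x₁, …`. -/
abbrev TimeRing := MvPolynomial ℕ ℂ

/-- The constant `1 / 32`. -/
def unitConst : TimeRing := C (1 / 32)

/-- The first order part of the Virasoro operator, `¼ ∑ₘ (2m + 1) xₘ ∂_{d+m-1}`. -/
def virB (d : ℕ) : Derivation ℂ TimeRing TimeRing :=
  mkDerivation ℂ fun k => if d ≤ k + 1 then
    8 * unitConst * (2 * ((k + 1 - d : ℕ) : TimeRing) + 1) * X (k + 1 - d) else 0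

/-- The second order part of the Virasoro operator, `⅛ ∑_{i+j=d-2} ∂ᵢ ∂ⱼ`. -/
def virC (d : ℕ) (p : TimeRing) : TimeRing :=
  4 * unitConst * ∑ i ∈ Finset.range (d - 1), pderiv i (pderiv (d - 2 - i) p)

/-- The multiplication part of the Virasoro operator. -/
def virA (d : ℕ) : TimeRing :=
  if d = 0 then 4 * unitConst * X 0 ^ 2 else if d = 1 then unitConst else 0

/-- The Virasoro operators. -/
def vir (d : ℕ) (p : TimeRing) : TimeRing := virB d p + virC d p + virA d * p

/-- The difference `∂_d - ∂_{d+1}`. -/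
def shiftDiff (d : ℕ) (p : TimeRing) : TimeRing := pderiv d p - pderiv (d + 1) p

lemma derivation_unitConst (D : Derivation ℂ TimeRing TimeRing) : D unitConst = 0 :=
  derivation_C D _

lemma derivation_ofNat {A : Type*} [CommRing A] [Algebra ℂ A] (D : Derivation ℂ A A) (n : ℕ)
    [n.AtLeastTwo] : D (no_index (OfNat.ofNat n : A)) = 0 := by
  rw [← Nat.cast_ofNat (R := A), D.map_natCast]

lemma pderiv_comm (i j : ℕ) (p : TimeRing) :
    pderiv i (pderiv j p) = pderiv j (pderiv i p) := by
  have h : ⁅(pderiv i : Derivation ℂ TimeRing TimeRing),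
      (pderiv j : Derivation ℂ TimeRing TimeRing)⁆ = 0 := by
    apply derivation_ext
    intro k
    rw [Derivation.commutator_apply]
    simp only [pderiv_X, Pi.single_apply]
    split_ifs <;> simp
  have := congrArg (fun D => D p) h
  simp only [Derivation.commutator_apply, Derivation.coe_zero, Pi.zero_apply] at this
  exact sub_eq_zero.1 this

lemma virB_X_of_le {d k : ℕ} (h : d ≤ k + 1) : virB d (X k) =
    8 * unitConst * (2 * ((k + 1 - d : ℕ) : TimeRing) + 1) * X (k + 1 - d) := by
  simp [virB, h]

lemma virB_X_of_lt {d k : ℕ} (h : k + 1 < d) : virB d (X k) = 0 := by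
  simp [virB, not_le.2 h]

lemma derivation_coeff_mul (D : Derivation ℂ TimeRing TimeRing) (n : ℕ) (p : TimeRing) :
    D (8 * unitConst * (2 * (n : TimeRing) + 1) * p)
      = 8 * unitConst * (2 * (n : TimeRing) + 1) * D p := by
  simp only [Derivation.leibniz, map_add, derivation_unitConst, derivation_ofNat,
    Derivation.map_natCast, Derivation.map_one_eq_zero, smul_eq_mul]
  ring

/-- A commutator of derivations is a derivation, so it suffices to compare on the variables. All
first order commutation relations below are checked this way. -/
lemma commutator_ext {D₁ D₂ D₃ : Derivation ℂ TimeRing TimeRing}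
    (h : ∀ k, D₁ (D₂ (X k)) - D₂ (D₁ (X k)) = D₃ (X k)) (p : TimeRing) :
    D₁ (D₂ p) - D₂ (D₁ p) = D₃ p := by
  have : ⁅D₁, D₂⁆ = D₃ := derivation_ext fun k => by rw [Derivation.commutator_apply, h]
  rw [← this, Derivation.commutator_apply]

/-- Only the term of `virB` containing x_i contributes. The operator with d = 0 is treated apart: it
lowers the index of the derivative, and there is nothing below ∂₀. -/
lemma virB_succ_pderiv (c i : ℕ) (p : TimeRing) :
    virB (c + 1) (pderiv i p) - pderiv i (virB (c + 1) p)
      = -(8 * unitConst * (2 * (i : TimeRing) + 1) * pderiv (c + i) p) := by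
  have := commutator_ext (D₁ := virB (c + 1)) (D₂ := pderiv i)
    (D₃ := -((8 * unitConst * (2 * (i : TimeRing) + 1)) • pderiv (c + i))) ?_ p
  · simpa using this
  intro k
  rcases le_or_gt c k with h | h
  · rw [virB_X_of_le (by omega), derivation_coeff_mul]
    simp only [Derivation.neg_apply, Derivation.smul_apply, pderiv_X, Pi.single_apply, smul_eq_mul]
    by_cases hk : k = c + i
    · subst hk
      have : c + i + 1 - (c + 1) = i := by omega
      simp only [this, if_true]
      split_ifs <;> simp
    · have : ¬ k + 1 - (c + 1) = i := by omega
      simp only [this, if_false, hk]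
      split_ifs <;> simp
  · rw [virB_X_of_lt (by omega)]
    simp only [Derivation.neg_apply, Derivation.smul_apply, pderiv_X, Pi.single_apply, smul_eq_mul]
    have : ¬ k = c + i := by omega
    simp only [this, if_false]
    split_ifs <;> simp

lemma virB_zero_pderiv_succ (i : ℕ) (p : TimeRing) :
    virB 0 (pderiv (i + 1) p) - pderiv (i + 1) (virB 0 p)
      = -(8 * unitConst * (2 * ((i + 1 : ℕ) : TimeRing) + 1) * pderiv i p) := by
  have := commutator_ext (D₁ := virB 0) (D₂ := pderiv (i + 1))
    (D₃ := -((8 * unitConst * (2 * ((i + 1 : ℕ) : TimeRing) + 1)) • pderiv i)) ?_ p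
  · simpa using this
  intro k
  rw [virB_X_of_le (by omega), derivation_coeff_mul]
  simp only [Derivation.neg_apply, Derivation.smul_apply, pderiv_X, Pi.single_apply, smul_eq_mul]
  by_cases hk : k = i
  · subst hk; simp
  · have : ¬ k + 1 - 0 = i + 1 := by omega
    simp only [this, if_false, hk]
    split_ifs <;> simp

lemma virB_zero_pderiv_zero (p : TimeRing) :
    virB 0 (pderiv 0 p) - pderiv 0 (virB 0 p) = 0 := by
  have := commutator_ext (D₁ := virB 0) (D₂ := pderiv 0) (D₃ := 0) ?_ p
  · simpa using this
  intro k
  rw [virB_X_of_le (by omega), derivation_coeff_mul]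
  simp only [pderiv_X, Pi.single_apply]
  have : ¬ k + 1 - 0 = 0 := by omega
  simp only [this, if_false]
  split_ifs <;> simp

lemma sum_reflect_weight {S : Type*} [CommRing S] (n : ℕ) (g w : ℕ → S)
    (hg : ∀ p < n, g (n - 1 - p) = g p) :
    2 * ∑ p ∈ Finset.range n, w p * g p
      = ∑ p ∈ Finset.range n, (w p + w (n - 1 - p)) * g p := by
  have : ∑ p ∈ Finset.range n, w p * g p = ∑ p ∈ Finset.range n, w (n - 1 - p) * g p := by
    rw [← Finset.sum_range_reflect]
    refine Finset.sum_congr rfl fun p hp => ?_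
    rw [hg p (Finset.mem_range.1 hp)]
  rw [two_mul]; nth_rewrite 2 [this]
  rw [← Finset.sum_add_distrib]
  exact Finset.sum_congr rfl fun p _ => by ring

/-- The two sums on the left are the parts p ≥ c and, after reflection, p < c of the single sum with
weight 2(p - c) + 1. Since g is invariant under p ↦ c + d - 1 - p, only the symmetrized weight d - c
matters. -/
lemma sum_weight_diff {S : Type*} [CommRing S] [IsDomain S] [CharZero S] (c d : ℕ) (g : ℕ → S)
    (hg : ∀ p < c + d, g (c + d - 1 - p) = g p) :
    ∑ i ∈ Finset.range d, (2 * (i : S) + 1) * g (c + i)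
      - ∑ i ∈ Finset.range c, (2 * (i : S) + 1) * g (d + i)
      = ((d : S) - c) * ∑ p ∈ Finset.range (c + d), g p := by
  have key := sum_reflect_weight (c + d) g (fun p => 2 * ((p : S) - c) + 1) hg
  have e1 : ∑ p ∈ Finset.range (c + d), (2 * ((p : S) - c) + 1) * g p
      = ∑ i ∈ Finset.range d, (2 * (i : S) + 1) * g (c + i)
      - ∑ i ∈ Finset.range c, (2 * (i : S) + 1) * g (d + i) := by
    rw [Finset.sum_range_add, add_comm, sub_eq_add_neg]
    congr 1
    · exact Finset.sum_congr rfl fun i _ => by push_cast; ring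
    · rw [← Finset.sum_neg_distrib, ← Finset.sum_range_reflect]
      refine Finset.sum_congr rfl fun i hi => ?_
      have hi' := Finset.mem_range.1 hi
      have h1 : g (c - 1 - i) = g (d + i) := by
        rw [← hg (d + i) (by omega)]; congr 1; omega
      have h2 : ((c - 1 - i : ℕ) : S) = c - 1 - i := by
        rw [Nat.cast_sub (by omega), Nat.cast_sub (by omega)]; simp
      rw [h1, h2]; ring
  have e2 : ∑ p ∈ Finset.range (c + d), ((2 * ((p : S) - c) + 1)
      + (2 * (((c + d - 1 - p : ℕ) : S) - c) + 1)) * g p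
      = 2 * (((d : S) - c) * ∑ p ∈ Finset.range (c + d), g p) := by
    rw [Finset.mul_sum, Finset.mul_sum]
    refine Finset.sum_congr rfl fun i hi => ?_
    have hi' := Finset.mem_range.1 hi
    have h2 : ((c + d - 1 - i : ℕ) : S) = c + d - 1 - i := by
      rw [Nat.cast_sub (by omega), Nat.cast_sub (by omega)]; simp
    rw [h2]; ring
  rw [e2] at key
  rw [← e1]
  exact mul_left_cancel₀ two_ne_zero key

lemma virB_virC_succ (c d : ℕ) (p : TimeRing) :
    virB (c + 1) (virC (d + 1) p) - virC (d + 1) (virB (c + 1) p)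
      = -(64 * unitConst ^ 2 * ∑ i ∈ Finset.range d, (2 * (i : TimeRing) + 1) *
        pderiv (c + i) (pderiv (c + d - 1 - (c + i)) p)) := by
  have e : ∀ i ∈ Finset.range d, virB (c + 1) (pderiv i (pderiv (d - 1 - i) p))
      - pderiv i (pderiv (d - 1 - i) (virB (c + 1) p))
      = -(8 * unitConst * ((2 * (i : TimeRing) + 1) *
        pderiv (c + i) (pderiv (c + d - 1 - (c + i)) p)
        + (2 * ((d - 1 - i : ℕ) : TimeRing) + 1) *
        pderiv (c + (d - 1 - i)) (pderiv (c + d - 1 - (c + (d - 1 - i))) p))) := by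
    intro i hi
    have hi' := Finset.mem_range.1 hi
    have h1 := virB_succ_pderiv c i (pderiv (d - 1 - i) p)
    have h2 := congrArg (pderiv i) (virB_succ_pderiv c (d - 1 - i) p)
    rw [map_sub, map_neg, derivation_coeff_mul] at h2
    have n1 : c + d - 1 - (c + i) = d - 1 - i := by omega
    have n2 : c + d - 1 - (c + (d - 1 - i)) = i := by omega
    rw [n1, n2, pderiv_comm (c + (d - 1 - i)) i]
    linear_combination h1 + h2
  have hs : virB (c + 1) (virC (d + 1) p) - virC (d + 1) (virB (c + 1) p)
      = 4 * unitConst * ∑ i ∈ Finset.range d, (virB (c + 1) (pderiv i (pderiv (d - 1 - i) p))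
      - pderiv i (pderiv (d - 1 - i) (virB (c + 1) p))) := by
    have := derivation_coeff_mul (virB (c + 1)) 0
      (∑ i ∈ Finset.range d, pderiv i (pderiv (d - 1 - i) p))
    simp only [virC, Nat.add_sub_cancel, show d + 1 - 2 = d - 1 by omega]
    simp only [Derivation.leibniz, derivation_unitConst, derivation_ofNat, smul_eq_mul, map_sum,
      Finset.sum_sub_distrib]
    ring
  rw [hs, Finset.sum_congr rfl e, Finset.sum_neg_distrib, ← Finset.mul_sum,
    Finset.sum_add_distrib]
  have := Finset.sum_range_reflect (fun i => (2 * (i : TimeRing) + 1) *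
        pderiv (c + i) (pderiv (c + d - 1 - (c + i)) p)) d
  rw [this]; ring

lemma virB_comm_succ (c d : ℕ) (p : TimeRing) :
    virB (c + 1) (virB (d + 1) p) - virB (d + 1) (virB (c + 1) p)
      = 16 * unitConst * ((c : TimeRing) - d) * virB (c + d + 1) p := by
  have := commutator_ext (D₁ := virB (c + 1)) (D₂ := virB (d + 1))
    (D₃ := (16 * unitConst * ((c : TimeRing) - d)) • virB (c + d + 1)) ?_ p
  · simpa using this
  intro k
  simp only [Derivation.smul_apply, smul_eq_mul]
  rcases le_or_gt (c + d) k with h | h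
  · rw [virB_X_of_le (by omega), virB_X_of_le (by omega), virB_X_of_le (by omega),
      derivation_coeff_mul, derivation_coeff_mul, virB_X_of_le (by omega), virB_X_of_le (by omega)]
    obtain ⟨l, rfl⟩ := Nat.exists_eq_add_of_le h
    have h1 : c + d + l + 1 - (d + 1) = c + l := by omega
    have h2 : c + d + l + 1 - (c + 1) = d + l := by omega
    have h3 : c + l + 1 - (c + 1) = l := by omega
    have h4 : d + l + 1 - (d + 1) = l := by omega
    have h5 : c + d + l + 1 - (c + d + 1) = l := by omega
    rw [h1, h2, h3, h4, h5]; push_cast; ring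
  · rw [virB_X_of_lt (show k + 1 < c + d + 1 by omega)]
    have : ∀ a b : ℕ, k < a + b → virB (a + 1) (virB (b + 1) (X k)) = 0 := by
      intro a b hab
      rcases le_or_gt b k with hb | hb
      · rw [virB_X_of_le (by omega), derivation_coeff_mul, virB_X_of_lt (by omega), mul_zero]
      · rw [virB_X_of_lt (by omega), map_zero]
    rw [this c d h, this d c (by omega)]; simp

lemma virA_succ (d : ℕ) : virA (d + 1) = if d = 0 then unitConst else 0 := by
  simp [virA]

lemma virC_add (d : ℕ) (p q : TimeRing) : virC d (p + q) = virC d p + virC d q := by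
  simp only [virC, map_add, Finset.sum_add_distrib, mul_add]

lemma virC_sum {ι : Type*} (d : ℕ) (s : Finset ι) (f : ι → TimeRing) :
    virC d (∑ i ∈ s, f i) = ∑ i ∈ s, virC d (f i) := by
  classical
  induction s using Finset.induction_on with
  | empty => simp [virC]
  | insert a s ha ih => rw [Finset.sum_insert ha, Finset.sum_insert ha, virC_add, ih]

lemma virC_const_mul (d : ℕ) (a : TimeRing) (ha : ∀ i, pderiv i a = 0) (p : TimeRing) :
    virC d (a * p) = a * virC d p := by
  simp only [virC, Derivation.leibniz, ha, smul_eq_mul, mul_zero, add_zero, Finset.mul_sum]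
  exact Finset.sum_congr rfl fun i _ => by ring

lemma pderiv_virC (i d : ℕ) (p : TimeRing) : pderiv i (virC d p) = virC d (pderiv i p) := by
  simp only [virC, Derivation.leibniz, derivation_unitConst, derivation_ofNat, smul_eq_mul,
    map_sum, mul_zero, add_zero, pderiv_comm i]

lemma virC_comm (c d : ℕ) (p : TimeRing) : virC c (virC d p) = virC d (virC c p) := by
  conv_lhs => rw [virC]
  conv_rhs => rw [virC.eq_def c]
  simp only [pderiv_virC]
  rw [virC_const_mul _ _ (fun i => by simp [Derivation.leibniz, derivation_unitConst,
    derivation_ofNat]), virC_sum]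

/-- The second order parts commute, and the two mixed commutators recombine by `sum_weight_diff`.
The constant `virA (c + d + 1)` is nonzero only for c = d = 0, where the factor c - d kills it. -/
lemma vir_comm_succ (c d : ℕ) (p : TimeRing) :
    vir (c + 1) (vir (d + 1) p) - vir (d + 1) (vir (c + 1) p)
      = 16 * unitConst * ((c : TimeRing) - d) * vir (c + d + 1) p := by
  have hBB := virB_comm_succ c d p
  have h1 := virB_virC_succ c d p
  have h2 := virB_virC_succ d c p
  have hw := sum_weight_diff c d (fun j => pderiv j (pderiv (c + d - 1 - j) p)) (by
    intro j hj
    rw [pderiv_comm]; congr 2; omega)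
  have hC : virC (c + d + 1) p = 4 * unitConst * ∑ j ∈ Finset.range (c + d),
      pderiv j (pderiv (c + d - 1 - j) p) := by
    simp [virC, show c + d + 1 - 2 = c + d - 1 by omega]
  rw [add_comm d c] at h2
  have hCC := virC_comm (c + 1) (d + 1) p
  have ha : ∀ c, ∀ D : Derivation ℂ TimeRing TimeRing, D (virA (c + 1)) = 0 := by
    intro c D; rw [virA_succ]; split_ifs
    · exact derivation_unitConst D
    · exact map_zero D
  have hA : ((c : TimeRing) - d) * virA (c + d + 1) = 0 := by
    rw [virA_succ]; split_ifs with h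
    · obtain ⟨rfl, rfl⟩ : c = 0 ∧ d = 0 := by omega
      simp
    · simp
  simp only [vir, map_add, virC_add, Derivation.leibniz, ha, smul_eq_mul, mul_zero, add_zero,
    virC_const_mul _ _ (fun i => ha _ (pderiv i))]
  rw [hC]
  linear_combination hBB + h1 - h2 + hCC - 64 * unitConst ^ 2 * hw - 16 * unitConst * p * hA

lemma virB_comm_zero_one (p : TimeRing) :
    virB 0 (virB 1 p) - virB 1 (virB 0 p) = -(16 * unitConst * virB 0 p) := by
  have := commutator_ext (D₁ := virB 0) (D₂ := virB 1)
    (D₃ := (-(16 * unitConst)) • virB 0) ?_ p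
  · simpa using this
  intro k
  simp only [Derivation.smul_apply, smul_eq_mul]
  rw [virB_X_of_le (by omega), virB_X_of_le (by omega),
      derivation_coeff_mul, derivation_coeff_mul, virB_X_of_le (by omega), virB_X_of_le (by omega)]
  simp only [Nat.add_sub_cancel, Nat.sub_zero]; push_cast; ring

lemma virB_comm_zero_succ (d : ℕ) (p : TimeRing) :
    virB 0 (virB (d + 2) p) - virB (d + 2) (virB 0 p)
      = -(16 * unitConst * (d + 2 : TimeRing) * virB (d + 1) p)
        + 64 * unitConst ^ 2 * X 0 * pderiv d p := by
  have := commutator_ext (D₁ := virB 0) (D₂ := virB (d + 2))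
    (D₃ := (-(16 * unitConst * (d + 2 : TimeRing))) • virB (d + 1)
      + (64 * unitConst ^ 2 * X 0) • pderiv d) ?_ p
  · simpa using this
  intro k
  simp only [Derivation.smul_apply, smul_eq_mul, Derivation.add_apply, pderiv_X, Pi.single_apply]
  rcases lt_trichotomy k d with h | h | h
  · rw [virB_X_of_lt (show k + 1 < d + 2 by omega), virB_X_of_lt (show k + 1 < d + 1 by omega),
      virB_X_of_le (show 0 ≤ k + 1 by omega),
      derivation_coeff_mul, virB_X_of_lt (by omega), if_neg (by omega)]
    simp
  · subst h
    rw [virB_X_of_lt (by omega), virB_X_of_le (by omega), virB_X_of_le (by omega),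
      derivation_coeff_mul, virB_X_of_le (by omega), if_pos rfl]
    rw [show k + 1 - 0 + 1 - (k + 2) = 0 by omega, show k + 1 - (k + 1) = 0 by omega,
      Nat.sub_zero, map_zero]
    push_cast; ring
  · obtain ⟨l, rfl⟩ := Nat.exists_eq_add_of_lt h
    rw [virB_X_of_le (by omega), virB_X_of_le (by omega), virB_X_of_le (by omega),
      derivation_coeff_mul, derivation_coeff_mul, virB_X_of_le (by omega),
      virB_X_of_le (by omega), if_neg (by omega)]
    have h1 : d + l + 1 + 1 - (d + 2) = l := by omega
    have h2 : d + l + 1 + 1 - 0 + 1 - (d + 2) = l + 1 := by omega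
    have h3 : d + l + 1 + 1 - (d + 1) = l + 1 := by omega
    rw [h1, h2, h3, Nat.sub_zero]; push_cast; ring

/-- Both derivatives in each product are lowered by one. After reindexing, the weights 2j + 3 are
symmetrized by j ↦ d - 1 - j to the constant d + 2. -/
lemma virB_zero_virC (d : ℕ) (p : TimeRing) :
    virB 0 (virC (d + 2) p) - virC (d + 2) (virB 0 p)
      = -(16 * unitConst * (d + 2 : TimeRing) * virC (d + 1) p) := by
  have hz : ∀ (i : ℕ) (q : TimeRing), virB 0 (pderiv i q) - pderiv i (virB 0 q)
      = -(8 * unitConst * (if i = 0 then 0 else (2 * (i : TimeRing) + 1) * pderiv (i - 1) q)) := by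
    intro i q
    cases i with
    | zero => rw [virB_zero_pderiv_zero]; simp
    | succ i => rw [virB_zero_pderiv_succ]; simp; ring
  have e : ∀ i ∈ Finset.range (d + 1), virB 0 (pderiv i (pderiv (d - i) p))
      - pderiv i (pderiv (d - i) (virB 0 p))
      = -(8 * unitConst *
       ((if i = 0 then 0 else (2 * (i : TimeRing) + 1) * pderiv (i - 1) (pderiv (d - i) p))
        + (if d - i = 0 then 0 else
          (2 * ((d - i : ℕ) : TimeRing) + 1) * pderiv (d - i - 1) (pderiv i p)))) := by
    intro i hi
    have h1 := hz i (pderiv (d - i) p)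
    have h2 := congrArg (pderiv i) (hz (d - i) p)
    have h3 : pderiv i (-(8 * unitConst * (if d - i = 0 then 0 else
          (2 * ((d - i : ℕ) : TimeRing) + 1) * pderiv (d - i - 1) p)))
        = -(8 * unitConst * (if d - i = 0 then 0 else
          (2 * ((d - i : ℕ) : TimeRing) + 1) * pderiv (d - i - 1) (pderiv i p))) := by
      split_ifs
      · simp
      · rw [← mul_assoc, map_neg, derivation_coeff_mul, pderiv_comm, mul_assoc (8 * unitConst)]
    rw [h3, map_sub] at h2
    linear_combination h1 + h2
  have hs : virB 0 (virC (d + 2) p) - virC (d + 2) (virB 0 p)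
      = 4 * unitConst * ∑ i ∈ Finset.range (d + 1), (virB 0 (pderiv i (pderiv (d - i) p))
      - pderiv i (pderiv (d - i) (virB 0 p))) := by
    simp only [virC, show d + 2 - 1 = d + 1 by omega, show d + 2 - 2 = d by omega]
    simp only [Derivation.leibniz, derivation_unitConst, derivation_ofNat, smul_eq_mul, map_sum,
      Finset.sum_sub_distrib]
    ring
  have hr := Finset.sum_range_reflect (fun i => if i = 0 then 0 else
    (2 * (i : TimeRing) + 1) * pderiv (i - 1) (pderiv (d - i) p)) (d + 1)
  have hr' : ∑ i ∈ Finset.range (d + 1), (if d - i = 0 then 0 else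
          (2 * ((d - i : ℕ) : TimeRing) + 1) * pderiv (d - i - 1) (pderiv i p))
      = ∑ i ∈ Finset.range (d + 1), (if i = 0 then 0 else
    (2 * (i : TimeRing) + 1) * pderiv (i - 1) (pderiv (d - i) p)) := by
    rw [← hr]
    refine Finset.sum_congr rfl fun i hi => ?_
    have := Finset.mem_range.1 hi
    simp only [Nat.add_sub_cancel, show d - (d - i) = i by omega]
  rw [hs, Finset.sum_congr rfl e, Finset.sum_neg_distrib, ← Finset.mul_sum,
    Finset.sum_add_distrib, hr', Finset.sum_range_succ']
  have hw := sum_reflect_weight d (fun j => pderiv j (pderiv (d - 1 - j) p))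
    (fun j => 2 * (j : TimeRing) + 3) (by
    intro j hj
    rw [pderiv_comm]; congr 2; omega)
  have hw2 : ∑ j ∈ Finset.range d, ((2 * (j : TimeRing) + 3)
      + (2 * ((d - 1 - j : ℕ) : TimeRing) + 3)) * pderiv j (pderiv (d - 1 - j) p)
      = 2 * ((d + 2) * ∑ j ∈ Finset.range d, pderiv j (pderiv (d - 1 - j) p)) := by
    rw [Finset.mul_sum, Finset.mul_sum]
    refine Finset.sum_congr rfl fun i hi => ?_
    have hi' := Finset.mem_range.1 hi
    have h2 : ((d - 1 - i : ℕ) : TimeRing) = d - 1 - i := by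
      rw [Nat.cast_sub (by omega), Nat.cast_sub (by omega)]; simp
    rw [h2]; ring
  have hl : ∑ k ∈ Finset.range d, (if k + 1 = 0 then 0 else
      (2 * ((k + 1 : ℕ) : TimeRing) + 1) * pderiv (k + 1 - 1) (pderiv (d - (k + 1)) p))
      = ∑ j ∈ Finset.range d, (2 * (j : TimeRing) + 3) * pderiv j (pderiv (d - 1 - j) p) := by
    refine Finset.sum_congr rfl fun i hi => ?_
    rw [if_neg (by omega), show d - (i + 1) = d - 1 - i by omega]
    push_cast; ring
  have hC : virC (d + 1) p = 4 * unitConst * ∑ j ∈ Finset.range d,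
      pderiv j (pderiv (d - 1 - j) p) := by
    simp [virC, show d + 1 - 2 = d - 1 by omega]
  rw [hl, hC, if_pos rfl]
  rw [hw2] at hw
  linear_combination (-32 * unitConst ^ 2) * hw

lemma virC_zero (p : TimeRing) : virC 0 p = 0 := by simp [virC]

lemma virC_one (p : TimeRing) : virC 1 p = 0 := by simp [virC]

lemma virA_zero : virA 0 = 4 * unitConst * X 0 ^ 2 := by simp [virA]

lemma virA_one : virA 1 = unitConst := by simp [virA]

lemma virA_add_two (d : ℕ) : virA (d + 2) = 0 := by simp [virA]

lemma pderiv_virA_zero (i : ℕ) :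
    pderiv i (virA 0) = if i = 0 then 8 * unitConst * X 0 else 0 := by
  rw [virA_zero]
  simp only [Derivation.leibniz, Derivation.leibniz_pow, derivation_unitConst, derivation_ofNat,
    pderiv_X, Pi.single_apply, smul_eq_mul]
  by_cases h : i = 0
  · subst h; simp; ring
  · rw [if_neg (fun h' => h h'.symm), if_neg h]; simp

/-- The anomaly caused by x₀². Its first order term cancels the extra term of `virB_comm_zero_succ`;
its constant term for d = 0 is exactly what the constant 1/32 in `virA 1` absorbs. -/
lemma virC_virA_zero_mul (d : ℕ) (p : TimeRing) :
    virC (d + 2) (virA 0 * p) = virA 0 * virC (d + 2) p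
      + 64 * unitConst ^ 2 * X 0 * pderiv d p + if d = 0 then 32 * unitConst ^ 2 * p else 0 := by
  have h : ∀ i ∈ Finset.range (d + 1), pderiv i (pderiv (d - i) (virA 0 * p))
      = virA 0 * pderiv i (pderiv (d - i) p)
        + (if i = 0 then 8 * unitConst * X 0 * pderiv d p else 0)
        + (if i = d then 8 * unitConst * X 0 * pderiv d p else 0)
        + (if i = d then if d = 0 then 8 * unitConst * p else 0 else 0) := by
    intro i hi
    have hi' := Finset.mem_range.1 hi
    simp only [Derivation.leibniz, pderiv_virA_zero, map_add, smul_eq_mul]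
    rcases Nat.eq_zero_or_pos i with rfl | h0
    · rcases Nat.eq_zero_or_pos d with rfl | hd
      · simp [Derivation.leibniz, derivation_unitConst, derivation_ofNat]; ring
      · have : ¬ 0 = d := by omega
        have : ¬ d = 0 := by omega
        simp [*]; ring
    · rcases eq_or_lt_of_le (Nat.lt_succ_iff.1 hi') with rfl | hd
      · have : ¬ i = 0 := by omega
        have h2 : ¬ 0 = i := by omega
        simp [*, Derivation.leibniz, derivation_unitConst, derivation_ofNat, pderiv_X]
      · have : ¬ i = 0 := by omega
        have h2 : ¬ i = d := by omega
        have h3 : ¬ d - i = 0 := by omega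
        simp only [this, h2, h3, if_false]; simp
  rw [virC, virC, show d + 2 - 1 = d + 1 by omega, show d + 2 - 2 = d by omega,
    Finset.sum_congr rfl h]
  simp only [Finset.sum_add_distrib, ← Finset.mul_sum, Finset.sum_ite_eq', Finset.mem_range,
    Nat.lt_succ_self, Nat.succ_pos, if_true]
  split_ifs <;> ring

lemma vir_comm_zero (d : ℕ) (p : TimeRing) :
    vir 0 (vir (d + 1) p) - vir (d + 1) (vir 0 p)
      = -(16 * unitConst * (d + 1 : TimeRing) * vir d p) := by
  have hB0 : ∀ k, virB (k + 1) (virA 0) = if k = 0 then 64 * unitConst ^ 2 * X 0 ^ 2 else 0 := by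
    intro k
    rw [virA_zero]
    simp only [Derivation.leibniz, Derivation.leibniz_pow, derivation_unitConst, derivation_ofNat,
      smul_eq_mul]
    cases k with
    | zero => rw [virB_X_of_le (by omega)]; simp; ring
    | succ k => rw [virB_X_of_lt (by omega)]; simp
  cases d with
  | zero =>
    have h1 := virB_comm_zero_one p
    have h2 := hB0 0
    simp only [vir, virC_zero, virC_one, map_add, Derivation.leibniz, virA_one,
      derivation_unitConst, smul_eq_mul, zero_add] at h1 h2 ⊢
    rw [h2, virA_zero, if_pos trivial]
    push_cast
    simp only [map_zero]
    linear_combination h1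
  | succ d =>
    have h1 := virB_comm_zero_succ d p
    have h2 := hB0 (d + 1)
    have h3 := virB_zero_virC d p
    have h4 := virC_virA_zero_mul d p
    have h5 : (d + 2 : TimeRing) * virA (d + 1) = if d = 0 then 2 * unitConst else 0 := by
      rw [virA_succ]; split_ifs with h
      · subst h; simp
      · simp
    have h6 : (if d = 0 then 32 * unitConst ^ 2 * p else 0)
        = 16 * unitConst * p * if d = 0 then 2 * unitConst else 0 := by split_ifs <;> ring
    simp only [vir, virC_zero, map_add, virC_add, Derivation.leibniz, virA_add_two,
      smul_eq_mul, zero_add, add_assoc, Nat.reduceAdd] at h1 h2 h3 h4 ⊢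
    rw [h4, h2, if_neg (by omega), h6, ← h5]
    push_cast
    simp only [map_zero]
    linear_combination h1 + h3

lemma vir_add (d : ℕ) (p q : TimeRing) : vir d (p + q) = vir d p + vir d q := by
  simp only [vir, map_add, virC_add]; ring

lemma vir_const_mul (d : ℕ) (a : TimeRing) (ha : ∀ D : Derivation ℂ TimeRing TimeRing, D a = 0)
    (p : TimeRing) : vir d (a * p) = a * vir d p := by
  simp only [vir, Derivation.leibniz, virC_const_mul d a (fun i => ha _), ha, smul_eq_mul]; ring

lemma vir_zero_right (d : ℕ) : vir d 0 = 0 := by simp [vir, virC]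

lemma vir_neg (d : ℕ) (p : TimeRing) : vir d (-p) = -vir d p := by
  have := vir_const_mul d (-1) (fun D => by simp) p
  simpa using this

lemma vir_sub (d : ℕ) (p q : TimeRing) : vir d (p - q) = vir d p - vir d q := by
  rw [sub_eq_add_neg, vir_add, vir_neg, ← sub_eq_add_neg]

lemma pderiv_vir (i d : ℕ) (p : TimeRing) : pderiv i (vir d p) = vir d (pderiv i p)
    - (virB d (pderiv i p) - pderiv i (virB d p)) + pderiv i (virA d) * p := by
  simp only [vir, map_add, pderiv_virC, Derivation.leibniz, smul_eq_mul]; ring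

/-- The integrability condition. Moving `shiftDiff c` past `vir d` leaves `vir d (vir c p')` plus a
multiple of a single `shiftDiff` of p. Antisymmetrized in c and d, the multiples combine, by the
hypothesis again, into a multiple of one `vir` of p', which cancels the commutator of the two
operators `vir`. -/
lemma shiftDiff_vir_aux {p p' : TimeRing} (h : ∀ d, shiftDiff d p = vir d p') {c d : ℕ}
    (hcd : c < d) : shiftDiff c (vir d p) = shiftDiff d (vir c p) := by
  have hv : ∀ c d, vir d (pderiv c p) - vir d (pderiv (c + 1) p) = vir d (vir c p') := by
    intro c d; rw [← vir_sub, ← h]; rfl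
  obtain ⟨d, rfl⟩ : ∃ d', d = d' + 1 := ⟨d - 1, by omega⟩
  have hA : ∀ i d, pderiv i (virA (d + 1)) = 0 := by
    intro i d; rw [virA_succ]; split_ifs
    · exact derivation_unitConst _
    · exact map_zero _
  cases c with
  | zero =>
    have h1 := hv 0 (d + 1)
    have h2 := hv (d + 1) 0
    have h3 := vir_comm_zero d p'
    have h4 := h d
    simp only [shiftDiff, pderiv_vir, hA, pderiv_virA_zero] at h4 ⊢
    rw [if_neg (by omega), if_neg (by omega), virB_succ_pderiv, virB_succ_pderiv,
      virB_zero_pderiv_succ, virB_zero_pderiv_succ]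
    push_cast
    simp only [add_zero]
    linear_combination h1 - h2 - h3 - 16 * unitConst * (d + 1 : TimeRing) * h4
  | succ c =>
    have h1 := hv (c + 1) (d + 1)
    have h2 := hv (d + 1) (c + 1)
    have h3 := vir_comm_succ c d p'
    have h4 := h (c + d + 1)
    simp only [shiftDiff, pderiv_vir, hA] at h4 ⊢
    simp only [virB_succ_pderiv]
    rw [show d + (c + 1) = c + d + 1 by omega, show d + (c + 1 + 1) = c + d + 1 + 1 by omega,
      show c + (d + 1) = c + d + 1 by omega, show c + (d + 1 + 1) = c + d + 1 + 1 by omega]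
    push_cast
    linear_combination h1 - h2 - h3 + 16 * unitConst * ((c : TimeRing) - d) * h4

lemma shiftDiff_vir_comm {p p' : TimeRing} (h : ∀ d, shiftDiff d p = vir d p') (c d : ℕ) :
    shiftDiff c (vir d p) = shiftDiff d (vir c p) := by
  rcases lt_trichotomy c d with hc | rfl | hc
  · exact shiftDiff_vir_aux h hc
  · rfl
  · exact (shiftDiff_vir_aux h hc).symm

end PainleveOne

end

noncomputable section
namespace PainleveOne

open MvPolynomial

/-! ### The partition function -/

lemma exists_vars_bound (p : TimeRing) : ∃ M : ℕ, ∀ k ∈ p.vars, k < M := by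
  obtain ⟨M, hM⟩ := p.vars.bddAbove
  exact ⟨M + 1, fun k hk => Nat.lt_succ_of_le (hM hk)⟩

lemma pderiv_eq_zero_of_bound {p : TimeRing} {M : ℕ} (h : ∀ k ∈ p.vars, k < M) {k : ℕ}
    (hk : M ≤ k) : pderiv k p = 0 :=
  pderiv_eq_zero_of_notMem_vars fun hk' => absurd (h k hk') (by omega)

lemma virB_eq_zero_of_bound {p : TimeRing} {M : ℕ} (h : ∀ k ∈ p.vars, k < M) {d : ℕ}
    (hd : M + 1 ≤ d) : virB d p = 0 :=
  derivation_eq_zero_of_forall_mem_vars fun k hk => virB_X_of_lt (by have := h k hk; omega)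

lemma pderiv_pderiv_eq_zero_of_bound {p : TimeRing} {M : ℕ} (h : ∀ k ∈ p.vars, k < M) {i j : ℕ}
    (hij : M ≤ i ∨ M ≤ j) : pderiv i (pderiv j p) = 0 := by
  rcases hij with h1 | h1
  · rw [pderiv_comm, pderiv_eq_zero_of_bound h h1, map_zero]
  · rw [pderiv_eq_zero_of_bound h h1, map_zero]

lemma virC_eq_zero_of_bound {p : TimeRing} {M : ℕ} (h : ∀ k ∈ p.vars, k < M) {d : ℕ}
    (hd : 2 * M + 1 ≤ d) : virC d p = 0 := by
  rw [virC, Finset.sum_eq_zero, mul_zero]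
  intro i hi
  have := Finset.mem_range.1 hi
  exact pderiv_pderiv_eq_zero_of_bound h (by omega)

lemma vir_eq_zero_of_bound {p : TimeRing} {M : ℕ} (h : ∀ k ∈ p.vars, k < M) {d : ℕ}
    (hd : 2 * M + 2 ≤ d) : vir d p = 0 := by
  obtain ⟨d, rfl⟩ : ∃ d', d = d' + 2 := ⟨d - 2, by omega⟩
  rw [vir, virB_eq_zero_of_bound h (by omega), virC_eq_zero_of_bound h (by omega), virA_add_two]
  simp

lemma derivation_sum_apply {A ι : Type*} [CommRing A] [Algebra ℂ A] (s : Finset ι)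
    (D : ι → Derivation ℂ A A) (p : A) : (∑ i ∈ s, D i) p = ∑ i ∈ s, D i p := by
  classical
  induction s using Finset.induction_on with
  | empty => simp
  | insert a s ha ih => rw [Finset.sum_insert ha, Finset.sum_insert ha, Derivation.add_apply, ih]

/-- The operator dividing a monomial of degree `n` by `n + c`. -/
def degreeInv (c : ℕ) : TimeRing →ₗ[ℂ] TimeRing :=
  (basisMonomials ℕ ℂ).constr ℂ fun s => monomial s (1 / ((s.degree : ℂ) + c))

lemma degreeInv_monomial (c : ℕ) (s : ℕ →₀ ℕ) (a : ℂ) :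
    degreeInv c (monomial s a) = monomial s (a / ((s.degree : ℂ) + c)) := by
  have : monomial s a = a • basisMonomials ℕ ℂ s := by simp [smul_monomial]
  rw [this, map_smul, degreeInv, Module.Basis.constr_basis, smul_monomial]
  congr 1; simp [div_eq_mul_inv]

lemma pderiv_degreeInv (c j : ℕ) (p : TimeRing) :
    pderiv j (degreeInv c p) = degreeInv (c + 1) (pderiv j p) := by
  induction p using MvPolynomial.induction_on' with
  | add p q hp hq => simp only [map_add, hp, hq]
  | monomial s a =>
    rw [degreeInv_monomial, pderiv_monomial, pderiv_monomial, degreeInv_monomial]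
    rcases Nat.eq_zero_or_pos (s j) with h | h
    · simp [h]
    · congr 1
      have hs : s - Finsupp.single j 1 + Finsupp.single j 1 = s := by
        ext i; simp only [Finsupp.add_apply, Finsupp.tsub_apply, Finsupp.single_apply]
        split_ifs with hi
        · subst hi; omega
        · simp
      have hd : (s - Finsupp.single j 1).degree + 1 = s.degree := by
        conv_rhs => rw [← hs, map_add, Finsupp.degree_single]
      rw [← hd]; push_cast; ring

/-- The Euler operator `∑ xₖ ∂ₖ`. -/
def degreeDer : Derivation ℂ TimeRing TimeRing := mkDerivation ℂ X

lemma degreeDer_monomial (s : ℕ →₀ ℕ) (a : ℂ) :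
    degreeDer (monomial s a) = (s.degree : ℂ) • monomial s a := by
  have h1 : degreeDer (monomial s a)
      = (∑ i ∈ s.support, (X i : TimeRing) • pderiv i : Derivation ℂ TimeRing TimeRing)
        (monomial s a) := by
    apply derivation_eq_of_forall_mem_vars
    intro k hk
    have hk' : k ∈ s.support := by
      by_cases ha : a = 0
      · simp [ha] at hk
      · rwa [vars_monomial ha] at hk
    rw [degreeDer, mkDerivation_X, derivation_sum_apply,
      Finset.sum_eq_single k]
    · simp
    · intro i _ hi; simp [pderiv_X_of_ne hi.symm]
    · exact fun h => absurd hk' h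
  rw [h1, derivation_sum_apply]
  simp only [Derivation.smul_apply, smul_eq_mul, X_mul_pderiv_monomial]
  rw [← Finset.sum_smul, Nat.cast_smul_eq_nsmul ℂ, Finsupp.degree_apply]

lemma degreeDer_degreeInv (p : TimeRing) :
    degreeInv 1 p + degreeDer (degreeInv 1 p) = p := by
  induction p using MvPolynomial.induction_on' with
  | add p q hp hq => simp only [map_add]; linear_combination hp + hq
  | monomial s a =>
    rw [degreeInv_monomial, degreeDer_monomial, smul_monomial, ← map_add (monomial s)]
    congr 1
    have : (s.degree : ℂ) + 1 ≠ 0 := by exact_mod_cast Nat.succ_ne_zero s.degree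
    rw [smul_eq_mul]; push_cast; field_simp; ring

lemma degreeDer_eq_sum {p : TimeRing} {N : ℕ} (h : ∀ k, N ≤ k → pderiv k p = 0) :
    degreeDer p = ∑ k ∈ Finset.range N, X k * pderiv k p := by
  have h1 : degreeDer p = ∑ k ∈ Finset.range (max N (exists_vars_bound p).choose),
      X k * pderiv k p := by
    have h2 := derivation_eq_of_forall_mem_vars (D₁ := degreeDer) (f := p)
      (D₂ := ∑ k ∈ Finset.range (max N (exists_vars_bound p).choose),
        (X k : TimeRing) • (pderiv k : Derivation ℂ TimeRing TimeRing)) ?_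
    · rw [h2, derivation_sum_apply]; simp
    intro k hk
    have hk' := (exists_vars_bound p).choose_spec k hk
    rw [degreeDer, mkDerivation_X, derivation_sum_apply,
      Finset.sum_eq_single k]
    · simp
    · intro i _ hi; simp [pderiv_X_of_ne hi.symm]
    · intro h; simp at h; omega
  rw [h1]
  symm
  apply Finset.sum_subset
  · intro k; simp; omega
  · intro k _ hk; rw [h k (by simpa using hk), mul_zero]

/-- The Poincaré lemma for polynomial one-forms. -/
lemma exists_potential {e : ℕ → TimeRing} {N : ℕ} (h0 : ∀ k, N ≤ k → e k = 0)
    (h1 : ∀ j k, N ≤ j → pderiv j (e k) = 0) (h : ∀ j k, pderiv j (e k) = pderiv k (e j)) :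
    ∃ G : TimeRing, (∀ j, pderiv j G = e j) ∧ constantCoeff G = 0 := by
  -- The homotopy formula G = Σ x_k ∫₀¹ e_k(τx) dτ; on a monomial of degree n the integral is
  -- division by n + 1, that is `degreeInv 1`.
  refine ⟨∑ k ∈ Finset.range N, X k * degreeInv 1 (e k), fun j => ?_, ?_⟩
  · have e1 : ∀ k ∈ Finset.range N, pderiv j (X k * degreeInv 1 (e k))
        = (if k = j then degreeInv 1 (e j) else 0) + X k * pderiv k (degreeInv 1 (e j)) := by
      intro k _
      rw [Derivation.leibniz, pderiv_degreeInv, h j k, ← pderiv_degreeInv, pderiv_X,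
        Pi.single_apply]
      by_cases hk : k = j
      · subst hk; simp; ring
      · simp [hk]
    rw [map_sum, Finset.sum_congr rfl e1, Finset.sum_add_distrib,
      ← degreeDer_eq_sum (fun k hk => by rw [pderiv_degreeInv, h1 k j hk, map_zero]),
      Finset.sum_ite_eq']
    split_ifs with hj
    · exact degreeDer_degreeInv _
    · rw [h0 j (by simpa using hj)]; simp
  · rw [map_sum]; exact Finset.sum_eq_zero fun k _ => by simp

lemma sum_Ico_telescope {M : Type*} [AddCommGroup M] (f : ℕ → M) {c N : ℕ} (h : c ≤ N) :
    ∑ i ∈ Finset.Ico c N, (f i - f (i + 1)) = f c - f N := by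
  induction N, h using Nat.le_induction with
  | base => simp
  | succ N h ih => rw [Finset.sum_Ico_succ_top h, ih]; abel

/-- If p'' exists, telescoping forces ∂_d p'' = Σ_{j ≥ d} `vir j p`, a finite sum. These expressions
form a closed one-form by `shiftDiff_vir_comm`, hence have a potential. -/
lemma exists_next {p p' : TimeRing} (h : ∀ d, shiftDiff d p = vir d p') :
    ∃ p'' : TimeRing, (∀ d, shiftDiff d p'' = vir d p) ∧ constantCoeff p'' = 0 := by
  obtain ⟨M, hM⟩ := exists_vars_bound p
  choose B hB using fun d => exists_vars_bound (vir d p)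
  -- Large enough for two purposes: `vir d p` vanishes for d ≥ N, and no `vir d p` involves a
  -- variable of index ≥ N.
  set N := (2 * M + 2) + ∑ d ∈ Finset.range (2 * M + 2), B d with hN
  have z1 : ∀ d, N ≤ d → vir d p = 0 := fun d hd => vir_eq_zero_of_bound hM (by omega)
  have z2 : ∀ d k, N ≤ k → pderiv k (vir d p) = 0 := by
    intro d k hk
    rcases lt_or_ge d (2 * M + 2) with hd | hd
    · apply pderiv_eq_zero_of_bound (hB d)
      have := Finset.single_le_sum (f := B) (fun _ _ => Nat.zero_le _) (Finset.mem_range.2 hd)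
      omega
    · rw [vir_eq_zero_of_bound hM hd, map_zero]
  set e : ℕ → TimeRing := fun d => ∑ j ∈ Finset.Ico d N, vir j p with he
  have e0 : ∀ d, N ≤ d → e d = 0 := fun d hd => by simp [he, Finset.Ico_eq_empty_of_le hd]
  have e1 : ∀ k d, N ≤ k → pderiv k (e d) = 0 := by
    intro k d hk
    simp only [he, map_sum]
    exact Finset.sum_eq_zero fun j _ => z2 j k hk
  have tel : ∀ (f : TimeRing) (d : ℕ), (∀ k, N ≤ k → pderiv k f = 0) →
      ∑ j ∈ Finset.Ico d N, shiftDiff j f = pderiv d f := by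
    intro f d hf
    rcases le_or_gt d N with hd | hd
    · have := sum_Ico_telescope (fun i => pderiv i f) hd
      rw [hf N le_rfl, sub_zero] at this
      exact this
    · rw [Finset.Ico_eq_empty_of_le hd.le, hf d hd.le, Finset.sum_empty]
  have key : ∀ c d, shiftDiff c (e d) = pderiv d (vir c p) := by
    intro c d
    rw [← tel _ d (fun k hk => z2 c k hk)]
    simp only [he, shiftDiff, map_sum, ← Finset.sum_sub_distrib]
    exact Finset.sum_congr rfl fun j _ => shiftDiff_vir_comm h c j
  have sym : ∀ c d, pderiv c (e d) = pderiv d (e c) := by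
    intro c d
    rw [← tel (e d) c (fun k hk => e1 k d hk)]
    simp only [he, map_sum]
    exact Finset.sum_congr rfl fun i _ => key i d
  obtain ⟨G, hG, hG0⟩ := exists_potential e0 e1 sym
  refine ⟨G, fun d => ?_, hG0⟩
  rw [shiftDiff, hG, hG]
  rcases lt_or_ge d N with hd | hd
  · simp only [he]; rw [Finset.sum_eq_sum_Ico_succ_bot hd]; simp
  · rw [e0 d hd, e0 (d + 1) (by omega), z1 d hd, sub_zero]

/-- Consecutive coefficients of the partition function. -/
def zPair : ℕ → {pp : TimeRing × TimeRing // ∀ d, shiftDiff d pp.1 = vir d pp.2}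
  -- The pair keeps the previous coefficient because integrability of the next step uses the
  -- previous constraint. Before the constant 1 stands the coefficient 0.
  | 0 => ⟨(1, 0), fun d => by simp [shiftDiff, vir_zero_right]⟩
  | m + 1 => ⟨((exists_next (zPair m).2).choose, (zPair m).1.1),
      (exists_next (zPair m).2).choose_spec.1⟩

/-- The coefficients of the partition function. -/
def zCoeff (m : ℕ) : TimeRing := (zPair m).1.1

lemma zCoeff_zero : zCoeff 0 = 1 := rfl

lemma shiftDiff_zCoeff_zero (d : ℕ) : shiftDiff d (zCoeff 0) = 0 := by
  simp [shiftDiff, zCoeff_zero]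

lemma shiftDiff_zCoeff_succ (d m : ℕ) : shiftDiff d (zCoeff (m + 1)) = vir d (zCoeff m) :=
  (zPair (m + 1)).2 d

lemma constantCoeff_zCoeff (m : ℕ) : constantCoeff (zCoeff m) = if m = 0 then 1 else 0 := by
  cases m with
  | zero => simp [zCoeff_zero]
  | succ m => exact (exists_next (zPair m).2).choose_spec.2

end PainleveOne

end

noncomputable section
namespace PainleveOne

open MvPolynomial

/-! ### The dilaton equation -/

/-- The operator `∑ (2k + 1) xₖ ∂ₖ`. -/
def weightDer : Derivation ℂ TimeRing TimeRing :=
  mkDerivation ℂ fun k => (2 * (k : TimeRing) + 1) * X k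

lemma mul_unitConst : (32 : TimeRing) * unitConst = 1 := by
  rw [unitConst, ← map_ofNat (C : ℂ →+* TimeRing), ← C_mul]; norm_num

lemma weightDer_pderiv (i : ℕ) (p : TimeRing) :
    weightDer (pderiv i p) - pderiv i (weightDer p) = -((2 * (i : TimeRing) + 1) * pderiv i p) := by
  have := commutator_ext (D₁ := weightDer) (D₂ := pderiv i)
    (D₃ := -((2 * (i : TimeRing) + 1) • pderiv i)) ?_ p
  · simpa using this
  intro k
  simp only [weightDer, mkDerivation_X, Derivation.neg_apply, Derivation.smul_apply, smul_eq_mul,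
    Derivation.leibniz, pderiv_X, Pi.single_apply, map_add, derivation_ofNat,
    Derivation.map_natCast, Derivation.map_one_eq_zero]
  by_cases hk : k = i
  · subst hk; simp
  · simp [hk]

lemma weightDer_virB (d : ℕ) (p : TimeRing) :
    weightDer (virB d p) - virB d (weightDer p) = (2 - 2 * (d : TimeRing)) * virB d p := by
  have := commutator_ext (D₁ := weightDer) (D₂ := virB d)
    (D₃ := (2 - 2 * (d : TimeRing)) • virB d) ?_ p
  · simpa using this
  intro k
  have h1 : ∀ D : Derivation ℂ TimeRing TimeRing, ∀ k : ℕ, ∀ q, D ((2 * (k : TimeRing) + 1) * q)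
      = (2 * (k : TimeRing) + 1) * D q := by
    intro D k q
    simp only [Derivation.leibniz, map_add, derivation_ofNat, smul_eq_mul,
      Derivation.map_natCast, Derivation.map_one_eq_zero]
    ring
  have h2 : ∀ k, weightDer (X k) = (2 * (k : TimeRing) + 1) * X k := fun k => mkDerivation_X ..
  rw [h2, h1, Derivation.smul_apply, smul_eq_mul]
  rcases le_or_gt d (k + 1) with h | h
  · rw [virB_X_of_le h, derivation_coeff_mul, h2]
    rw [Nat.cast_sub h]; push_cast; ring
  · rw [virB_X_of_lt h]; simp

lemma weightDer_virC (d : ℕ) (p : TimeRing) :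
    weightDer (virC d p) - virC d (weightDer p) = (2 - 2 * (d : TimeRing)) * virC d p := by
  rcases lt_or_ge d 2 with hd | hd
  · have : ∀ q, virC d q = 0 := fun q => by
      interval_cases d
      · exact virC_zero q
      · exact virC_one q
    simp [this]
  obtain ⟨d, rfl⟩ := Nat.exists_eq_add_of_le' hd
  simp only [virC, show d + 2 - 1 = d + 1 by omega, show d + 2 - 2 = d by omega,
    Derivation.leibniz, derivation_unitConst, derivation_ofNat, smul_eq_mul, map_sum, mul_zero,
    add_zero]
  rw [← mul_sub, ← Finset.sum_sub_distrib, Finset.mul_sum, Finset.mul_sum, Finset.mul_sum]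
  refine Finset.sum_congr rfl fun i hi => ?_
  have hi' := Finset.mem_range.1 hi
  have h1 := weightDer_pderiv i (pderiv (d - i) p)
  have h2 := congrArg (pderiv i) (weightDer_pderiv (d - i) p)
  have h3 : ∀ q, pderiv i ((2 * ((d - i : ℕ) : TimeRing) + 1) * q)
      = (2 * ((d - i : ℕ) : TimeRing) + 1) * pderiv i q := by
    intro q
    simp only [Derivation.leibniz, map_add, derivation_ofNat, smul_eq_mul,
      Derivation.map_natCast, Derivation.map_one_eq_zero]
    ring
  rw [map_neg, h3, map_sub, Nat.cast_sub (by omega)] at h2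
  push_cast
  linear_combination 4 * unitConst * h1 + 4 * unitConst * h2

lemma weightDer_vir (d : ℕ) (p : TimeRing) :
    weightDer (vir d p) - vir d (weightDer p) = (2 - 2 * (d : TimeRing)) * vir d p := by
  have hA : weightDer (virA d) = (2 - 2 * (d : TimeRing)) * virA d := by
    rcases d with _ | _ | d
    · rw [virA_zero]
      simp only [Derivation.leibniz, Derivation.leibniz_pow, derivation_unitConst,
        derivation_ofNat, smul_eq_mul, weightDer, mkDerivation_X]
      simp; ring
    · simp [virA_one, derivation_unitConst]
    · simp [virA_add_two]
  simp only [vir, map_add, Derivation.leibniz, hA, smul_eq_mul]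
  linear_combination weightDer_virB d p + weightDer_virC d p

lemma pderiv_one_vir (d : ℕ) (p : TimeRing) :
    pderiv 1 (vir d p) = vir d (pderiv 1 p) + 24 * unitConst * pderiv d p := by
  have hA : pderiv 1 (virA d) = 0 := by
    rcases d with _ | d
    · rw [pderiv_virA_zero, if_neg one_ne_zero]
    · rw [virA_succ]; split_ifs
      · exact derivation_unitConst _
      · exact map_zero _
  have hB : virB d (pderiv 1 p) - pderiv 1 (virB d p) = -(24 * unitConst * pderiv d p) := by
    rcases d with _ | d
    · have := virB_zero_pderiv_succ 0 p
      norm_num at this ⊢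
      rw [this]; ring
    · rw [virB_succ_pderiv]; push_cast; ring
  rw [pderiv_vir, hA, hB]; ring

/-- All partial derivatives coincide along the indices, and those beyond the last variable vanish.
-/
lemma constantCoeff_pderiv_eq {p : TimeRing} (h : ∀ d, shiftDiff d p = 0) (d : ℕ) :
    pderiv d p = 0 := by
  obtain ⟨M, hM⟩ := exists_vars_bound p
  have : ∀ k, pderiv d p = pderiv (d + k) p := by
    intro k
    induction k with
    | zero => rfl
    | succ k ih => rw [ih]; exact sub_eq_zero.1 (h (d + k))
  rw [this M, pderiv_eq_zero_of_bound hM (by omega)]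

/-- The uniqueness counterpart of `exists_next`: a coefficient is determined by the preceding one
and its constant term. -/
lemma eq_zero_of_shiftDiff {p : TimeRing} (h : ∀ d, shiftDiff d p = 0)
    (h0 : constantCoeff p = 0) : p = 0 := by
  have hd : degreeDer p = 0 := by
    rw [degreeDer_eq_sum (N := 0) fun k _ => constantCoeff_pderiv_eq h k, Finset.sum_range_zero]
  ext s
  rw [coeff_zero]
  by_cases hs : s = 0
  · subst hs; exact h0
  · obtain ⟨j, hj⟩ : ∃ j, s j ≠ 0 := by
      by_contra hc; push Not at hc; exact hs (Finsupp.ext hc)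
    have h1 := congrArg (coeff (s - Finsupp.single j 1)) (constantCoeff_pderiv_eq h j)
    rw [coeff_pderiv, coeff_zero] at h1
    have hs : s - Finsupp.single j 1 + Finsupp.single j 1 = s := by
      ext i; simp only [Finsupp.add_apply, Finsupp.tsub_apply, Finsupp.single_apply]
      split_ifs with hi
      · subst hi; omega
      · simp
    rw [hs] at h1
    rcases mul_eq_zero.1 h1 with h1 | h1
    · exact h1
    · exact absurd h1 (Nat.cast_add_one_ne_zero _)

/-- The value at the origin of `∂₁` of the `m`-th coefficient of the partition function. -/
def bCoeff (m : ℕ) : ℂ := constantCoeff (pderiv 1 (zCoeff m))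

/-- The defect in the dilaton equation. -/
def dilatonDefect : ℕ → TimeRing
  | 0 => 0
  | m + 1 => 3 * (5 * (m : TimeRing) * zCoeff m - weightDer (zCoeff m))
      - 8 * pderiv 1 (zCoeff (m + 1))
      + 8 * ∑ x ∈ Finset.HasAntidiagonal.antidiagonal (m + 1), C (bCoeff x.1) * zCoeff x.2

/-- The defect satisfies the same recursion as the coefficients themselves. The multiples of `vir d
(zCoeff m)` cancel because 15 = 3(2 - 2d) + 3(2d + 1) + 6: the first summand is the weight of `vir
d`, the second comes from moving ∂_d past `weightDer`, and 6 = 8 · 24/32, by `pderiv_one_vir`,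
completes ∂_{d+1} to a `shiftDiff`. -/
lemma shiftDiff_dilatonDefect (d m : ℕ) :
    shiftDiff d (dilatonDefect (m + 1)) = vir d (dilatonDefect m) := by
  have hC : ∀ (D : Derivation ℂ TimeRing TimeRing) (a : ℂ), D (C a) = 0 :=
    fun D a => derivation_C D a
  have hS : ∀ m, shiftDiff d (∑ x ∈ Finset.HasAntidiagonal.antidiagonal (m + 1), C (bCoeff x.1) * zCoeff x.2)
      = vir d (∑ x ∈ Finset.HasAntidiagonal.antidiagonal m, C (bCoeff x.1) * zCoeff x.2) := by
    intro m
    have hsum : vir d (∑ x ∈ Finset.HasAntidiagonal.antidiagonal m, C (bCoeff x.1) * zCoeff x.2)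
        = ∑ x ∈ Finset.HasAntidiagonal.antidiagonal m, C (bCoeff x.1) * vir d (zCoeff x.2) := by
      have : ∀ s : Finset (ℕ × ℕ), vir d (∑ x ∈ s, C (bCoeff x.1) * zCoeff x.2)
          = ∑ x ∈ s, C (bCoeff x.1) * vir d (zCoeff x.2) := by
        intro s
        induction s using Finset.induction_on with
        | empty => simp [vir_zero_right]
        | insert a s ha ih =>
          rw [Finset.sum_insert ha, Finset.sum_insert ha, vir_add, ih,
            vir_const_mul d _ (fun D => hC D _)]
      exact this _
    rw [hsum, Finset.Nat.sum_antidiagonal_succ', shiftDiff]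
    simp only [map_add, map_sum, Derivation.leibniz, hC, smul_eq_mul, mul_zero, add_zero]
    have h0 := shiftDiff_zCoeff_zero d
    have h1 : ∀ x ∈ Finset.HasAntidiagonal.antidiagonal m, C (bCoeff x.1) * vir d (zCoeff x.2)
        = C (bCoeff x.1) * pderiv d (zCoeff (x.2 + 1))
          - C (bCoeff x.1) * pderiv (d + 1) (zCoeff (x.2 + 1)) := by
      intro x _
      rw [← shiftDiff_zCoeff_succ, shiftDiff]; ring
    rw [Finset.sum_congr rfl h1, Finset.sum_sub_distrib]
    rw [shiftDiff] at h0
    linear_combination C (bCoeff (m + 1)) * h0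
  have hE : ∀ p, shiftDiff d (weightDer p) = weightDer (shiftDiff d p)
      + (2 * (d : TimeRing) + 1) * shiftDiff d p - 2 * pderiv (d + 1) p := by
    intro p
    have h1 := weightDer_pderiv d p
    have h2 := weightDer_pderiv (d + 1) p
    simp only [shiftDiff, map_sub]
    push_cast at h2
    linear_combination h2 - h1
  have h32 := mul_unitConst
  have hn : ∀ (n : ℕ) (D : Derivation ℂ TimeRing TimeRing), D (n : TimeRing) = 0 :=
    fun n D => D.map_natCast n
  have hsh : ∀ (q₁ q₂ q₃ : TimeRing) (n : ℕ), shiftDiff d (3 * (5 * (n : TimeRing) * q₁ - q₂)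
      - 8 * pderiv 1 q₃ ) = 3 * (5 * n * shiftDiff d q₁ - shiftDiff d q₂)
      - 8 * pderiv 1 (shiftDiff d q₃) := by
    intro q₁ q₂ q₃ n
    simp only [shiftDiff, map_sub, Derivation.leibniz, derivation_ofNat, hn, smul_eq_mul,
      pderiv_comm 1]
    ring
  have hadd : ∀ q₁ q₂ : TimeRing, shiftDiff d (q₁ + 8 * q₂)
      = shiftDiff d q₁ + 8 * shiftDiff d q₂ := by
    intro q₁ q₂
    simp only [shiftDiff, map_add, Derivation.leibniz, derivation_ofNat, smul_eq_mul]
    ring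
  cases m with
  | zero =>
    rw [dilatonDefect, dilatonDefect, hadd, hsh, hS, shiftDiff_zCoeff_succ, hE,
      shiftDiff_zCoeff_zero, pderiv_one_vir]
    simp [zCoeff_zero, bCoeff, vir_zero_right]
  | succ m =>
    have h1 := shiftDiff_zCoeff_succ d m
    have h2 := weightDer_vir d (zCoeff m)
    have h3 : vir d (dilatonDefect (m + 1)) = 3 * (5 * (m : TimeRing) * vir d (zCoeff m)
        - vir d (weightDer (zCoeff m))) - 8 * vir d (pderiv 1 (zCoeff (m + 1)))
      + 8 * vir d (∑ x ∈ Finset.HasAntidiagonal.antidiagonal (m + 1), C (bCoeff x.1) * zCoeff x.2) := by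
      have c3 := vir_const_mul d 3 (fun D => derivation_ofNat D 3)
      have c8 := vir_const_mul d 8 (fun D => derivation_ofNat D 8)
      have c5 := vir_const_mul d (5 * (m : TimeRing)) (fun D => by
        simp [Derivation.leibniz, hn, derivation_ofNat])
      rw [dilatonDefect, vir_add, vir_sub, c3, c8, c8, vir_sub, c5]
    rw [h3, dilatonDefect, hadd, hsh, hS, shiftDiff_zCoeff_succ d m, hE,
      shiftDiff_zCoeff_succ d m, shiftDiff_zCoeff_succ d (m + 1), pderiv_one_vir]
    rw [shiftDiff] at h1
    push_cast
    linear_combination (-3 : TimeRing) * h2 - 6 * h1 - 6 * pderiv d (zCoeff (m + 1)) * h32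

/-- The dilaton equation. -/
lemma dilatonDefect_eq_zero (m : ℕ) : dilatonDefect m = 0 := by
  induction m with
  | zero => rfl
  | succ m ih =>
    apply eq_zero_of_shiftDiff
    · intro d; rw [shiftDiff_dilatonDefect, ih, vir_zero_right]
    · have hw : ∀ p : TimeRing, constantCoeff (weightDer p) = 0 := by
        intro p
        induction p using MvPolynomial.induction_on with
        | C a => simp [weightDer]
        | add p q hp hq => simp [hp, hq]
        | mul_X p i hp => simp [Derivation.leibniz, weightDer]
      -- The term with `bCoeff` is there to give the defect constant term zero: Z equals 1 at the
      -- origin, so the convolution collapses to `bCoeff (m + 1)`, which cancels ∂₁.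
      have hs : ∑ x ∈ Finset.HasAntidiagonal.antidiagonal (m + 1), bCoeff x.1 * constantCoeff (zCoeff x.2)
          = bCoeff (m + 1) := by
        rw [Finset.sum_eq_single (m + 1, 0)]
        · simp [constantCoeff_zCoeff]
        · rintro ⟨i, j⟩ hx hne
          have := Finset.HasAntidiagonal.mem_antidiagonal.1 hx
          rw [constantCoeff_zCoeff, if_neg, mul_zero]
          rintro rfl; simp at this; exact hne (by simp [this])
        · intro h; simp at h
      simp only [dilatonDefect, map_add, map_sub, map_mul, map_sum, hw, constantCoeff_C, hs,
        map_natCast, map_ofNat]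
      rw [← bCoeff, constantCoeff_zCoeff]
      split_ifs with h <;> simp [h]

end PainleveOne

end

noncomputable section
namespace PainleveOne

open MvPolynomial

/-! ### The generating form of the Virasoro constraints -/

section Generating

variable {Λ : Type*} [CommRing Λ] (ε : TimeRing →+* Λ)

/-- Stated for maps with a Leibniz rule along ε, so that it covers both derivations of the time ring
(ε the identity) and p ↦ `eulerPoly (special p)`. -/
lemma chain_rule_aux (D : TimeRing → Λ) (hadd : ∀ p q, D (p + q) = D p + D q)
    (hC : ∀ a, D (C a) = 0) (hmul : ∀ p q, D (p * q) = D p * ε q + ε p * D q) (p : TimeRing) :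
    ∃ M₀, ∀ M, M₀ ≤ M → D p = ∑ k ∈ Finset.range M, D (X k) * ε (pderiv k p) := by
  induction p using MvPolynomial.induction_on with
  | C a => exact ⟨0, fun M _ => by simp [hC]⟩
  | add p q hp hq =>
    obtain ⟨M₁, h₁⟩ := hp
    obtain ⟨M₂, h₂⟩ := hq
    refine ⟨max M₁ M₂, fun M hM => ?_⟩
    rw [hadd, h₁ M (le_trans (le_max_left _ _) hM), h₂ M (le_trans (le_max_right _ _) hM),
      ← Finset.sum_add_distrib]
    exact Finset.sum_congr rfl fun k _ => by rw [map_add, map_add]; ring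
  | mul_X p i hp =>
    obtain ⟨M₁, h₁⟩ := hp
    refine ⟨max M₁ (i + 1), fun M hM => ?_⟩
    have e : ∀ k ∈ Finset.range M, D (X k) * ε (pderiv k (p * X i))
        = D (X k) * ε (pderiv k p) * ε (X i) + if k = i then ε p * D (X i) else 0 := by
      intro k _
      rw [Derivation.leibniz, pderiv_X, Pi.single_apply]
      by_cases hk : k = i
      · subst hk; simp; ring
      · simp [hk, Ne.symm hk]; ring
    rw [hmul, h₁ M (le_trans (le_max_left _ _) hM), Finset.sum_congr rfl e,
      Finset.sum_add_distrib, Finset.sum_ite_eq', ← Finset.sum_mul, if_pos]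
    have := le_trans (le_max_right _ _) hM
    simp; omega

lemma chain_rule (D : TimeRing → Λ) (hadd : ∀ p q, D (p + q) = D p + D q)
    (hC : ∀ a, D (C a) = 0) (hmul : ∀ p q, D (p * q) = D p * ε q + ε p * D q) {p : TimeRing}
    {M : ℕ} (hM : ∀ k, M ≤ k → pderiv k p = 0) :
    D p = ∑ k ∈ Finset.range M, D (X k) * ε (pderiv k p) := by
  obtain ⟨M₀, h⟩ := chain_rule_aux ε D hadd hC hmul p
  rw [h (max M M₀) (le_max_right _ _)]
  symm
  apply Finset.sum_subset
  · intro k; simp; omega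
  · intro k _ hk; rw [hM k (by simpa using hk), map_zero, mul_zero]

lemma derivation_eq_sum (D : Derivation ℂ TimeRing TimeRing) {p : TimeRing}
    {M : ℕ} (hM : ∀ k, M ≤ k → pderiv k p = 0) :
    D p = ∑ k ∈ Finset.range M, D (X k) * pderiv k p :=
  chain_rule (RingHom.id _) D (fun p q => map_add D p q) (fun a => derivation_C D a)
    (fun p q => by simp [Derivation.leibniz]; ring) hM

lemma sum_virB_X (y : Λ) (k : ℕ) {N : ℕ} (hN : k + 2 ≤ N) :
    ∑ d ∈ Finset.range N, y ^ (d + 1) * ε (virB d (X k))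
      = 8 * ε unitConst * ∑ m ∈ Finset.range (k + 2),
        (2 * (m : Λ) + 1) * ε (X m) * y ^ (k + 2 - m) := by
  rw [← Finset.sum_subset (Finset.range_mono hN), ← Finset.sum_range_reflect, Finset.mul_sum]
  · refine Finset.sum_congr rfl fun m hm => ?_
    have hm' := Finset.mem_range.1 hm
    rw [virB_X_of_le (by omega), show k + 1 - (k + 2 - 1 - m) = m by omega,
      show k + 2 - 1 - m + 1 = k + 2 - m by omega]
    simp only [map_mul, map_add, map_ofNat, map_natCast, map_one]
    ring
  · intro d _ hd
    rw [virB_X_of_lt (by simp at hd; omega), map_zero, mul_zero]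

/-- Since y^{d+1} = y · y^{i+1} y^{j+1} for i + j = d - 2, the sum over d is the full double sum
sorted by i + j. -/
lemma sum_virC (y : Λ) {p : TimeRing} {M N : ℕ} (hM : ∀ k, M ≤ k → pderiv k p = 0)
    (hN : 2 * M + 2 ≤ N) :
    ∑ d ∈ Finset.range N, y ^ (d + 1) * ε (virC d p)
      = 4 * ε unitConst * (y * ∑ i ∈ Finset.range M, ∑ j ∈ Finset.range M,
        y ^ (i + 1) * y ^ (j + 1) * ε (pderiv i (pderiv j p))) := by
  obtain ⟨n, rfl⟩ := Nat.exists_eq_add_of_le' (show 2 ≤ N by omega)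
  have hz : ∀ i j, M ≤ i ∨ M ≤ j → pderiv i (pderiv j p) = 0 := by
    intro i j h
    rcases h with h | h
    · rw [pderiv_comm, hM i h, map_zero]
    · rw [hM j h, map_zero]
  set F : ℕ × ℕ → Λ := fun x => y ^ (x.1 + 1) * y ^ (x.2 + 1) * ε (pderiv x.1 (pderiv x.2 p))
    with hF
  have h1 : ∑ d ∈ Finset.range (n + 2), y ^ (d + 1) * ε (virC d p)
      = 4 * ε unitConst * (y * ∑ d ∈ Finset.range n,
        ∑ x ∈ Finset.HasAntidiagonal.antidiagonal d, F x) := by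
    rw [Finset.sum_range_succ', Finset.sum_range_succ', virC_zero, virC_one, Finset.mul_sum,
      Finset.mul_sum]
    simp only [map_zero, mul_zero, add_zero]
    refine Finset.sum_congr rfl fun d _ => ?_
    rw [Finset.Nat.sum_antidiagonal_eq_sum_range_succ_mk, virC]
    simp only [map_mul, map_ofNat, map_sum, Finset.mul_sum]
    refine Finset.sum_congr rfl fun i hi => ?_
    have hi' := Finset.mem_range.1 hi
    simp only [hF, show d + 1 + 1 - 2 - i = d - i by omega]
    have : d + 1 + 1 + 1 = (i + 1) + (d - i + 1) + 1 := by omega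
    rw [this]; ring
  rw [h1]
  congr 2
  rw [← Finset.sum_product' (s := Finset.range M) (t := Finset.range M) (f := fun i j => F (i, j)),
    ← Finset.sum_fiberwise_of_maps_to (g := fun x : ℕ × ℕ => x.1 + x.2) (t := Finset.range n)]
  · refine Finset.sum_congr rfl fun d _ => ?_
    symm
    apply Finset.sum_subset
    · intro x hx
      simp only [Finset.mem_filter] at hx
      exact Finset.HasAntidiagonal.mem_antidiagonal.2 hx.2
    · intro x hx hx'
      have := Finset.HasAntidiagonal.mem_antidiagonal.1 hx
      simp only [Finset.mem_filter, Finset.mem_product, Finset.mem_range] at hx'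
      rw [hF]; simp only
      rw [hz x.1 x.2 (by by_contra hc; push Not at hc; exact hx' ⟨⟨hc.1, hc.2⟩, this⟩)]
      simp
  · intro x hx
    simp only [Finset.mem_product, Finset.mem_range] at hx ⊢
    omega

lemma sum_virA (y : Λ) {N : ℕ} (hN : 2 ≤ N) :
    ∑ d ∈ Finset.range N, y ^ (d + 1) * ε (virA d)
      = ε unitConst * (4 * y * ε (X 0) ^ 2 + y ^ 2) := by
  obtain ⟨n, rfl⟩ := Nat.exists_eq_add_of_le' hN
  rw [Finset.sum_range_succ', Finset.sum_range_succ']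
  simp only [virA_add_two, virA_one, virA_zero, map_mul, map_pow, map_ofNat, map_zero, mul_zero,
    Finset.sum_const_zero, zero_add]
  ring

lemma sum_vir (y : Λ) {p : TimeRing} {M N : ℕ} (hM : ∀ k, M ≤ k → pderiv k p = 0)
    (hN : 2 * M + 2 ≤ N) :
    ∑ d ∈ Finset.range N, y ^ (d + 1) * ε (vir d p)
      = 8 * ε unitConst * ∑ k ∈ Finset.range M, (∑ m ∈ Finset.range (k + 2),
          (2 * (m : Λ) + 1) * ε (X m) * y ^ (k + 2 - m)) * ε (pderiv k p)
        + 4 * ε unitConst * (y * ∑ i ∈ Finset.range M, ∑ j ∈ Finset.range M,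
          y ^ (i + 1) * y ^ (j + 1) * ε (pderiv i (pderiv j p)))
        + ε unitConst * (4 * y * ε (X 0) ^ 2 + y ^ 2) * ε p := by
  have hB : ∑ d ∈ Finset.range N, y ^ (d + 1) * ε (virB d p)
      = 8 * ε unitConst * ∑ k ∈ Finset.range M, (∑ m ∈ Finset.range (k + 2),
          (2 * (m : Λ) + 1) * ε (X m) * y ^ (k + 2 - m)) * ε (pderiv k p) := by
    have h1 : ∀ d ∈ Finset.range N, y ^ (d + 1) * ε (virB d p)
        = ∑ k ∈ Finset.range M, y ^ (d + 1) * ε (virB d (X k)) * ε (pderiv k p) := by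
      intro d _
      rw [derivation_eq_sum (virB d) hM, map_sum, Finset.mul_sum]
      exact Finset.sum_congr rfl fun k _ => by rw [map_mul]; ring
    rw [Finset.sum_congr rfl h1, Finset.sum_comm, Finset.mul_sum]
    refine Finset.sum_congr rfl fun k hk => ?_
    have := Finset.mem_range.1 hk
    rw [← Finset.sum_mul, sum_virB_X ε y k (by omega)]; ring
  rw [← hB, ← sum_virC ε y hM hN, ← sum_virA ε y (show 2 ≤ N by omega), Finset.sum_mul,
    ← Finset.sum_add_distrib, ← Finset.sum_add_distrib]
  refine Finset.sum_congr rfl fun d _ => ?_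
  rw [vir, map_add, map_add, map_mul]; ring

/-- Summation by parts; the extra factor y avoids division, and the boundary term is the origin of
∂₀ in the summed constraint. -/
lemma sum_shift_telescope (y : Λ) (g : ℕ → Λ) (N : ℕ) :
    y * ∑ d ∈ Finset.range N, y ^ (d + 1) * (g d - g (d + 1))
      = (y - 1) * ∑ d ∈ Finset.range N, y ^ (d + 1) * g d + y * g 0 - y ^ (N + 1) * g N := by
  induction N with
  | zero => simp
  | succ N ih => rw [Finset.sum_range_succ, Finset.sum_range_succ, mul_add, ih]; ring

/-- The generating form of the Virasoro constraints. -/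
lemma generating_constraint (y : Λ) {p p' : TimeRing} (h : ∀ d, shiftDiff d p = vir d p') {M : ℕ}
    (hM : ∀ k, M ≤ k → pderiv k p = 0) (hM' : ∀ k, M ≤ k → pderiv k p' = 0) :
    (y - 1) * ∑ k ∈ Finset.range M, y ^ (k + 1) * ε (pderiv k p) + y * ε (pderiv 0 p)
      = y * (8 * ε unitConst * ∑ k ∈ Finset.range M, (∑ m ∈ Finset.range (k + 2),
          (2 * (m : Λ) + 1) * ε (X m) * y ^ (k + 2 - m)) * ε (pderiv k p')
        + 4 * ε unitConst * (y * ∑ i ∈ Finset.range M, ∑ j ∈ Finset.range M,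
          y ^ (i + 1) * y ^ (j + 1) * ε (pderiv i (pderiv j p')))
        + ε unitConst * (4 * y * ε (X 0) ^ 2 + y ^ 2) * ε p') := by
  rw [← sum_vir ε y hM' le_rfl]
  have h1 := sum_shift_telescope y (fun d => ε (pderiv d p)) (2 * M + 2)
  rw [hM _ (show M ≤ 2 * M + 2 by omega), map_zero, mul_zero, sub_zero] at h1
  have h2 : ∑ k ∈ Finset.range M, y ^ (k + 1) * ε (pderiv k p)
      = ∑ k ∈ Finset.range (2 * M + 2), y ^ (k + 1) * ε (pderiv k p) := by
    apply Finset.sum_subset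
    · intro k; simp; omega
    · intro k _ hk; rw [hM k (by simpa using hk), map_zero, mul_zero]
  rw [h2, ← h1]
  congr 1
  refine Finset.sum_congr rfl fun d _ => ?_
  rw [← h, shiftDiff, map_sub]

end Generating

/-! ### The heat equation of the principal specialization -/

/-- The principal specialization `xₖ ↦ -u^{2k+1} / (2k + 1)`. -/
def special : TimeRing →ₐ[ℂ] Polynomial ℂ :=
  aeval fun k => -(Polynomial.C (1 / (2 * (k : ℂ) + 1)) * Polynomial.X ^ (2 * k + 1))

/-- The Euler operator `u d/du`. -/
def eulerPoly : Derivation ℂ (Polynomial ℂ) (Polynomial ℂ) :=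
  (Polynomial.X : Polynomial ℂ) • Polynomial.derivative'

lemma eulerPoly_X : eulerPoly Polynomial.X = Polynomial.X := by
  simp [eulerPoly]

lemma eulerPoly_X_pow (n : ℕ) :
    eulerPoly (Polynomial.X ^ n) = (n : Polynomial ℂ) * Polynomial.X ^ n := by
  rw [Derivation.leibniz_pow, eulerPoly_X]
  cases n with
  | zero => simp
  | succ n => simp [pow_succ]

lemma eulerPoly_C (a : ℂ) : eulerPoly (Polynomial.C a) = 0 := by
  simp [eulerPoly]

lemma special_X (k : ℕ) : special (X k)
    = -(Polynomial.C (1 / (2 * (k : ℂ) + 1)) * Polynomial.X ^ (2 * k + 1)) := by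
  simp [special]

lemma special_X_mul (k : ℕ) :
    (2 * (k : Polynomial ℂ) + 1) * special (X k) = -Polynomial.X ^ (2 * k + 1) := by
  have h : (2 * (k : ℂ) + 1) ≠ 0 := by exact_mod_cast Nat.succ_ne_zero (2 * k)
  have h2 : (2 * (k : Polynomial ℂ) + 1) = Polynomial.C (2 * (k : ℂ) + 1) := by
    rw [map_add, map_mul, map_ofNat, map_natCast, map_one]
  rw [special_X, h2, mul_neg, ← mul_assoc, ← Polynomial.C_mul, mul_one_div_cancel h]; simp

lemma eulerPoly_special_X (k : ℕ) :
    eulerPoly (special (X k)) = -Polynomial.X ^ (2 * k + 1) := by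
  rw [← special_X_mul, special_X, map_neg, Derivation.leibniz, eulerPoly_C, eulerPoly_X_pow]
  simp; ring

/-- The reason for this specialization: at y = u² the generating derivative Σ y^{k+1} ∂_k becomes -u
· (u d/du), so the summed constraints close on the single variable u, except for ∂₀. -/
lemma eulerPoly_special {p : TimeRing} {M : ℕ} (hM : ∀ k, M ≤ k → pderiv k p = 0) :
    ∑ k ∈ Finset.range M, (Polynomial.X ^ 2) ^ (k + 1) * special (pderiv k p)
      = -Polynomial.X * eulerPoly (special p) := by
  have : eulerPoly (special p) = _ := chain_rule (special : TimeRing →+* Polynomial ℂ) (fun p => eulerPoly (special p))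
    (fun p q => by simp) (fun a => by simp [special, eulerPoly]) (fun p q => by
      simp [Derivation.leibniz]; ring) hM
  rw [this, Finset.mul_sum]
  refine Finset.sum_congr rfl fun k _ => ?_
  rw [eulerPoly_special_X]
  simp only [RingHom.coe_coe]; ring

lemma special_unitConst : special unitConst = Polynomial.C (1 / 32) := by
  simp [unitConst, special]

lemma special_X_zero : special (X 0) = -Polynomial.X := by
  simp [special_X]

lemma heat_poly {p p' : TimeRing} (h : ∀ d, shiftDiff d p = vir d p') :
    (1 - Polynomial.X ^ 2) * (Polynomial.X * eulerPoly (special p))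
        + Polynomial.X ^ 2 * special (pderiv 0 p)
      = Polynomial.C (1 / 32) * Polynomial.X ^ 6 * (4 * eulerPoly (eulerPoly (special p'))
        + 12 * eulerPoly (special p') + 5 * special p') := by
  obtain ⟨M₁, h₁⟩ := exists_vars_bound p
  obtain ⟨M₂, h₂⟩ := exists_vars_bound p'
  set M := max M₁ M₂
  have hM : ∀ k, M ≤ k → pderiv k p = 0 := fun k hk =>
    pderiv_eq_zero_of_bound h₁ (le_trans (le_max_left _ _) hk)
  have hM' : ∀ k, M ≤ k → pderiv k p' = 0 := fun k hk =>
    pderiv_eq_zero_of_bound h₂ (le_trans (le_max_right _ _) hk)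
  have key := generating_constraint (special : TimeRing →+* Polynomial ℂ) (Polynomial.X ^ 2)
    h hM hM'
  simp only [RingHom.coe_coe, special_unitConst, special_X_zero, eulerPoly_special hM] at key
  -- All k + 2 summands equal -u^{2k+5}. The weight k + 2 that results is produced below by applying
  -- `eulerPoly` to `eulerPoly_special`, which makes this part a second order operator.
  have e1 : ∀ k, ∑ m ∈ Finset.range (k + 2), (2 * (m : Polynomial ℂ) + 1) * special (X m)
      * (Polynomial.X ^ 2) ^ (k + 2 - m)
      = -((k : Polynomial ℂ) + 2) * Polynomial.X ^ (2 * k + 5) := by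
    intro k
    have : ∀ m ∈ Finset.range (k + 2), (2 * (m : Polynomial ℂ) + 1) * special (X m)
      * (Polynomial.X ^ 2) ^ (k + 2 - m) = -Polynomial.X ^ (2 * k + 5) := by
      intro m hm
      have := Finset.mem_range.1 hm
      rw [special_X_mul, ← pow_mul, neg_mul, ← pow_add]
      congr 2; omega
    rw [Finset.sum_congr rfl this, Finset.sum_const, Finset.card_range]
    simp; ring
  have e2 : ∑ i ∈ Finset.range M, ∑ j ∈ Finset.range M, (Polynomial.X ^ 2) ^ (i + 1)
      * (Polynomial.X ^ 2) ^ (j + 1) * special (pderiv i (pderiv j p'))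
      = -Polynomial.X * ∑ j ∈ Finset.range M, (Polynomial.X ^ 2) ^ (j + 1)
        * eulerPoly (special (pderiv j p')) := by
    rw [Finset.sum_comm, Finset.mul_sum]
    refine Finset.sum_congr rfl fun j _ => ?_
    have := eulerPoly_special (p := pderiv j p') (M := M) (fun k hk => by
      rw [pderiv_comm, hM' k hk, map_zero])
    rw [mul_left_comm, ← this, Finset.mul_sum]
    exact Finset.sum_congr rfl fun i _ => by ring
  have e3 := congrArg eulerPoly (eulerPoly_special hM')
  simp only [map_sum, Derivation.leibniz, map_neg, ← pow_mul, eulerPoly_X_pow, eulerPoly_X,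
    smul_eq_mul, Finset.sum_add_distrib] at e3
  have e4 := eulerPoly_special hM'
  simp only [← pow_mul] at e4
  have e5 : ∑ x ∈ Finset.range M, special (pderiv x p') * (((2 * (x + 1) : ℕ) : Polynomial ℂ)
      * Polynomial.X ^ (2 * (x + 1)))
      = 2 * ∑ k ∈ Finset.range M, ((k : Polynomial ℂ) + 2) * Polynomial.X ^ (2 * (k + 1))
          * special (pderiv k p')
        - 2 * ∑ k ∈ Finset.range M, Polynomial.X ^ (2 * (k + 1)) * special (pderiv k p') := by
    rw [Finset.mul_sum, Finset.mul_sum, ← Finset.sum_sub_distrib]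
    exact Finset.sum_congr rfl fun k _ => by push_cast; ring
  have e6 : ∑ k ∈ Finset.range M, (-((k : Polynomial ℂ) + 2) * Polynomial.X ^ (2 * k + 5))
        * special (pderiv k p')
      = -Polynomial.X ^ 3 * ∑ k ∈ Finset.range M, ((k : Polynomial ℂ) + 2)
          * Polynomial.X ^ (2 * (k + 1)) * special (pderiv k p') := by
    rw [Finset.mul_sum]
    exact Finset.sum_congr rfl fun k _ => by ring
  simp only [e1, e2, e6] at key
  simp only [← pow_mul] at key
  rw [e5, e4] at e3
  linear_combination key - 4 * Polynomial.C (1 / 32) * Polynomial.X ^ 5 * e3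

end PainleveOne

end

noncomputable section
namespace PainleveOne

/-! ### Derivations of formal power series -/

section SeriesDerivations

open PowerSeries

variable {A : Type*} [CommRing A] [Algebra ℂ A]

/-- The coefficientwise extension of a derivation to formal power series. -/
def serDer (D : Derivation ℂ A A) : Derivation ℂ A⟦X⟧ A⟦X⟧ :=
  Derivation.mk'
    { toFun := fun f => PowerSeries.mk fun n => D (coeff n f)
      map_add' := fun f g => by ext n; simp
      map_smul' := fun c f => by ext n; simp }
    fun f g => by
      ext n
      simp only [LinearMap.coe_mk, AddHom.coe_mk, coeff_mk, coeff_mul, map_sum, map_add,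
        smul_eq_mul, Derivation.leibniz]
      rw [← Finset.Nat.sum_antidiagonal_swap (f := fun x => coeff x.1 g * D (coeff x.2 f)),
        ← Finset.sum_add_distrib]
      exact Finset.sum_congr rfl fun x _ => by simp

@[simp] lemma coeff_serDer (D : Derivation ℂ A A) (f : A⟦X⟧) (n : ℕ) :
    coeff n (serDer D f) = D (coeff n f) := by
  simp [serDer]

/-- The Euler operator `r d/dr` on formal power series in `r`. -/
def serEuler : Derivation ℂ A⟦X⟧ A⟦X⟧ :=
  Derivation.mk'
    { toFun := fun f => PowerSeries.mk fun n => (n : A) * coeff n f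
      map_add' := fun f g => by ext n; simp [mul_add]
      map_smul' := fun c f => by ext n; simp }
    fun f g => by
      ext n
      simp only [LinearMap.coe_mk, AddHom.coe_mk, coeff_mk, coeff_mul, map_add, smul_eq_mul]
      rw [← Finset.Nat.sum_antidiagonal_swap (f := fun x => coeff x.1 g * (x.2 * coeff x.2 f)),
        ← Finset.sum_add_distrib, Finset.mul_sum]
      refine Finset.sum_congr rfl fun x hx => ?_
      rw [← Finset.HasAntidiagonal.mem_antidiagonal.1 hx]
      simp; ring

@[simp] lemma coeff_serEuler (f : A⟦X⟧) (n : ℕ) :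
    coeff n (serEuler f) = (n : A) * coeff n f := by
  simp [serEuler]

lemma serEuler_serDer (D : Derivation ℂ A A) (f : A⟦X⟧) :
    serEuler (serDer D f) = serDer D (serEuler f) := by
  ext n; simp [Derivation.leibniz]

lemma serDer_X (D : Derivation ℂ A A) : serDer D (X : A⟦X⟧) = 0 := by
  ext n; rw [coeff_serDer, coeff_X]; split_ifs <;> simp

lemma serEuler_X : serEuler (X : A⟦X⟧) = X := by
  ext n; rw [coeff_serEuler, coeff_X]; split_ifs with h <;> simp [h]

lemma serDer_C (D : Derivation ℂ A A) (a : A) : serDer D (C a) = C (D a) := by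
  ext n; rw [coeff_serDer, coeff_C, coeff_C]; split_ifs <;> simp

lemma serEuler_C (a : A) : serEuler (C a : A⟦X⟧) = 0 := by
  ext n; rw [coeff_serEuler, coeff_C]; split_ifs with h <;> simp [h]

lemma derivation_inverse {B : Type*} [CommRing B] [Algebra ℂ B] (D : Derivation ℂ B B) {f g : B}
    (h : f * g = 1) : D g = -(g ^ 2 * D f) := by
  have h1 := congrArg D h
  rw [Derivation.leibniz, Derivation.map_one_eq_zero, smul_eq_mul, smul_eq_mul] at h1
  linear_combination g * h1 - D g * h

end SeriesDerivations

/-! ### The equations satisfied by the principal specialization -/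

open PowerSeries

/-- Formal power series in `r` whose coefficients are polynomials in `u`. -/
abbrev SpecRing := (Polynomial ℂ)⟦X⟧

/-- The variable `u`. -/
def uVar : SpecRing := C (Polynomial.X)

/-- The derivation `u d/du`. -/
def uDer : Derivation ℂ SpecRing SpecRing := serDer eulerPoly

/-- The derivation `r d/dr`. -/
def rDer : Derivation ℂ SpecRing SpecRing := serEuler

/-- The constant `1 / 32`. -/
def specConst : SpecRing := C (Polynomial.C (1 / 32))

lemma mul_specConst : (32 : SpecRing) * specConst = 1 := by
  rw [specConst, ← map_ofNat (C : Polynomial ℂ →+* SpecRing),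
    ← map_ofNat (Polynomial.C : ℂ →+* Polynomial ℂ), ← map_mul, ← Polynomial.C_mul]
  norm_num

lemma uDer_uVar : uDer uVar = uVar := by
  rw [uDer, uVar, serDer_C, eulerPoly_X]

lemma rDer_uVar : rDer uVar = 0 := serEuler_C _

lemma uDer_X : uDer X = 0 := serDer_X _

lemma rDer_X : rDer X = X := serEuler_X

lemma rDer_uDer (f : SpecRing) : rDer (uDer f) = uDer (rDer f) := serEuler_serDer _ f

/-- The specialized partition function. -/
def psi : SpecRing := PowerSeries.mk fun m => special (zCoeff m)

/-- The specialized derivatives of the partition function. -/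
def psiDeriv (d : ℕ) : SpecRing :=
  PowerSeries.mk fun m => special (MvPolynomial.pderiv d (zCoeff m))

/-- The value of `∂₁` of the partition function at the origin. -/
def bSeries : SpecRing := PowerSeries.mk fun m => Polynomial.C (bCoeff m)

lemma uVar_pow (n : ℕ) : uVar ^ n = C (Polynomial.X ^ n : Polynomial ℂ) := by
  rw [uVar, map_pow]

lemma psi_heat : (1 - uVar ^ 2) * (uVar * uDer psi) + uVar ^ 2 * psiDeriv 0
    = X * (specConst * uVar ^ 6 * (4 * uDer (uDer psi) + 12 * uDer psi + 5 * psi)) := by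
  have h1 : (1 - uVar ^ 2) * (uVar * uDer psi) + uVar ^ 2 * psiDeriv 0
      = C (1 - Polynomial.X ^ 2 : Polynomial ℂ) * (C Polynomial.X * uDer psi)
        + C (Polynomial.X ^ 2) * psiDeriv 0 := by
    simp [uVar]
  have h2 : specConst * uVar ^ 6 * (4 * uDer (uDer psi) + 12 * uDer psi + 5 * psi)
      = C (Polynomial.C (1 / 32) * Polynomial.X ^ 6 : Polynomial ℂ)
        * (C 4 * uDer (uDer psi) + C 12 * uDer psi + C 5 * psi) := by
    rw [map_ofNat, map_ofNat, map_ofNat, specConst, uVar_pow, map_mul]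
  rw [h1, h2]
  ext1 n
  cases n with
  | zero =>
    rw [coeff_zero_X_mul]
    simp only [map_add, coeff_C_mul, uDer, coeff_serDer, psi, psiDeriv, coeff_mk, zCoeff_zero]
    simp
  | succ n =>
    rw [coeff_succ_X_mul]
    simp only [map_add, coeff_C_mul, uDer, coeff_serDer, psi, psiDeriv, coeff_mk]
    have := heat_poly (p := zCoeff (n + 1)) (p' := zCoeff n) (fun d => shiftDiff_zCoeff_succ d n)
    rw [this]

lemma special_weightDer (p : TimeRing) : special (weightDer p) = eulerPoly (special p) := by
  induction p using MvPolynomial.induction_on with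
  | C a => simp [weightDer, special, eulerPoly]
  | add p q hp hq => simp [hp, hq]
  | mul_X p i hp =>
    have h := special_X_mul i
    rw [Derivation.leibniz, map_mul, Derivation.leibniz, ← hp, eulerPoly_special_X, ← h, weightDer,
      MvPolynomial.mkDerivation_X]
    simp only [smul_eq_mul, map_add, map_mul, map_ofNat, map_natCast, map_one]

lemma special_vir_zero (p : TimeRing) : special (vir 0 p)
    = Polynomial.C (1 / 32) * (8 * Polynomial.X ^ 2 * eulerPoly (special p)
      + 4 * Polynomial.X ^ 2 * special p) := by
  obtain ⟨M, hM⟩ := exists_vars_bound p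
  have hM' : ∀ k, M ≤ k → MvPolynomial.pderiv k p = 0 := fun k hk => pderiv_eq_zero_of_bound hM hk
  have h1 := eulerPoly_special hM'
  have h2 : special (virB 0 p)
      = Polynomial.C (1 / 32) * (8 * Polynomial.X ^ 2 * eulerPoly (special p)) := by
    rw [derivation_eq_sum (virB 0) hM', map_sum]
    have : ∀ k ∈ Finset.range M, special (virB 0 (MvPolynomial.X k) * MvPolynomial.pderiv k p)
        = -(8 * Polynomial.C (1 / 32) * Polynomial.X) * ((Polynomial.X ^ 2) ^ (k + 1)
          * special (MvPolynomial.pderiv k p)) := by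
      intro k _
      have h3 := special_X_mul (k + 1)
      rw [virB_X_of_le (by omega), Nat.sub_zero]
      simp only [map_mul, map_add, map_ofNat, map_natCast, map_one, special_unitConst]
      linear_combination (8 * Polynomial.C (1 / 32) * special (MvPolynomial.pderiv k p)) * h3
    rw [Finset.sum_congr rfl this, ← Finset.mul_sum, h1]; ring
  rw [vir, virC_zero, virA_zero, map_add, map_add, h2]
  simp only [map_mul, map_pow, map_ofNat, special_unitConst, special_X_zero, map_zero]
  ring

/-- The constraint d = 0 trades ∂₀ for ∂₁, and `psi_dilaton` trades ∂₁ for r d/dr. Thus ∂₀ becomes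
an operator in u and r, up to the unknown series `bSeries` in r alone. -/
lemma psi_string : psiDeriv 0 = psiDeriv 1
    + X * (specConst * (8 * uVar ^ 2 * uDer psi + 4 * uVar ^ 2 * psi)) := by
  have h2 : specConst * (8 * uVar ^ 2 * uDer psi + 4 * uVar ^ 2 * psi)
      = C (Polynomial.C (1 / 32) : Polynomial ℂ) * (C (8 * Polynomial.X ^ 2) * uDer psi
        + C (4 * Polynomial.X ^ 2) * psi) := by
    rw [map_mul, map_mul, map_ofNat, map_ofNat, specConst, uVar_pow]
  rw [h2]
  ext1 n
  cases n with
  | zero =>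
    rw [map_add, coeff_zero_X_mul]
    simp [psiDeriv, zCoeff_zero]
  | succ n =>
    rw [map_add, coeff_succ_X_mul]
    simp only [map_add, coeff_C_mul, uDer, coeff_serDer, psi, psiDeriv, coeff_mk]
    rw [← special_vir_zero, ← shiftDiff_zCoeff_succ, shiftDiff, map_sub]; ring

lemma psi_dilaton : 8 * psiDeriv 1
    = X * (3 * (5 * rDer psi - uDer psi)) + 8 * (bSeries * psi) := by
  have h2 : X * (3 * (5 * rDer psi - uDer psi)) + 8 * (bSeries * psi)
      = X * (C 3 * (C 5 * rDer psi - uDer psi)) + C 8 * (bSeries * psi) := by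
    simp only [map_ofNat]
  rw [h2, ← map_ofNat (C : Polynomial ℂ →+* SpecRing) 8]
  ext1 n
  have h := dilatonDefect_eq_zero n
  cases n with
  | zero =>
    rw [map_add, coeff_zero_X_mul]
    simp [psiDeriv, zCoeff_zero, bSeries, bCoeff, psi]
  | succ n =>
    rw [map_add, coeff_succ_X_mul]
    simp only [map_sub, coeff_C_mul, uDer, rDer, coeff_serDer, coeff_serEuler, psi, psiDeriv,
      coeff_mk]
    simp only [bSeries, coeff_mul, coeff_mk]
    have h' := congrArg special h
    simp only [dilatonDefect, map_add, map_sub, map_mul, map_ofNat, map_natCast, map_sum,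
      map_zero, special_weightDer] at h'
    have hC : ∀ a : ℂ, special (MvPolynomial.C a) = Polynomial.C a := fun a => by simp [special]
    simp only [hC] at h'
    linear_combination -h'

/-- The inverse of the specialized partition function. -/
def psiInv : SpecRing := invOfUnit psi 1

lemma psi_mul_psiInv : psi * psiInv = 1 :=
  mul_invOfUnit psi 1 (by
    rw [← coeff_zero_eq_constantCoeff_apply, psi, coeff_mk, zCoeff_zero, map_one]; rfl)

/-- The logarithmic derivative of the specialized partition function, suitably scaled. -/
def kappaTau : SpecRing := X * uVar ^ 3 * uDer psi * psiInv

/-- The scaled logarithmic derivative of the partition function in the direction `x₀`. -/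
def phiTau : SpecRing := X * psiDeriv 0 * psiInv

/-- The Riccati form of the heat equation. -/
def HeatEq (κ φ : SpecRing) : Prop :=
  32 * (1 - uVar ^ 2) * κ + 32 * uVar ^ 4 * φ
    = 4 * X * uVar ^ 5 * uDer κ + 4 * uVar ^ 2 * κ ^ 2 + 5 * X ^ 2 * uVar ^ 8

/-- The equation expressing that the time derivative of the wave function is `φ`. -/
def TimeEq (κ φ : SpecRing) : Prop :=
  8 * uVar ^ 3 * uDer φ = X * (-3 * (uDer κ + 2 * κ - 5 * rDer κ)
    + 2 * uVar ^ 2 * (uDer κ - κ)) + 2 * X ^ 2 * uVar ^ 5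

/-- Division of the linear equation by ψ: the second logarithmic derivative is the derivative of the
first plus its square. -/
lemma heatEq_tau : HeatEq kappaTau phiTau := by
  have h1 := psi_mul_psiInv
  have h2 := psi_heat
  have h3 := mul_specConst
  have h4 := derivation_inverse uDer h1
  simp only [HeatEq, kappaTau, phiTau, Derivation.leibniz, Derivation.leibniz_pow, uDer_uVar,
    uDer_X, h4, smul_eq_mul, nsmul_eq_mul]
  push_cast
  linear_combination (32 * X * uVar ^ 2 * psiInv) * h2
    + (X ^ 2 * uVar ^ 8 * psiInv * (4 * uDer (uDer psi) + 12 * uDer psi + 5 * psi)) * h3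
    + 5 * X ^ 2 * uVar ^ 8 * h1

lemma uDer_bSeries : uDer bSeries = 0 := by
  ext1 n; rw [uDer, coeff_serDer, bSeries, coeff_mk, eulerPoly_C, map_zero]

/-- Applying u d/du to the expression for φ removes `bSeries`, which does not depend on u. -/
lemma timeEq_tau : TimeEq kappaTau phiTau := by
  have h1 := psi_mul_psiInv
  have h3 := mul_specConst
  have h4 := derivation_inverse uDer h1
  have h4' := derivation_inverse rDer h1
  have h5 : 8 * phiTau = X * (X * (3 * (5 * rDer psi * psiInv - uDer psi * psiInv))
      + 8 * bSeries + X * (2 * uVar ^ 2 * (uDer psi * psiInv) + uVar ^ 2)) := by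
    have h6 := psi_string
    have h7 := psi_dilaton
    rw [phiTau]
    linear_combination (8 * X * psiInv) * h6 + X * psiInv * h7
      + X ^ 2 * psiInv * (2 * uVar ^ 2 * uDer psi + uVar ^ 2 * psi) * h3
      + X * (8 * bSeries + X * uVar ^ 2) * h1
  have h8 := congrArg uDer h5
  simp only [Derivation.leibniz, Derivation.leibniz_pow, uDer_uVar, derivation_ofNat, map_add,
    map_sub, uDer_X, h4, smul_eq_mul, nsmul_eq_mul, uDer_bSeries] at h8
  simp only [TimeEq, kappaTau, Derivation.leibniz, Derivation.leibniz_pow, uDer_uVar, rDer_uVar,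
    uDer_X, rDer_X, h4, h4', smul_eq_mul, nsmul_eq_mul, rDer_uDer]
  push_cast at h8 ⊢
  linear_combination uVar ^ 3 * h8

lemma coeff_zero_kappaTau : coeff 0 kappaTau = 0 := by
  rw [kappaTau, mul_assoc, mul_assoc, coeff_zero_X_mul]

/-- The values at the origin of the derivatives of the partition function. -/
def zDerivSeries (d : ℕ) : ℂ⟦X⟧ :=
  PowerSeries.mk fun m => MvPolynomial.constantCoeff (MvPolynomial.pderiv d (zCoeff m))

lemma constantCoeff_special (p : TimeRing) :
    Polynomial.constantCoeff (special p) = MvPolynomial.constantCoeff p := by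
  induction p using MvPolynomial.induction_on with
  | C a => simp [special]
  | add p q hp hq => rw [map_add, map_add, map_add, hp, hq]
  | mul_X p i hp => rw [map_mul, map_mul, map_mul, special_X]; simp

/-- At u = 0 all times vanish, and ψ is 1 there. -/
lemma map_phiTau : PowerSeries.map Polynomial.constantCoeff phiTau = X * zDerivSeries 0 := by
  have h1 : PowerSeries.map Polynomial.constantCoeff psi = 1 := by
    ext n
    rw [coeff_map, psi, coeff_mk, constantCoeff_special, constantCoeff_zCoeff, coeff_one]
  have h2 := congrArg (PowerSeries.map Polynomial.constantCoeff) psi_mul_psiInv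
  rw [map_mul, h1, one_mul, map_one] at h2
  rw [phiTau, map_mul, map_mul, h2, mul_one, map_X]
  congr 1
  ext n
  rw [coeff_map, psiDeriv, coeff_mk, constantCoeff_special, zDerivSeries, coeff_mk]

/-! ### Uniqueness -/

lemma eq_const_of_eulerPoly {f : Polynomial ℂ} (h : eulerPoly f = 0) :
    f = Polynomial.C (f.coeff 0) := by
  ext n
  rw [Polynomial.coeff_C]
  split_ifs with hn
  · rw [hn]
  · have h1 := congrArg (fun p => Polynomial.coeff p n) h
    obtain ⟨k, rfl⟩ := Nat.exists_eq_succ_of_ne_zero hn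
    simp only [eulerPoly, Derivation.smul_apply, smul_eq_mul, Polynomial.derivative'_apply,
      Polynomial.coeff_X_mul, Polynomial.coeff_derivative, Polynomial.coeff_zero] at h1
    rcases mul_eq_zero.1 h1 with h2 | h2
    · exact h2
    · exact absurd h2 (Nat.cast_add_one_ne_zero k)

/-- Induction on the order in r. At order n, `TimeEq` leaves 8u³ · u d/du (δφ) = 0, so δφ is a
constant c, and `HeatEq` leaves (1 - u²) δκ + u⁴ c = 0. Since δκ is a polynomial in u, setting u = 1
gives c = 0, whence δκ = 0. -/
lemma heat_time_unique {κ φ κ' φ' : SpecRing} (h : HeatEq κ φ) (ht : TimeEq κ φ)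
    (h0 : coeff 0 κ = 0) (h' : HeatEq κ' φ') (ht' : TimeEq κ' φ') (h0' : coeff 0 κ' = 0) :
    φ = φ' := by
  have key : ∀ n, coeff n (κ - κ') = 0 ∧ coeff n (φ - φ') = 0 := by
    intro n
    induction n using Nat.strong_induction_on with
    | _ n ih =>
    have e1 : C (32 * (1 - Polynomial.X ^ 2) : Polynomial ℂ) * (κ - κ')
        + C (32 * Polynomial.X ^ 4 : Polynomial ℂ) * (φ - φ')
        = X * (C (4 * Polynomial.X ^ 5 : Polynomial ℂ) * uDer (κ - κ'))
          + C (4 * Polynomial.X ^ 2 : Polynomial ℂ) * ((κ + κ') * (κ - κ')) := by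
      have c1 : C (32 * (1 - Polynomial.X ^ 2) : Polynomial ℂ) = 32 * (1 - uVar ^ 2) := by
        rw [map_mul, map_ofNat, map_sub, map_one, map_pow, uVar]
      have c2 : C (32 * Polynomial.X ^ 4 : Polynomial ℂ) = 32 * uVar ^ 4 := by
        rw [map_mul, map_ofNat, map_pow, uVar]
      have c3 : C (4 * Polynomial.X ^ 5 : Polynomial ℂ) = 4 * uVar ^ 5 := by
        rw [map_mul, map_ofNat, map_pow, uVar]
      have c4 : C (4 * Polynomial.X ^ 2 : Polynomial ℂ) = 4 * uVar ^ 2 := by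
        rw [map_mul, map_ofNat, map_pow, uVar]
      rw [c1, c2, c3, c4, map_sub]
      rw [HeatEq] at h h'
      linear_combination h - h'
    have e2 : C (8 * Polynomial.X ^ 3 : Polynomial ℂ) * uDer (φ - φ')
        = X * (C (-3 : Polynomial ℂ) * (uDer (κ - κ') + C 2 * (κ - κ') - C 5 * rDer (κ - κ'))
          + C (2 * Polynomial.X ^ 2 : Polynomial ℂ) * (uDer (κ - κ') - (κ - κ'))) := by
      have c1 : C (8 * Polynomial.X ^ 3 : Polynomial ℂ) = 8 * uVar ^ 3 := by
        rw [map_mul, map_ofNat, map_pow, uVar]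
      have c2 : C (2 * Polynomial.X ^ 2 : Polynomial ℂ) = 2 * uVar ^ 2 := by
        rw [map_mul, map_ofNat, map_pow, uVar]
      rw [c1, c2, map_neg, map_ofNat, map_ofNat, map_ofNat, map_sub, map_sub, map_sub]
      rw [TimeEq] at ht ht'
      linear_combination ht - ht'
    have z1 : coeff n ((κ + κ') * (κ - κ')) = 0 := by
      rw [coeff_mul]
      refine Finset.sum_eq_zero fun x hx => ?_
      have hx' := Finset.HasAntidiagonal.mem_antidiagonal.1 hx
      rcases Nat.eq_zero_or_pos x.1 with h1 | h1
      · rw [h1, map_add, h0, h0']; simp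
      · rw [(ih x.2 (by omega)).1, mul_zero]
    have r1 := congrArg (coeff n) e1
    have r2 := congrArg (coeff n) e2
    have z2 : ∀ F : SpecRing, (∀ m, coeff m (κ - κ') = 0 → coeff m F = 0) →
        coeff n (X * F) = 0 := by
      intro F hF
      cases n with
      | zero => exact coeff_zero_X_mul F
      | succ n => rw [coeff_succ_X_mul]; exact hF n (ih n (Nat.lt_succ_self n)).1
    rw [z2] at r2
    swap
    · intro m hm
      simp only [map_add, map_sub (coeff m), coeff_C_mul, uDer, rDer, coeff_serDer,
        coeff_serEuler]
      rw [← map_sub (coeff m), hm]; simp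
    rw [map_add, map_add, coeff_C_mul, coeff_C_mul, coeff_C_mul _ ((κ + κ') * _), z1, z2] at r1
    swap
    · intro m hm
      simp only [coeff_C_mul, uDer, coeff_serDer]
      rw [hm]; simp
    rw [coeff_C_mul, uDer, coeff_serDer] at r2
    have hne : (8 * Polynomial.X ^ 3 : Polynomial ℂ) ≠ 0 :=
      mul_ne_zero (by norm_num) (pow_ne_zero _ Polynomial.X_ne_zero)
    obtain ⟨c, r3⟩ : ∃ c, coeff n (φ - φ') = Polynomial.C c :=
      ⟨_, eq_const_of_eulerPoly ((mul_eq_zero.1 r2).resolve_left hne)⟩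
    rw [r3] at r1
    have r4 := congrArg (Polynomial.eval 1) r1
    simp at r4
    rw [r4, Polynomial.C_0] at r3
    rw [r4] at r1
    simp only [Polynomial.C_0, mul_zero, add_zero] at r1
    refine ⟨(mul_eq_zero.1 r1).resolve_left (mul_ne_zero (by norm_num) ?_), r3⟩
    intro hc
    have := congrArg (Polynomial.eval 0) hc
    simp at this
  ext1 n
  exact sub_eq_zero.1 (by rw [← map_sub]; exact (key n).2)

end PainleveOne

end

noncomputable section
namespace PainleveOne

/-! ### The wave function of the first Painlevé equation -/

open PowerSeries

/-- The derivation `(2 u² - 3) u d/du + 15 r d/dr`, a multiple of the time derivative. -/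
def tDer : Derivation ℂ SpecRing SpecRing := (2 * uVar ^ 2 - 3) • uDer + (15 : SpecRing) • rDer

lemma tDer_apply (f : SpecRing) : tDer f = (2 * uVar ^ 2 - 3) * uDer f + 15 * rDer f := by
  simp [tDer]

lemma tDer_uVar : tDer uVar = 2 * uVar ^ 3 - 3 * uVar := by
  rw [tDer_apply, uDer_uVar, rDer_uVar]; ring

lemma tDer_X : tDer X = 15 * X := by
  rw [tDer_apply, uDer_X, rDer_X]; ring

lemma tDer_uDer (f : SpecRing) : tDer (uDer f) = uDer (tDer f) - 4 * uVar ^ 2 * uDer f := by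
  rw [tDer_apply, tDer_apply, rDer_uDer]
  simp only [map_add, map_sub, Derivation.leibniz, Derivation.leibniz_pow, uDer_uVar,
    derivation_ofNat, smul_eq_mul, nsmul_eq_mul]
  push_cast
  ring

lemma uVar_ne_zero : uVar ≠ 0 := by
  intro h
  have := congrArg (coeff 0) h
  rw [uVar, coeff_zero_C, map_zero] at this
  exact Polynomial.X_ne_zero this

/-- As θ = 1 + O(r) and the differential part carries a factor r, the lowest coefficient of a
solution Z is killed by 16. -/
lemma eq_zero_of_transport {θ Z : SpecRing} (hθ : coeff 0 θ = 1)
    (h : 16 * θ * Z + X * uVar * (tDer Z + 12 * Z - 6 * uVar ^ 2 * Z) = 0) : Z = 0 := by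
  have key : ∀ n, coeff n Z = 0 := by
    intro n
    induction n using Nat.strong_induction_on with
    | _ n ih =>
    have h1 := congrArg (coeff n) h
    have c1 : 16 * θ * Z + X * uVar * (tDer Z + 12 * Z - 6 * uVar ^ 2 * Z)
        = C (16 : Polynomial ℂ) * (θ * Z) + X * (C (Polynomial.X * (2 * Polynomial.X ^ 2 - 3))
          * uDer Z + C (15 * Polynomial.X) * rDer Z
          + C (12 * Polynomial.X - 6 * Polynomial.X ^ 3) * Z) := by
      rw [tDer_apply]
      simp only [map_mul, map_sub, map_pow, map_ofNat]
      rw [← uVar]; ring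
    rw [c1, map_add, coeff_C_mul, coeff_mul, Finset.sum_eq_single (0, n), hθ, one_mul] at h1
    · cases n with
      | zero =>
        rw [coeff_zero_X_mul, add_zero, map_zero] at h1
        exact (mul_eq_zero.1 h1).resolve_left (by norm_num)
      | succ n =>
        rw [coeff_succ_X_mul] at h1
        simp only [map_add, coeff_C_mul, uDer, rDer, coeff_serDer, coeff_serEuler,
          ih n (Nat.lt_succ_self n), map_zero, mul_zero, add_zero] at h1
        exact (mul_eq_zero.1 h1).resolve_left (by norm_num)
    · intro x hx hx0
      have hx' := Finset.HasAntidiagonal.mem_antidiagonal.1 hx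
      rcases Nat.eq_zero_or_pos x.1 with h2 | h2
      · exact absurd (Prod.ext h2 (by simp; omega)) hx0
      · rw [ih x.2 (by omega), mul_zero]
    · intro hx
      exact absurd (Finset.HasAntidiagonal.mem_antidiagonal.2 (by simp)) hx
  ext1 n; rw [key, map_zero]

/-- A formal solution `q` of the first Painlevé equation together with the logarithmic derivative
`θ = 1 + u² ϑ` of its wave function. -/
structure IsWave (q ϑ θ : SpecRing) : Prop where
  uDer_eq : uDer q = 0
  theta_eq : θ = 1 + uVar ^ 2 * ϑ
  coeff_theta : coeff 0 θ = 1
  painleve : 3 * X ^ 2 * (tDer (tDer q - 6 * q) + 6 * (tDer q - 6 * q))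
    - 64 * (18 * q ^ 2 - 2) = 0
  riccati : 24 * θ ^ 2 + 3 * X * uVar * (tDer θ - 2 * uVar ^ 2 * θ) - 24
    - 16 * uVar ^ 2 * (3 * q - 1) = 0

/-- The off-diagonal entry of the wave connection. -/
def wavePi (q θ : SpecRing) : SpecRing :=
  16 * (3 - 2 * uVar ^ 2 - 3 * uVar ^ 2 * q) * θ + 3 * uVar ^ 3 * X * (tDer q - 6 * q)

/-- A multiple of the difference of the Hamiltonian function and its leading term. -/
def sigmaDiff (q : SpecRing) : SpecRing :=
  27 * X ^ 2 * (tDer q - 6 * q) ^ 2 - 6912 * q ^ 3 + 2304 * q - 512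

/-! ### Compatibility of the Lax pair and the Riccati system for its wave function -/

section Wave

variable {q ϑ θ : SpecRing} (H : IsWave q ϑ θ)

lemma IsWave.uDer_tDer (H : IsWave q ϑ θ) : uDer (tDer q) = 0 := by
  have := tDer_uDer q
  rw [H.uDer_eq, map_zero] at this
  linear_combination -this

/-- Equality of mixed derivatives of log Ψ: up to scaling, θ/u is ħ∂_t log Ψ and `wavePi`/u³ is ħ∂_x
log Ψ. The Painlevé equation and the t-Riccati equation do not give this at once; they give a linear
homogeneous transport equation for the defect, which `eq_zero_of_transport` solves by zero. -/
lemma IsWave.compat (H : IsWave q ϑ θ) :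
    96 * uVar ^ 4 * (uDer θ - θ) + (tDer (wavePi q θ) - 6 * uVar ^ 2 * wavePi q θ) = 0 := by
  have hR := H.riccati
  have hP := H.painleve
  have hTR := congrArg tDer hR
  have hTP := congrArg tDer hP
  have hER := congrArg uDer hR
  have hET := tDer_uDer θ
  apply eq_zero_of_transport H.coeff_theta
  simp only [wavePi, map_add, map_sub, map_zero, Derivation.leibniz, Derivation.leibniz_pow,
    tDer_uVar, tDer_X, uDer_uVar, uDer_X, derivation_ofNat, H.uDer_eq, smul_eq_mul, nsmul_eq_mul,
    hET, Derivation.map_one_eq_zero] at *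
  push_cast at *
  simp only [derivation_ofNat]
  have hmul : (3 : SpecRing) ≠ 0 := by
    rw [← map_ofNat (C : Polynomial ℂ →+* SpecRing), ← map_ofNat (Polynomial.C : ℂ →+* Polynomial ℂ)]
    intro h
    have := congrArg (fun f => Polynomial.eval 0 (coeff 0 f)) h
    simp at this
  -- The available relations combine to three times the transport equation.
  apply (mul_eq_zero.1 (_ : (3 : SpecRing) * _ = 0)).resolve_left hmul
  linear_combination (96 * uVar ^ 4) * hER - (192 * uVar ^ 4) * hR
    + (48 - 32 * uVar ^ 2 - 48 * uVar ^ 2 * q) * hTR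
    + (-192 * uVar ^ 2 + 128 * uVar ^ 4 + 576 * uVar ^ 2 * q + 192 * uVar ^ 4 * q
      - 96 * uVar ^ 2 * tDer q) * hR - 36 * uVar ^ 4 * hP + 3 * uVar ^ 4 * hTP

/-- The Riccati equation in x. Minus the determinant of the Lax matrix is 4x³ + 2tx + 2σ; it differs
from y² = 4(x - q₀)²(x + 2q₀), here 6912(1 - u²)², by 2(σ - σ₀), which is the source of `sigmaDiff`.
-/
lemma IsWave.wavePi_sq (H : IsWave q ϑ θ) :
    3 * wavePi q θ ^ 2 - 36 * X * uVar ^ 5 * (uDer (wavePi q θ) - 3 * wavePi q θ)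
      - 6912 * (1 - uVar ^ 2) ^ 2 - uVar ^ 6 * sigmaDiff q - 3456 * X * uVar ^ 5 * θ = 0 := by
  have hR := H.riccati
  have hP := H.painleve
  have hZ := H.compat
  have hq := H.uDer_tDer
  simp only [wavePi, sigmaDiff, map_add, map_sub, Derivation.leibniz,
    Derivation.leibniz_pow, hq, tDer_uVar, tDer_X, uDer_uVar, uDer_X, derivation_ofNat, H.uDer_eq,
    smul_eq_mul, nsmul_eq_mul] at *
  push_cast at *
  linear_combination (-18 * X * uVar + 12 * X * uVar ^ 3 + 18 * X * uVar ^ 3 * q) * hZ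
    + (288 - 384 * uVar ^ 2 + 128 * uVar ^ 4 - 576 * uVar ^ 2 * q + 384 * uVar ^ 4 * q
      + 288 * uVar ^ 4 * q ^ 2) * hR + (18 * uVar ^ 4 - 12 * uVar ^ 6 - 18 * uVar ^ 6 * q) * hP

/-- The constant `1 / 48`. -/
def waveConst : SpecRing := C (Polynomial.C (1 / 48))

lemma mul_waveConst : (48 : SpecRing) * waveConst = 1 := by
  rw [waveConst, ← map_ofNat (C : Polynomial ℂ →+* SpecRing),
    ← map_ofNat (Polynomial.C : ℂ →+* Polynomial ℂ), ← map_mul, ← Polynomial.C_mul]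
  norm_num

lemma uDer_waveConst : uDer waveConst = 0 := by
  rw [waveConst, uDer, serDer_C, eulerPoly_C, map_zero]

/-- The counterpart of `kappaTau` for a wave function. -/
def kappaWave (q ϑ θ : SpecRing) : SpecRing :=
  4 * waveConst * (-48 * (1 - uVar ^ 2) * ϑ + 16 * (3 * q - 1) * θ
    - 3 * uVar * X * (tDer q - 6 * q) - 6 * X * uVar ^ 3)

/-- The counterpart of `phiTau` for a wave function. -/
def phiWave (q ϑ : SpecRing) : SpecRing :=
  X * uVar * ϑ + 32 * waveConst ^ 3 * sigmaDiff q

/-- The subtracted terms are the leading term, given by y, and the contribution of the prefactor of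
Ψ. Dividing by u² is legitimate because θ - 1 is a multiple of u²; this is why ϑ is carried along.
-/
lemma IsWave.kappa_eq (H : IsWave q ϑ θ) : 12 * uVar ^ 2 * kappaWave q ϑ θ
    = 48 * (1 - uVar ^ 2) - wavePi q θ - 6 * X * uVar ^ 5 := by
  rw [kappaWave, wavePi]
  linear_combination (uVar ^ 2 * (-48 * (1 - uVar ^ 2) * ϑ + 16 * (3 * q - 1) * θ
    - 3 * uVar * X * (tDer q - 6 * q) - 6 * X * uVar ^ 3)) * mul_waveConst
    + 48 * (1 - uVar ^ 2) * H.theta_eq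

/-- The factor `32 * waveConst ^ 3` is 1/3456, since 48³ = 32 · 3456. -/
lemma phiWave_eq : 3456 * phiWave q ϑ = 3456 * X * uVar * ϑ + sigmaDiff q := by
  rw [phiWave]
  linear_combination (sigmaDiff q * (48 ^ 2 * waveConst ^ 2 + 48 * waveConst + 1)) * mul_waveConst

/-- After multiplication by 108u² this is `wavePi_sq`, rewritten through `kappa_eq` and its
u-derivative. -/
lemma IsWave.heatEq (H : IsWave q ϑ θ) : HeatEq (kappaWave q ϑ θ) (phiWave q ϑ) := by
  have h1 := H.kappa_eq
  have h2 := congrArg uDer h1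
  have h3 := phiWave_eq (q := q) (ϑ := ϑ)
  have h4 := H.wavePi_sq
  have h5 := H.theta_eq
  simp only [map_sub, Derivation.leibniz, Derivation.leibniz_pow,
    uDer_uVar, uDer_X, derivation_ofNat, smul_eq_mul, nsmul_eq_mul,
    Derivation.map_one_eq_zero] at h2
  push_cast at h2
  have hne : (C (Polynomial.C 108) : SpecRing) * uVar ^ 2 ≠ 0 := by
    refine mul_ne_zero ?_ (pow_ne_zero _ uVar_ne_zero)
    intro h
    have := congrArg (fun f => Polynomial.eval 0 (coeff 0 f)) h
    simp at this
  rw [map_ofNat, map_ofNat] at hne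
  rw [HeatEq]
  apply mul_left_cancel₀ hne
  set κ := kappaWave q ϑ θ
  set ϖ := wavePi q θ
  linear_combination (288 * (1 - uVar ^ 2) + 72 * X * uVar ^ 5 - 3 * (12 * uVar ^ 2 * κ
    + (48 * (1 - uVar ^ 2) - ϖ - 6 * X * uVar ^ 5))) * h1 + uVar ^ 6 * h3
    - 36 * X * uVar ^ 5 * h2 - h4 - 3456 * X * uVar ^ 5 * h5

lemma IsWave.uDer_sigmaDiff (H : IsWave q ϑ θ) : uDer (sigmaDiff q) = 0 := by
  simp only [sigmaDiff, map_add, map_sub, Derivation.leibniz, Derivation.leibniz_pow,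
    uDer_X, derivation_ofNat, smul_eq_mul, nsmul_eq_mul, H.uDer_eq, H.uDer_tDer]
  ring

/-- After multiplication by 12u² this is `compat`. The Hamiltonian part of φ is independent of u and
drops out under u d/du. -/
lemma IsWave.timeEq (H : IsWave q ϑ θ) : TimeEq (kappaWave q ϑ θ) (phiWave q ϑ) := by
  have h1 := H.kappa_eq
  have h2 := congrArg tDer h1
  have h4 := H.compat
  have h5 := congrArg uDer H.theta_eq
  have h6 := H.theta_eq
  have h7 : uDer (phiWave q ϑ) = X * uVar * ϑ + X * uVar * uDer ϑ := by
    simp only [phiWave, map_add, Derivation.leibniz, Derivation.leibniz_pow,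
      uDer_uVar, uDer_X, derivation_ofNat, uDer_waveConst, H.uDer_sigmaDiff,
      smul_eq_mul, nsmul_eq_mul]
    ring
  simp only [map_add, map_sub, Derivation.leibniz, Derivation.leibniz_pow, tDer_uVar,
    tDer_X, uDer_uVar, derivation_ofNat, smul_eq_mul, nsmul_eq_mul,
    Derivation.map_one_eq_zero] at h2 h5
  push_cast at h2 h5
  rw [TimeEq]
  have hne : (C (Polynomial.C 12) : SpecRing) * uVar ^ 2 ≠ 0 := by
    refine mul_ne_zero ?_ (pow_ne_zero _ uVar_ne_zero)
    intro h
    have := congrArg (fun f => Polynomial.eval 0 (coeff 0 f)) h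
    simp at this
  rw [map_ofNat, map_ofNat] at hne
  apply mul_left_cancel₀ hne
  have h8 := tDer_apply (kappaWave q ϑ θ)
  set κ := kappaWave q ϑ θ
  set ϖ := wavePi q θ
  linear_combination 96 * uVar ^ 5 * h7 - X * h2 + X * h4 + 6 * X * uVar ^ 2 * h1
    - 96 * X * uVar ^ 4 * h5 + 96 * X * uVar ^ 4 * h6 + 12 * X * uVar ^ 2 * h8

lemma IsWave.phiWave_eq_phiTau (H : IsWave q ϑ θ) (h0 : coeff 0 (kappaWave q ϑ θ) = 0) :
    phiWave q ϑ = phiTau :=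
  heat_time_unique H.heatEq H.timeEq h0 heatEq_tau timeEq_tau coeff_zero_kappaTau

end Wave

end PainleveOne

end

noncomputable section
namespace PainleveOne

/-! ### The formal solution of the first Painlevé equation, as a series of numbers -/

open PowerSeries

/-- The coefficients of the formal solution at `q₀ = 1 / 3`. -/
def alpha : ℕ → ℂ
  | 0 => 1 / 3
  | k + 1 => 1 / 4 * (9 / 16 * (25 * (k : ℂ) ^ 2 - 1) * alpha k
      - 6 * ∑ i : Fin k, alpha (i + 1) * alpha (k - i))
  decreasing_by all_goals omega

/-- The generating series of the coefficients of the formal solution. -/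
def alphaSeries : ℂ⟦X⟧ := PowerSeries.mk alpha

lemma alphaSeries_eq : 27 * X * (100 * serEuler (serEuler alphaSeries) - 4 * alphaSeries)
    = 1152 * alphaSeries ^ 2 - 128 := by
  have h1 : 27 * X * (100 * serEuler (serEuler alphaSeries) - 4 * alphaSeries)
      = X * (C (2700 : ℂ) * serEuler (serEuler alphaSeries) - C (108 : ℂ) * alphaSeries) := by
    rw [map_ofNat, map_ofNat]; ring
  rw [h1, ← map_ofNat (C : ℂ →+* ℂ⟦X⟧) 1152, ← map_ofNat (C : ℂ →+* ℂ⟦X⟧) 128, pow_two]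
  ext1 n
  rw [map_sub, coeff_C_mul, coeff_mul n alphaSeries, coeff_C]
  cases n with
  | zero =>
    rw [coeff_zero_X_mul]
    simp [alphaSeries, alpha]; norm_num
  | succ k =>
    rw [coeff_succ_X_mul, Finset.Nat.sum_antidiagonal_eq_sum_range_succ_mk,
      Finset.sum_range_succ', Finset.sum_range_succ]
    simp only [map_sub, coeff_C_mul, coeff_serEuler, alphaSeries, coeff_mk, Nat.sub_self,
      Nat.sub_zero, if_neg (Nat.succ_ne_zero k), Nat.add_sub_add_right]
    rw [Finset.sum_range (fun i => alpha (i + 1) * alpha (k - i))]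
    have h2 : alpha (k + 1) = 1 / 4 * (9 / 16 * (25 * (k : ℂ) ^ 2 - 1) * alpha k
      - 6 * ∑ i : Fin k, alpha (i + 1) * alpha (k - i)) := by rw [alpha]
    have h3 : alpha 0 = 1 / 3 := by rw [alpha]
    rw [h3]
    linear_combination (-768) * h2

/-- The formal solution at `q₀ = 1 / 3`, as an even series. -/
def qNum : ℂ⟦X⟧ := PowerSeries.expand 2 two_ne_zero alphaSeries

lemma coeff_qNum (n : ℕ) : coeff n qNum = if Even n then alpha (n / 2) else 0 := by
  split_ifs with h
  · obtain ⟨k, rfl⟩ := h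
    rw [← two_mul, qNum, coeff_expand_mul, Nat.mul_div_cancel_left k two_pos, alphaSeries, coeff_mk]
  · rw [qNum, coeff_expand_of_not_dvd]
    rwa [even_iff_two_dvd] at h

lemma serEuler_expand (f : ℂ⟦X⟧) : serEuler (PowerSeries.expand 2 two_ne_zero f)
    = 2 * PowerSeries.expand 2 two_ne_zero (serEuler f) := by
  rw [← map_ofNat (C : ℂ →+* ℂ⟦X⟧) 2]
  ext1 n
  rw [coeff_serEuler, coeff_C_mul]
  by_cases h : 2 ∣ n
  · obtain ⟨k, rfl⟩ := h
    rw [coeff_expand_mul, coeff_expand_mul, coeff_serEuler]; push_cast; ring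
  · rw [coeff_expand_of_not_dvd _ _ _ h, coeff_expand_of_not_dvd _ _ _ h]; simp

lemma qNum_eq : 27 * X ^ 2 * (25 * serEuler (serEuler qNum) - 4 * qNum)
    = 1152 * qNum ^ 2 - 128 := by
  have h := congrArg (PowerSeries.expand 2 two_ne_zero) alphaSeries_eq
  have h0 : (2 : ℂ⟦X⟧) = C 2 := (map_ofNat _ _).symm
  have h1 : serEuler (serEuler qNum)
      = 4 * PowerSeries.expand 2 two_ne_zero (serEuler (serEuler alphaSeries)) := by
    rw [qNum, serEuler_expand, Derivation.leibniz, serEuler_expand, derivation_ofNat]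
    simp only [smul_eq_mul]; ring
  simp only [map_mul, map_sub, map_pow, map_ofNat, PowerSeries.expand_X] at h
  rw [← qNum] at h
  rw [h1, ← h]; ring

/-- The formal solution as an element of `SpecRing`. -/
def qSpec : SpecRing := PowerSeries.map Polynomial.C qNum

lemma tDer_map (f : ℂ⟦X⟧) :
    tDer (PowerSeries.map Polynomial.C f) = PowerSeries.map Polynomial.C (15 * serEuler f) := by
  rw [tDer_apply]
  have h1 : uDer (PowerSeries.map Polynomial.C f) = 0 := by
    ext1 n; rw [uDer, coeff_serDer, coeff_map, eulerPoly_C, map_zero]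
  have h2 : rDer (PowerSeries.map Polynomial.C f) = PowerSeries.map Polynomial.C (serEuler f) := by
    ext1 n; rw [rDer, coeff_serEuler, coeff_map, coeff_map, coeff_serEuler]; simp
  rw [h1, h2, map_mul, map_ofNat]; ring

lemma qSpec_painleve : 3 * X ^ 2 * (tDer (tDer qSpec - 6 * qSpec) + 6 * (tDer qSpec - 6 * qSpec))
    - 64 * (18 * qSpec ^ 2 - 2) = 0 := by
  have h := congrArg (PowerSeries.map (Polynomial.C : ℂ →+* Polynomial ℂ)) qNum_eq
  have h1 : tDer (tDer qSpec)
      = 225 * PowerSeries.map Polynomial.C (serEuler (serEuler qNum)) := by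
    rw [qSpec, tDer_map, tDer_map, Derivation.leibniz, derivation_ofNat]
    simp only [smul_eq_mul, map_mul, map_add, map_ofNat, map_zero]; ring
  simp only [map_mul, map_sub, map_pow, map_ofNat, PowerSeries.map_X] at h
  rw [← qSpec] at h
  rw [map_sub, Derivation.leibniz, derivation_ofNat, h1]
  simp only [smul_eq_mul]
  linear_combination h

lemma coeff_zero_qSpec : coeff 0 (3 * qSpec - 1) = 0 := by
  rw [← map_ofNat (C : Polynomial ℂ →+* SpecRing), map_sub, coeff_C_mul, qSpec, coeff_map,
    coeff_qNum, if_pos Even.zero, Nat.zero_div, alpha, ← map_ofNat (Polynomial.C : ℂ →+* _),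
    ← Polynomial.C_mul]
  simp

/-! ### Solving the Riccati equation -/

/-- A contraction for the X-adic topology; the coefficient of index m no longer changes after m + 1
iterations. -/
lemma exists_fixed_point {A : Type*} [CommRing A] (Ψ : A⟦X⟧ → A⟦X⟧)
    (hΨ : ∀ n f g, X ^ n ∣ f - g → X ^ (n + 1) ∣ Ψ f - Ψ g) : ∃ f, Ψ f = f := by
  have h1 : ∀ n k, n ≤ k → X ^ n ∣ Ψ^[k] 0 - Ψ^[n] 0 := by
    intro n
    induction n with
    | zero => intro k _; simp
    | succ n ih =>
      intro k hk
      obtain ⟨k, rfl⟩ := Nat.exists_eq_succ_of_ne_zero (by omega : k ≠ 0)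
      rw [Function.iterate_succ_apply', Function.iterate_succ_apply']
      exact hΨ _ _ _ (ih k (by omega))
  set f : A⟦X⟧ := PowerSeries.mk fun m => coeff m (Ψ^[m + 1] 0) with hf
  have h2 : ∀ n, X ^ n ∣ f - Ψ^[n] 0 := by
    intro n
    rw [X_pow_dvd_iff]
    intro m hm
    have := X_pow_dvd_iff.1 (h1 (m + 1) n hm) m (Nat.lt_succ_self m)
    rw [map_sub] at this ⊢
    rw [hf, coeff_mk]
    linear_combination -this
  refine ⟨f, ?_⟩
  ext1 m
  have := X_pow_dvd_iff.1 (hΨ m _ _ (h2 m)) m (Nat.lt_succ_self m)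
  rw [map_sub, ← Function.iterate_succ_apply' Ψ m] at this
  rw [sub_eq_zero.1 this, hf, coeff_mk]

/-- The time derivative preserves the order in r. In the Riccati equation it carries an extra factor
r, which makes the iteration contracting. -/
lemma pow_dvd_tDer {n : ℕ} {f : SpecRing} (h : X ^ n ∣ f) : X ^ n ∣ tDer f := by
  obtain ⟨g, rfl⟩ := h
  rw [Derivation.leibniz, Derivation.leibniz_pow, tDer_X]
  cases n with
  | zero => simp
  | succ n =>
    refine dvd_add (dvd_mul_right _ _) ⟨g * ((n + 1 : ℕ) * 15), ?_⟩
    simp only [smul_eq_mul, nsmul_eq_mul, Nat.add_sub_cancel]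
    ring

/-- The Riccati equation for θ = 1 + u² r g, divided by r u². The term 9g comes from differentiating
u² r: its logarithmic `tDer` is 2(2u² - 3) + 15 = 4u² + 9, and -2u²θ removes 2u². -/
lemma exists_riccati : ∃ g q₁ : SpecRing, 3 * qSpec - 1 = X * q₁ ∧
    48 * g = 16 * q₁ + 6 * uVar + X * (-24 * uVar ^ 2 * g ^ 2
      - 3 * uVar * (tDer g + (2 * uVar ^ 2 + 9) * g)) := by
  obtain ⟨q₁, hq₁⟩ := X_dvd_iff.2
    ((coeff_zero_eq_constantCoeff_apply (3 * qSpec - 1)).symm.trans coeff_zero_qSpec)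
  obtain ⟨g, hg⟩ := exists_fixed_point (fun g : SpecRing => waveConst * (16 * q₁ + 6 * uVar
    + X * (-24 * uVar ^ 2 * g ^ 2 - 3 * uVar * (tDer g + (2 * uVar ^ 2 + 9) * g)))) (by
      intro n f g h
      have h2 : X ^ n ∣ tDer (f - g) := pow_dvd_tDer h
      obtain ⟨k, hk⟩ := h
      obtain ⟨l, hl⟩ := h2
      rw [map_sub] at hl
      refine ⟨waveConst * (-24 * uVar ^ 2 * k * (f + g)
        - 3 * uVar * (l + (2 * uVar ^ 2 + 9) * k)), ?_⟩
      linear_combination (waveConst * X * (-24 * uVar ^ 2 * (f + g)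
        - 3 * uVar * (2 * uVar ^ 2 + 9))) * hk - (waveConst * X * 3 * uVar) * hl)
  refine ⟨g, q₁, hq₁, ?_⟩
  linear_combination (-48) * hg + (16 * q₁ + 6 * uVar + X * (-24 * uVar ^ 2 * g ^ 2
      - 3 * uVar * (tDer g + (2 * uVar ^ 2 + 9) * g))) * mul_waveConst

lemma exists_isWave : ∃ g : SpecRing, IsWave qSpec (X * g) (1 + uVar ^ 2 * (X * g)) ∧
    coeff 0 (kappaWave qSpec (X * g) (1 + uVar ^ 2 * (X * g))) = 0 := by
  obtain ⟨g, q₁, h1, h2⟩ := exists_riccati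
  refine ⟨g, ⟨?_, rfl, ?_, qSpec_painleve, ?_⟩, ?_⟩
  · ext1 n; rw [qSpec, uDer, coeff_serDer, coeff_map, eulerPoly_C, map_zero]
  · rw [mul_left_comm, map_add, coeff_zero_X_mul]; simp
  · rw [map_add, Derivation.leibniz, Derivation.leibniz, Derivation.leibniz_pow, tDer_uVar,
      tDer_X, Derivation.map_one_eq_zero]
    simp only [smul_eq_mul, nsmul_eq_mul]
    push_cast
    linear_combination (X * uVar ^ 2) * h2 - 16 * uVar ^ 2 * h1
  · rw [kappaWave, h1]
    have : 4 * waveConst * (-48 * (1 - uVar ^ 2) * (X * g)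
        + 16 * (X * q₁) * (1 + uVar ^ 2 * (X * g)) - 3 * uVar * X * (tDer qSpec - 6 * qSpec)
        - 6 * X * uVar ^ 3)
      = X * (4 * waveConst * (-48 * (1 - uVar ^ 2) * g
        + 16 * q₁ * (1 + uVar ^ 2 * (X * g)) - 3 * uVar * (tDer qSpec - 6 * qSpec)
        - 6 * uVar ^ 3)) := by ring
    rw [this, coeff_zero_X_mul]

/-- The Hamiltonian function of the formal solution agrees with the one-point function of the
partition function. -/
theorem hamiltonian_eq_zDerivSeries :
    27 * X ^ 2 * (15 * serEuler qNum - 6 * qNum) ^ 2 - 6912 * qNum ^ 3 + 2304 * qNum - 512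
      = 3456 * (X * zDerivSeries 0) := by
  obtain ⟨g, hg, h0⟩ := exists_isWave
  have h1 := hg.phiWave_eq_phiTau h0
  have h2 := phiWave_eq (q := qSpec) (ϑ := X * g)
  rw [h1] at h2
  -- At u = 0 the term r u ϑ of φ disappears: the Hamiltonian remains on one side, the one-point
  -- function on the other.
  have h3 := congrArg (PowerSeries.map (Polynomial.constantCoeff : Polynomial ℂ →+* ℂ)) h2
  have h4 : PowerSeries.map (Polynomial.constantCoeff : Polynomial ℂ →+* ℂ) uVar = 0 := by
    rw [uVar, map_C]; simp
  have h5 : ∀ f : ℂ⟦X⟧, PowerSeries.map (Polynomial.constantCoeff : Polynomial ℂ →+* ℂ)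
      (PowerSeries.map Polynomial.C f) = f := by
    intro f; ext n; rw [coeff_map, coeff_map]; simp
  rw [sigmaDiff, qSpec, tDer_map] at h3
  simp only [map_add, map_sub, map_mul, map_pow, map_ofNat, PowerSeries.map_X, map_phiTau, h4, h5]
    at h3
  linear_combination -h3

end PainleveOne

end

noncomputable section
namespace PainleveOne

/-! ### The free energy of the partition function -/

open MvPolynomial

/-- The derivation with constant coefficients `∑ₖ vₖ ∂ₖ`. -/
def constDer (v : ℕ → ℂ) : Derivation ℂ TimeRing TimeRing := mkDerivation ℂ fun k => C (v k)

@[simp] lemma constDer_X (v : ℕ → ℂ) (k : ℕ) : constDer v (X k) = C (v k) := by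
  simp [constDer]

lemma constDer_comm (v w : ℕ → ℂ) (p : TimeRing) :
    constDer v (constDer w p) = constDer w (constDer v p) := by
  have h := commutator_ext (D₁ := constDer v) (D₂ := constDer w) (D₃ := 0)
    (fun k => by simp [derivation_C]) p
  simpa [sub_eq_zero] using h

lemma pderiv_eq_constDer (k : ℕ) :
    (pderiv k : Derivation ℂ TimeRing TimeRing) = constDer (Pi.single k 1) := by
  apply derivation_ext
  intro i
  rw [constDer_X, pderiv_X]
  by_cases h : k = i
  · subst h; simp
  · rw [Pi.single_eq_of_ne (Ne.symm h), Pi.single_eq_of_ne (Ne.symm h), map_zero]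

/-- The partition function. -/
def zSer : PowerSeries TimeRing := PowerSeries.mk zCoeff

/-- The inverse of the partition function. -/
def zInv : PowerSeries TimeRing := PowerSeries.invOfUnit zSer 1

lemma zSer_mul_zInv : zSer * zInv = 1 :=
  PowerSeries.mul_invOfUnit zSer 1 (by
    rw [← PowerSeries.coeff_zero_eq_constantCoeff_apply, zSer, PowerSeries.coeff_mk, zCoeff_zero]
    rfl)

/-- The logarithmic derivative of the partition function. -/
def dlog (D : Derivation ℂ TimeRing TimeRing) : PowerSeries TimeRing :=
  serDer D zSer * (PowerSeries.X * zInv)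

lemma coeff_dlog (D : Derivation ℂ TimeRing TimeRing) (m : ℕ) : PowerSeries.coeff m (dlog D)
    = ∑ x ∈ Finset.HasAntidiagonal.antidiagonal m,
      D (zCoeff x.1) * PowerSeries.coeff x.2 (PowerSeries.X * zInv) := by
  rw [dlog, PowerSeries.coeff_mul]
  simp [zSer]

lemma exists_zCoeff_bound (m : ℕ) :
    ∃ N, ∀ i ≤ m, ∀ k, N ≤ k → pderiv k (zCoeff i) = 0 := by
  choose B hB using fun i => exists_vars_bound (zCoeff i)
  refine ⟨∑ i ∈ Finset.range (m + 1), B i, fun i hi k hk => pderiv_eq_zero_of_bound (hB i) ?_⟩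
  exact (Finset.single_le_sum (f := B) (fun _ _ => Nat.zero_le _)
    (Finset.mem_range.2 (by omega))).trans hk

lemma serDer_dlog (D₁ D₂ : Derivation ℂ TimeRing TimeRing) : serDer D₁ (dlog D₂)
    = PowerSeries.X * (serDer D₁ (serDer D₂ zSer) * zInv
      - serDer D₁ zSer * serDer D₂ zSer * zInv ^ 2) := by
  rw [dlog, Derivation.leibniz, Derivation.leibniz, serDer_X,
    derivation_inverse (serDer D₁) zSer_mul_zInv]
  simp only [smul_eq_mul]; ring

/-- Mixed second logarithmic derivatives are symmetric and only finitely many first ones are nonzero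
in each order, so the Poincaré lemma supplies log Z without a logarithm of a series. -/
lemma exists_freeF (m : ℕ) :
    ∃ G : TimeRing, ∀ j, pderiv j G = PowerSeries.coeff m (dlog (pderiv j)) := by
  obtain ⟨N, hN⟩ := exists_zCoeff_bound m
  have h0 : ∀ k, N ≤ k → PowerSeries.coeff m (dlog (pderiv k)) = 0 := by
    intro k hk
    rw [coeff_dlog]
    refine Finset.sum_eq_zero fun x hx => ?_
    have hx' := Finset.HasAntidiagonal.mem_antidiagonal.1 hx
    rw [hN x.1 (by omega) k hk, zero_mul]
  have h : ∀ j k, pderiv j (PowerSeries.coeff m (dlog (pderiv k)))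
      = pderiv k (PowerSeries.coeff m (dlog (pderiv j))) := by
    intro j k
    rw [← coeff_serDer, ← coeff_serDer, serDer_dlog, serDer_dlog]
    have : serDer (pderiv j) (serDer (pderiv k) zSer) = serDer (pderiv k) (serDer (pderiv j) zSer)
    · ext1 n; simp only [coeff_serDer]; exact pderiv_comm _ _ _
    rw [this, mul_comm (serDer (pderiv j) zSer)]
  obtain ⟨G, hG, -⟩ := exists_potential h0 (fun j k hj => by rw [h, h0 j hj, map_zero]) h
  exact ⟨G, hG⟩

/-- The coefficients of the free energy, the logarithm of the partition function times `r`. -/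
def freeF (m : ℕ) : TimeRing := (exists_freeF m).choose

lemma pderiv_freeF (m j : ℕ) : pderiv j (freeF m) = PowerSeries.coeff m (dlog (pderiv j)) :=
  (exists_freeF m).choose_spec j

lemma exists_freeF_bound (m : ℕ) : ∃ M, ∀ k, M ≤ k → pderiv k (freeF m) = 0 :=
  (exists_vars_bound (freeF m)).imp fun _ hM _ hk => pderiv_eq_zero_of_bound hM hk

lemma derivation_freeF (D : Derivation ℂ TimeRing TimeRing) (m : ℕ) :
    D (freeF m) = PowerSeries.coeff m (dlog D) := by
  obtain ⟨N, hN⟩ := exists_zCoeff_bound m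
  obtain ⟨M, hM⟩ := exists_freeF_bound m
  rw [derivation_eq_sum D (M := max M N) fun k hk => hM k (le_trans (le_max_left _ _) hk),
    coeff_dlog]
  simp only [pderiv_freeF, coeff_dlog, Finset.mul_sum]
  rw [Finset.sum_comm]
  refine Finset.sum_congr rfl fun x hx => ?_
  have hx' := Finset.HasAntidiagonal.mem_antidiagonal.1 hx
  rw [derivation_eq_sum D (M := max M N)
    fun k hk => hN x.1 (by omega) k (le_trans (le_max_right _ _) hk), Finset.sum_mul]
  exact Finset.sum_congr rfl fun k _ => by ring

/-- The free energy. -/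
def freeSer : PowerSeries TimeRing := PowerSeries.mk freeF

lemma serDer_freeSer (D : Derivation ℂ TimeRing TimeRing) : serDer D freeSer = dlog D := by
  ext1 m; rw [coeff_serDer, freeSer, PowerSeries.coeff_mk, derivation_freeF]

/-- Z is 1 at the origin, so there ∂ log Z = ∂Z; the shift of index is the factor r in F = r log Z.
-/
lemma constantCoeff_pderiv_freeF (m d : ℕ) : constantCoeff (pderiv d (freeF (m + 1)))
    = PowerSeries.coeff m (zDerivSeries d) := by
  have h1 : PowerSeries.map (constantCoeff : TimeRing →+* ℂ) zSer = 1 := by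
    ext n
    rw [PowerSeries.coeff_map, zSer, PowerSeries.coeff_mk, constantCoeff_zCoeff,
      PowerSeries.coeff_one]
  have h2 := congrArg (PowerSeries.map (constantCoeff : TimeRing →+* ℂ)) zSer_mul_zInv
  rw [map_mul, h1, one_mul, map_one] at h2
  have h3 : PowerSeries.map (constantCoeff : TimeRing →+* ℂ) (dlog (pderiv d))
      = PowerSeries.X * zDerivSeries d := by
    rw [dlog, map_mul, map_mul, h2, mul_one, PowerSeries.map_X, mul_comm]
    congr 1
    ext n
    rw [PowerSeries.coeff_map, coeff_serDer, zSer, PowerSeries.coeff_mk, zDerivSeries,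
      PowerSeries.coeff_mk]
  rw [pderiv_freeF, ← PowerSeries.coeff_map, h3, PowerSeries.coeff_succ_X_mul]

/-- The generating derivation of the first order parts of the Virasoro operators. -/
def genB (y : ℂ) : Derivation ℂ TimeRing TimeRing :=
  mkDerivation ℂ fun k => ∑ m ∈ Finset.range (k + 2), (2 * (m : TimeRing) + 1) * X m
    * C y ^ (k + 2 - m)

lemma constraint_zCoeff (y : ℂ) (n : ℕ) :
    (C y - 1) * constDer (fun k => y ^ (k + 1)) (zCoeff (n + 1))
      + C y * pderiv 0 (zCoeff (n + 1))
      = C y * (8 * unitConst * genB y (zCoeff n)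
        + 4 * unitConst * (C y * constDer (fun k => y ^ (k + 1))
          (constDer (fun k => y ^ (k + 1)) (zCoeff n)))
        + unitConst * (4 * C y * X 0 ^ 2 + C y ^ 2) * zCoeff n) := by
  obtain ⟨M, hM⟩ := exists_zCoeff_bound (n + 1)
  have h := generating_constraint (RingHom.id TimeRing) (C y)
    (fun d => shiftDiff_zCoeff_succ d n) (hM (n + 1) le_rfl) (hM n (by omega))
  simp only [RingHom.id_apply] at h
  have e1 : ∀ p : TimeRing, (∀ k, M ≤ k → pderiv k p = 0) →
      constDer (fun k => y ^ (k + 1)) p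
        = ∑ k ∈ Finset.range M, C y ^ (k + 1) * pderiv k p := by
    intro p hp
    rw [derivation_eq_sum _ hp]
    simp
  have e2 : genB y (zCoeff n) = ∑ k ∈ Finset.range M, (∑ m ∈ Finset.range (k + 2),
      (2 * (m : TimeRing) + 1) * X m * C y ^ (k + 2 - m)) * pderiv k (zCoeff n) := by
    rw [derivation_eq_sum _ (hM n (by omega))]
    simp [genB]
  rw [e1 _ (hM (n + 1) le_rfl), e1 (zCoeff n) (hM n (by omega)), e1, e2, h]
  · simp only [map_sum, Derivation.leibniz, Derivation.leibniz_pow, derivation_C, smul_eq_mul,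
      smul_zero, mul_zero, add_zero, Finset.mul_sum, mul_assoc]
  · intro k hk
    rw [map_sum]
    refine Finset.sum_eq_zero fun i _ => ?_
    rw [Derivation.leibniz, pderiv_comm, hM n (by omega) k hk, Derivation.leibniz_pow,
      derivation_C]
    simp

section Loop

open PowerSeries (coeff)

/-- The loop equation for the free energy. -/
lemma loop_freeSer (y : ℂ) (cy c : PowerSeries TimeRing) (hcy : cy = PowerSeries.C (C y))
    (hc : c = PowerSeries.C unitConst) :
    (cy - 1) * serDer (constDer fun k => y ^ (k + 1)) freeSer + cy * serDer (pderiv 0) freeSer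
      = PowerSeries.X * (8 * c * cy * serDer (genB y) freeSer)
        + 4 * c * cy ^ 2 * (PowerSeries.X * serDer (constDer fun k => y ^ (k + 1))
          (serDer (constDer fun k => y ^ (k + 1)) freeSer)
          + serDer (constDer fun k => y ^ (k + 1)) freeSer ^ 2)
        + PowerSeries.X ^ 2 * (c * cy * (4 * cy * PowerSeries.C (X 0) ^ 2 + cy ^ 2)) := by
  set D := constDer fun k => y ^ (k + 1) with hD
  have hz : (cy - 1) * serDer D zSer + cy * serDer (pderiv 0) zSer
      = PowerSeries.X * (cy * (8 * c * serDer (genB y) zSer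
        + 4 * c * (cy * serDer D (serDer D zSer))
        + c * (4 * cy * PowerSeries.C (X 0) ^ 2 + cy ^ 2) * zSer)) := by
    have e1 : (cy - 1) * serDer D zSer + cy * serDer (pderiv 0) zSer
        = PowerSeries.C (C y - 1) * serDer D zSer
          + PowerSeries.C (C y) * serDer (pderiv 0) zSer := by
      rw [hcy, map_sub, map_one]
    have e2 : cy * (8 * c * serDer (genB y) zSer
        + 4 * c * (cy * serDer D (serDer D zSer))
        + c * (4 * cy * PowerSeries.C (X 0) ^ 2 + cy ^ 2) * zSer)
        = PowerSeries.C (C y) * (PowerSeries.C (8 * unitConst) * serDer (genB y) zSer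
        + PowerSeries.C (4 * unitConst) * (PowerSeries.C (C y) * serDer D (serDer D zSer))
        + PowerSeries.C (unitConst * (4 * C y * X 0 ^ 2 + C y ^ 2)) * zSer) := by
      simp only [hcy, hc, map_mul, map_add, map_pow, map_ofNat]
    rw [e1, e2]
    ext1 n
    cases n with
    | zero =>
      rw [PowerSeries.coeff_zero_X_mul]
      simp only [map_add, PowerSeries.coeff_C_mul, coeff_serDer, zSer, PowerSeries.coeff_mk,
        zCoeff_zero]
      simp
    | succ n =>
      rw [PowerSeries.coeff_succ_X_mul]
      simp only [map_add, PowerSeries.coeff_C_mul, coeff_serDer, zSer, PowerSeries.coeff_mk]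
      exact constraint_zCoeff y n
  -- Multiplication by r/Z. With F = r log Z one has r² D²Z/Z = r D²F + (DF)²: the two terms become
  -- W_{g-1,n+2} and the products in the recursion.
  have h1 := zSer_mul_zInv
  rw [serDer_freeSer, serDer_freeSer, serDer_freeSer, serDer_dlog, dlog, dlog, dlog]
  linear_combination PowerSeries.X * zInv * hz
    + PowerSeries.X ^ 2 * (c * cy * (4 * cy * PowerSeries.C (X 0) ^ 2 + cy ^ 2)) * h1

end Loop

end PainleveOne

end

noncomputable section
namespace PainleveOne

/-! ### Correlators -/

open MvPolynomial

/-- The coefficients of the derivation attached to a point `z` of the spectral curve. -/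
def ptCoeff (s z : ℂ) (k : ℕ) : ℂ := s ^ 3 * (1 / (s * z ^ 2)) ^ (k + 1)

/-- The derivation attached to a point `z` of the spectral curve. -/
def ptDer (s z : ℂ) : Derivation ℂ TimeRing TimeRing := constDer (ptCoeff s z)

lemma ptDer_neg (s z : ℂ) : ptDer s (-z) = ptDer s z := by
  rw [ptDer, ptDer]; congr 1; ext k; simp [ptCoeff]

/-- Constant coefficient derivations commute, so iterated derivatives depend only on the multiset of
points; the symmetry of the correlators is then built in. -/
instance ptDer_leftCommutative (s : ℂ) :
    LeftCommutative fun (w : ℂ) (p : TimeRing) => ptDer s w p :=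
  ⟨fun _ _ _ => constDer_comm _ _ _⟩

/-- The iterated derivative at several points of the spectral curve. -/
def multiDer (s : ℂ) (m : Multiset ℂ) (p : TimeRing) : TimeRing :=
  m.foldr (fun w q => ptDer s w q) p

@[simp] lemma multiDer_zero (s : ℂ) (p : TimeRing) : multiDer s 0 p = p := rfl

lemma multiDer_cons (s w : ℂ) (m : Multiset ℂ) (p : TimeRing) :
    multiDer s (w ::ₘ m) p = ptDer s w (multiDer s m p) := Multiset.foldr_cons _ _ _ _

lemma multiDer_constDer (s : ℂ) (v : ℕ → ℂ) (m : Multiset ℂ) (p : TimeRing) :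
    multiDer s m (constDer v p) = constDer v (multiDer s m p) := by
  induction m using Multiset.induction_on with
  | empty => rfl
  | cons w m ih => rw [multiDer_cons, multiDer_cons, ih]; exact constDer_comm _ _ _

lemma multiDer_cons' (s w : ℂ) (m : Multiset ℂ) (p : TimeRing) :
    multiDer s (w ::ₘ m) p = multiDer s m (ptDer s w p) := by
  rw [multiDer_cons, ptDer, multiDer_constDer]

lemma multiDer_pderiv (s : ℂ) (k : ℕ) (m : Multiset ℂ) (p : TimeRing) :
    multiDer s m (pderiv k p) = pderiv k (multiDer s m p) := by
  rw [pderiv_eq_constDer, multiDer_constDer]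

lemma multiDer_add (s : ℂ) (m : Multiset ℂ) (p q : TimeRing) :
    multiDer s m (p + q) = multiDer s m p + multiDer s m q := by
  induction m using Multiset.induction_on with
  | empty => rfl
  | cons w m ih => rw [multiDer_cons, multiDer_cons, multiDer_cons, ih, map_add]

lemma multiDer_const_mul (s : ℂ) (m : Multiset ℂ) (c : ℂ) (p : TimeRing) :
    multiDer s m (C c * p) = C c * multiDer s m p := by
  induction m using Multiset.induction_on with
  | empty => rfl
  | cons w m ih =>
    rw [multiDer_cons, multiDer_cons, ih, Derivation.leibniz, derivation_C, smul_zero, add_zero,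
      smul_eq_mul]

lemma multiDer_sum {κ : Type*} (s : ℂ) (m : Multiset ℂ) (S : Finset κ) (f : κ → TimeRing) :
    multiDer s m (∑ i ∈ S, f i) = ∑ i ∈ S, multiDer s m (f i) := by
  classical
  induction S using Finset.induction_on with
  | empty => simpa using multiDer_const_mul s m 0 0
  | insert a S ha ih => rw [Finset.sum_insert ha, Finset.sum_insert ha, multiDer_add, ih]

lemma multiDer_C (s : ℂ) (m : Multiset ℂ) (c : ℂ) :
    multiDer s m (C c) = if m = 0 then C c else 0 := by
  induction m using Multiset.induction_on with
  | empty => simp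
  | cons w m ih => rw [multiDer_cons, ih]; split_ifs <;> simp [derivation_C] at *

/-! ### Leibniz and commutator rules over index sets, and the loop equation in the variable z -/

section Finsets

variable {ι : Type*}

/-- The multiset of the points with index in `K`. -/
def pts (zs : ι → ℂ) (K : Finset ι) : Multiset ℂ := K.val.map zs

@[simp] lemma pts_empty (zs : ι → ℂ) : pts zs ∅ = 0 := rfl

variable [DecidableEq ι]

lemma pts_insert (zs : ι → ℂ) {i : ι} {K : Finset ι} (h : i ∉ K) :
    pts zs (insert i K) = zs i ::ₘ pts zs K := by
  rw [pts, Finset.insert_val_of_notMem h, Multiset.map_cons, pts]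

lemma multiDer_mul (s : ℂ) (zs : ι → ℂ) (K : Finset ι) (p q : TimeRing) :
    multiDer s (pts zs K) (p * q)
      = ∑ L ∈ K.powerset, multiDer s (pts zs L) p * multiDer s (pts zs (K \ L)) q := by
  induction K using Finset.induction_on with
  | empty => simp
  | insert i K hi ih =>
    rw [pts_insert zs hi, multiDer_cons, ih, map_sum, Finset.sum_powerset_insert hi,
      ← Finset.sum_add_distrib]
    refine Finset.sum_congr rfl fun L hL => ?_
    have hL' := Finset.mem_powerset.1 hL
    have hiL : i ∉ L := fun h => hi (hL' h)
    have h1 : insert i K \ L = insert i (K \ L) := Finset.insert_sdiff_of_notMem K hiL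
    have h2 : insert i K \ insert i L = K \ L := by
      ext x; simp only [Finset.mem_sdiff, Finset.mem_insert]
      constructor
      · rintro ⟨h3, h4⟩; push Not at h4; exact ⟨h3.resolve_left h4.1, h4.2⟩
      · rintro ⟨h3, h4⟩
        exact ⟨Or.inr h3, fun h5 => h5.elim (fun h6 => hi (h6 ▸ h3)) h4⟩
    rw [h1, h2, pts_insert zs hiL, pts_insert zs (i := i) (K := K \ L)
      (fun h => hi (Finset.mem_sdiff.1 h).1), multiDer_cons, multiDer_cons, Derivation.leibniz]
    simp only [smul_eq_mul]; ring

/-- The coefficients of the commutator of `ptDer s w` and `genB y`. -/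
def genBeta (s y w : ℂ) (k : ℕ) : ℂ :=
  ∑ m ∈ Finset.range (k + 2), (2 * (m : ℂ) + 1) * ptCoeff s w m * y ^ (k + 2 - m)

lemma ptDer_genB (s y w : ℂ) (p : TimeRing) :
    ptDer s w (genB y p) = genB y (ptDer s w p) + constDer (genBeta s y w) p := by
  have h := commutator_ext (D₁ := ptDer s w) (D₂ := genB y) (D₃ := constDer (genBeta s y w))
    (fun k => by
      have e1 : genB y (ptDer s w (X k)) = 0 := by rw [ptDer, constDer_X, derivation_C]
      rw [e1, sub_zero, genB, mkDerivation_X, constDer_X, genBeta, map_sum, map_sum]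
      refine Finset.sum_congr rfl fun m _ => ?_
      have h1 : ptDer s w (m : TimeRing) = 0 := Derivation.map_natCast _ _
      have h2 : ptDer s w (2 : TimeRing) = 0 := derivation_ofNat _ _
      have h3 : ptDer s w (X m) = C (ptCoeff s w m) := constDer_X _ _
      rw [Derivation.leibniz, Derivation.leibniz, Derivation.leibniz_pow, derivation_C, map_add,
        Derivation.leibniz, h1, h2, h3, Derivation.map_one_eq_zero]
      simp only [map_mul, map_add, map_pow, map_natCast, map_one, smul_eq_mul, smul_zero,
        mul_zero, add_zero, zero_add]
      rw [map_ofNat]; ring) p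
  rw [← h]; ring

/-- The commutator of `genB` with a point derivation has constant coefficients, hence at most one
point is absorbed. The resulting terms match those of the recursion containing one factor W_{0,2}.
-/
lemma multiDer_genB (s y : ℂ) (zs : ι → ℂ) (K : Finset ι) (p : TimeRing) :
    multiDer s (pts zs K) (genB y p) = genB y (multiDer s (pts zs K) p)
      + ∑ i ∈ K, multiDer s (pts zs (K.erase i)) (constDer (genBeta s y (zs i)) p) := by
  induction K using Finset.induction_on with
  | empty => simp
  | insert i K hi ih =>
    rw [pts_insert zs hi, multiDer_cons, multiDer_cons, ih, map_add, map_sum, ptDer_genB,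
      Finset.sum_insert hi, Finset.erase_insert hi, multiDer_constDer s _ (pts zs K), add_assoc]
    congr 2
    refine Finset.sum_congr rfl fun k hk => ?_
    have hki : k ≠ i := fun h => hi (h ▸ hk)
    rw [Finset.erase_insert_of_ne hki.symm, pts_insert zs (fun h => hi (Finset.mem_of_mem_erase h)),
      multiDer_cons]

lemma constantCoeff_genB (y : ℂ) (p : TimeRing) : constantCoeff (genB y p) = 0 := by
  obtain ⟨M, hM⟩ := exists_vars_bound p
  rw [derivation_eq_sum _ fun k hk => pderiv_eq_zero_of_bound hM hk, map_sum]
  refine Finset.sum_eq_zero fun k _ => ?_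
  simp [genB]

/-- The correlators, up to a power of `s`. -/
def corr (s : ℂ) (j : ℕ) (m : Multiset ℂ) : ℂ := constantCoeff (multiDer s m (freeF j))

/-- The Laurent coefficients of the correlators. -/
def corrCoeff (s : ℂ) (j : ℕ) (m : Multiset ℂ) (k : ℕ) : ℂ :=
  constantCoeff (multiDer s m (pderiv k (freeF j)))

/-- A bound for the number of Laurent coefficients of a correlator. -/
def corrBound (j : ℕ) : ℕ := (exists_freeF_bound j).choose

lemma corrBound_spec (j k : ℕ) (h : corrBound j ≤ k) : pderiv k (freeF j) = 0 :=
  (exists_freeF_bound j).choose_spec k h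

lemma constDer_freeF (s : ℂ) (v : ℕ → ℂ) (j : ℕ) (m : Multiset ℂ) :
    constantCoeff (multiDer s m (constDer v (freeF j)))
      = ∑ k ∈ Finset.range (corrBound j), v k * corrCoeff s j m k := by
  rw [derivation_eq_sum _ (corrBound_spec j), multiDer_sum, map_sum]
  refine Finset.sum_congr rfl fun k _ => ?_
  rw [constDer_X, multiDer_const_mul, map_mul, constantCoeff_C, corrCoeff]

lemma corr_cons (s : ℂ) (j : ℕ) (z : ℂ) (m : Multiset ℂ) : corr s j (z ::ₘ m)
    = ∑ k ∈ Finset.range (corrBound j), ptCoeff s z k * corrCoeff s j m k := by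
  rw [corr, multiDer_cons', ptDer, constDer_freeF]

lemma corr_neg_cons (s : ℂ) (j : ℕ) (z : ℂ) (m : Multiset ℂ) :
    corr s j (-z ::ₘ m) = corr s j (z ::ₘ m) := by
  rw [corr, multiDer_cons, ptDer_neg, ← multiDer_cons, corr]

/-- Since DZ = O(r), the derivatives of F = r log Z start at order 2. Orders 0 and 1 would
correspond to the unstable W_{0,1} and W_{0,2}, which are absent from the correlators. -/
lemma freeF_zero_eq (D : Derivation ℂ TimeRing TimeRing) : D (freeF 0) = 0 := by
  rw [derivation_freeF, coeff_dlog]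
  simp [zCoeff_zero]

lemma freeF_one_eq (D : Derivation ℂ TimeRing TimeRing) : D (freeF 1) = 0 := by
  rw [derivation_freeF, coeff_dlog]
  rw [Finset.Nat.sum_antidiagonal_succ]
  simp [zCoeff_zero]

lemma corr_zero_cons (s z : ℂ) (m : Multiset ℂ) : corr s 0 (z ::ₘ m) = 0 := by
  rw [corr, multiDer_cons', freeF_zero_eq]; simpa using congrArg constantCoeff (multiDer_const_mul s m 0 0)

lemma corr_one_cons (s z : ℂ) (m : Multiset ℂ) : corr s 1 (z ::ₘ m) = 0 := by
  rw [corr, multiDer_cons', freeF_one_eq]; simpa using congrArg constantCoeff (multiDer_const_mul s m 0 0)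

/-- The value of the iterated derivative of the first variable. -/
def firstVar (s : ℂ) (m : Multiset ℂ) : ℂ := constantCoeff (multiDer s m (X 0))

lemma firstVar_zero (s : ℂ) : firstVar s 0 = 0 := by simp [firstVar]

lemma firstVar_cons (s w : ℂ) (m : Multiset ℂ) :
    firstVar s (w ::ₘ m) = if m = 0 then ptCoeff s w 0 else 0 := by
  rw [firstVar, multiDer_cons', ptDer, constDer_X, multiDer_C]
  split_ifs <;> simp

/-- The loop equation for the coefficients of the free energy. -/
lemma loop_freeF {s z : ℂ} (hs : s ≠ 0) (hz : z ≠ 0) (l : ℕ) :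
    C (1 - s * z ^ 2) * ptDer s z (freeF (l + 1)) + C (s ^ 3) * pderiv 0 (freeF (l + 1))
      = C (s ^ 3 / 4) * genB (1 / (s * z ^ 2)) (freeF l)
        + C (8 * s ^ 4 * z ^ 2)⁻¹ * (ptDer s z (ptDer s z (freeF l))
          + ∑ x ∈ Finset.HasAntidiagonal.antidiagonal (l + 1),
            ptDer s z (freeF x.1) * ptDer s z (freeF x.2))
        + if l = 1 then C (s ^ 3 / 32 * (4 * (1 / (s * z ^ 2)))) * (X 0 * X 0)
          + C (s ^ 3 / 32 * (1 / (s * z ^ 2)) ^ 2) else 0 := by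
  set y := 1 / (s * z ^ 2) with hy
  have hy1 : y * (s * z ^ 2) = 1 := by
    rw [hy]; field_simp
  set D := constDer fun k => y ^ (k + 1) with hD
  have hpt : ∀ p, ptDer s z p = C (s ^ 3) * D p := by
    intro p
    have : ptDer s z = (C (s ^ 3) : TimeRing) • D := by
      apply derivation_ext
      intro k
      rw [ptDer, constDer_X, Derivation.smul_apply, hD, constDer_X, smul_eq_mul, ← map_mul]
      rfl
    rw [this, Derivation.smul_apply, smul_eq_mul]
  have h := congrArg (PowerSeries.coeff (l + 1)) (loop_freeSer y _ _ rfl rfl)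
  have e1 : ∀ f : PowerSeries TimeRing, (PowerSeries.C (C y) - 1) * f
      = PowerSeries.C (C y - 1) * f := fun f => by rw [map_sub, map_one]
  have e2 : ∀ f : PowerSeries TimeRing, 8 * PowerSeries.C unitConst * PowerSeries.C (C y) * f
      = PowerSeries.C (8 * unitConst * C y) * f := fun f => by simp only [map_mul, map_ofNat]
  have e3 : ∀ f : PowerSeries TimeRing, 4 * PowerSeries.C unitConst * PowerSeries.C (C y) ^ 2 * f
      = PowerSeries.C (4 * unitConst * C y ^ 2) * f :=
    fun f => by simp only [map_mul, map_ofNat, map_pow]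
  have e4 : PowerSeries.C unitConst * PowerSeries.C (C y) * (4 * PowerSeries.C (C y)
      * PowerSeries.C (X 0) ^ 2 + PowerSeries.C (C y) ^ 2)
      = PowerSeries.C (unitConst * C y * (4 * C y * X 0 ^ 2 + C y ^ 2)) := by
    simp only [map_mul, map_ofNat, map_pow, map_add]
  rw [e1, e2, e3, e4] at h
  have e5 : ∀ p : TimeRing, PowerSeries.coeff (l + 1) (PowerSeries.X ^ 2 * PowerSeries.C p)
      = if l = 1 then p else 0 := by
    intro p
    rw [mul_comm, PowerSeries.coeff_C_mul, PowerSeries.coeff_X_pow]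
    simp
  rw [map_add, map_add, map_add, e5, PowerSeries.coeff_C_mul, PowerSeries.coeff_C_mul,
    PowerSeries.coeff_succ_X_mul, PowerSeries.coeff_C_mul, PowerSeries.coeff_C_mul, map_add,
    PowerSeries.coeff_succ_X_mul, pow_two (serDer D freeSer), PowerSeries.coeff_mul] at h
  simp only [coeff_serDer, freeSer, PowerSeries.coeff_mk] at h
  simp only [hpt, Derivation.leibniz, derivation_C, smul_eq_mul, mul_zero, add_zero]
  have h6 : ∑ x ∈ Finset.HasAntidiagonal.antidiagonal (l + 1),
      C (s ^ 3) * D (freeF x.1) * (C (s ^ 3) * D (freeF x.2))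
      = C (s ^ 3) ^ 2 * ∑ x ∈ Finset.HasAntidiagonal.antidiagonal (l + 1),
        D (freeF x.1) * D (freeF x.2) := by
    rw [Finset.mul_sum]; exact Finset.sum_congr rfl fun x _ => by ring
  rw [h6]
  set S := ∑ x ∈ Finset.HasAntidiagonal.antidiagonal (l + 1), D (freeF x.1) * D (freeF x.2)
  have hu : (unitConst : TimeRing) = C (1 / 32) := rfl
  have c8 : (8 : TimeRing) = C 8 := (map_ofNat _ _).symm
  have c4 : (4 : TimeRing) = C 4 := (map_ofNat _ _).symm
  rw [hu, c8, c4] at h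
  -- The coefficient equation is multiplied by s⁴z² = s³/y, which turns y - 1 into s³(1 - s z²).
  have k1 : (C (s ^ 4 * z ^ 2) : TimeRing) * (C y - 1) = C (s ^ 3) * C (1 - s * z ^ 2) := by
    rw [← map_one C, ← map_sub, ← map_mul, ← map_mul]; congr 1
    linear_combination s ^ 3 * hy1
  have k2 : (C (s ^ 4 * z ^ 2) : TimeRing) * C y = C (s ^ 3) := by
    rw [← map_mul]; congr 1; linear_combination s ^ 3 * hy1
  have k3 : (C (s ^ 4 * z ^ 2) : TimeRing) * (C 8 * C (1 / 32) * C y) = C (s ^ 3 / 4) := by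
    rw [← map_mul, ← map_mul, ← map_mul]; congr 1; linear_combination s ^ 3 / 4 * hy1
  have k4 : (C (s ^ 4 * z ^ 2) : TimeRing) * (C 4 * C (1 / 32) * C y ^ 2)
      = C (8 * s ^ 4 * z ^ 2)⁻¹ * C (s ^ 3) ^ 2 := by
    rw [← map_mul, ← map_pow, ← map_mul, ← map_mul, ← map_pow, ← map_mul]; congr 1
    rw [hy]; field_simp; ring
  have k5 : (C (s ^ 4 * z ^ 2) : TimeRing) * (C (1 / 32) * C y * (C 4 * C y * X 0 ^ 2 + C y ^ 2))
      = C (s ^ 3 / 32 * (4 * y)) * (X 0 * X 0) + C (s ^ 3 / 32 * y ^ 2) := by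
    have t1 : (C (s ^ 4 * z ^ 2) : TimeRing) * (C (1 / 32) * C y * C 4 * C y)
        = C (s ^ 3 / 32 * (4 * y)) := by
      simp only [← map_mul]; congr 1; linear_combination s ^ 3 / 8 * y * hy1
    have t2 : (C (s ^ 4 * z ^ 2) : TimeRing) * (C (1 / 32) * C y * C y ^ 2)
        = C (s ^ 3 / 32 * y ^ 2) := by
      simp only [← map_mul, ← map_pow]; congr 1; linear_combination s ^ 3 / 32 * y ^ 2 * hy1
    rw [← t1, ← t2]; ring
  have h' := congrArg (fun p => (C (s ^ 4 * z ^ 2) : TimeRing) * p) h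
  simp only [mul_add, mul_ite, mul_zero] at h'
  simp only [← mul_assoc] at h' ⊢
  simp only [← mul_assoc] at k1 k2 k3 k4 k5
  rw [k1, k2, k3, k4] at h'
  rw [← mul_add] at h'
  split_ifs at h' ⊢ with hl
  · linear_combination h' + k5
  · linear_combination h'

end Finsets

end PainleveOne

end

noncomputable section
namespace PainleveOne

/-! ### The loop equation for the correlators -/

open MvPolynomial

lemma corrCoeff_eq_zero_of_le (s : ℂ) (m : Multiset ℂ) {j k : ℕ} (h : corrBound j ≤ k) :
    corrCoeff s j m k = 0 := by
  rw [corrCoeff, multiDer_pderiv]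
  have h1 : multiDer s m (pderiv k (freeF j)) = 0 := by
    rw [corrBound_spec j k h]; simpa using multiDer_const_mul s m 0 0
  rw [← multiDer_pderiv, h1, map_zero]

lemma corrCoeff_of_lt_two (s : ℂ) (m : Multiset ℂ) {j : ℕ} (h : j < 2) (k : ℕ) :
    corrCoeff s j m k = 0 := by
  have h1 : pderiv k (freeF j) = 0 := by
    interval_cases j
    · exact freeF_zero_eq _
    · exact freeF_one_eq _
  rw [corrCoeff, h1]; simpa using congrArg constantCoeff (multiDer_const_mul s m 0 0)

lemma firstVar_of_card_ne_one (s : ℂ) (m : Multiset ℂ) (h : m.card ≠ 1) : firstVar s m = 0 := by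
  induction m using Multiset.induction_on with
  | empty => exact firstVar_zero s
  | cons w m _ =>
    rw [firstVar_cons, if_neg]
    rintro rfl; exact h rfl

lemma card_pts {ι : Type*} (zs : ι → ℂ) (K : Finset ι) : (pts zs K).card = K.card := by
  simp [pts]

lemma exists_pts (m : Multiset ℂ) : ∃ (n : ℕ) (zs : Fin n → ℂ), pts zs Finset.univ = m := by
  induction m using Quotient.inductionOn with
  | h l => exact ⟨l.length, l.get, by
      rw [pts, Fin.univ_val_map, List.ofFn_get]; rfl⟩

/-- The loop equation differentiated at the points of K and evaluated at the origin. There `genB`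
itself vanishes, its coefficients being linear in the times, and only its commutators survive. -/
lemma loop_corr {ι : Type*} [DecidableEq ι] {s z : ℂ} (hs : s ≠ 0) (hz : z ≠ 0) (zs : ι → ℂ)
    (K : Finset ι) (l : ℕ) :
    (1 - s * z ^ 2) * corr s (l + 1) (z ::ₘ pts zs K)
        + s ^ 3 * corrCoeff s (l + 1) (pts zs K) 0
      = s ^ 3 / 4 * ∑ i ∈ K, ∑ k ∈ Finset.range (corrBound l),
          genBeta s (1 / (s * z ^ 2)) (zs i) k * corrCoeff s l (pts zs (K.erase i)) k
        + (8 * s ^ 4 * z ^ 2)⁻¹ * (corr s l (z ::ₘ z ::ₘ pts zs K)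
          + ∑ L ∈ K.powerset, ∑ x ∈ Finset.HasAntidiagonal.antidiagonal (l + 1),
            corr s x.1 (z ::ₘ pts zs L) * corr s x.2 (z ::ₘ pts zs (K \ L)))
        + if l = 1 then s ^ 3 / 32 * (4 * (1 / (s * z ^ 2))) * (∑ L ∈ K.powerset,
            firstVar s (pts zs L) * firstVar s (pts zs (K \ L)))
          + s ^ 3 / 32 * (1 / (s * z ^ 2)) ^ 2 * (if K = ∅ then 1 else 0) else 0 := by
  have h0 := loop_freeF hs hz l
  generalize s ^ 3 / 32 * (4 * (1 / (s * z ^ 2))) = a at h0 ⊢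
  generalize s ^ 3 / 32 * (1 / (s * z ^ 2)) ^ 2 = b at h0 ⊢
  have h := congrArg (fun p => constantCoeff (multiDer s (pts zs K) p)) h0
  have hite : ∀ p : TimeRing, constantCoeff (multiDer s (pts zs K) (if l = 1 then p else 0))
      = if l = 1 then constantCoeff (multiDer s (pts zs K) p) else 0 := by
    intro p
    split_ifs
    · rfl
    · simpa using congrArg constantCoeff (multiDer_const_mul s (pts zs K) 0 0)
  have hK : pts zs K = 0 ↔ K = ∅ := by
    rw [← Multiset.card_eq_zero, card_pts, Finset.card_eq_zero]
  simp only [multiDer_add, multiDer_const_mul, map_add, map_mul, constantCoeff_C, hite,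
    multiDer_genB, multiDer_sum, multiDer_mul, map_sum, constantCoeff_genB, constDer_freeF,
    multiDer_C, hK, zero_add] at h
  simp only [corr, multiDer_cons', corrCoeff]
  rw [Finset.sum_comm (s := K.powerset)]
  simp only [corrCoeff] at h
  rw [h]
  congr 1
  split_ifs <;> simp [firstVar]

/-- The genus expansion. By induction every term on the right of the loop equation violates the same
condition; the inhomogeneous terms occur only at order 2 with no or two further points, which is
allowed. -/
lemma corrCoeff_eq_zero {s : ℂ} (hs : s ≠ 0) (j : ℕ) : ∀ m : Multiset ℂ,
    (∀ g, j ≠ 2 * g + m.card) → ∀ k, corrCoeff s j m k = 0 := by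
  induction j using Nat.strong_induction_on with
  | _ j ih =>
  intro m hm
  rcases lt_or_ge j 2 with hj | hj
  · exact corrCoeff_of_lt_two s m hj
  obtain ⟨l, rfl⟩ : ∃ l, j = l + 1 := ⟨j - 1, by omega⟩
  obtain ⟨n, zs, rfl⟩ := exists_pts m
  set K : Finset (Fin n) := Finset.univ
  have hcorr : ∀ i < l + 1, ∀ m : Multiset ℂ, (∀ g, i ≠ 2 * g + m.card) →
      ∀ z, corr s i (z ::ₘ m) = 0 := by
    intro i hi m hm z
    rw [corr_cons]
    exact Finset.sum_eq_zero fun k _ => by rw [ih i hi m hm, mul_zero]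
  simp only [card_pts] at hm
  have key : ∀ z : ℂ, z ≠ 0 → (1 - s * z ^ 2) * corr s (l + 1) (z ::ₘ pts zs K)
        + s ^ 3 * corrCoeff s (l + 1) (pts zs K) 0 = 0 := by
    intro z hz
    rw [loop_corr hs hz zs K l]
    have t1 : ∑ i ∈ K, ∑ k ∈ Finset.range (corrBound l),
          genBeta s (1 / (s * z ^ 2)) (zs i) k * corrCoeff s l (pts zs (K.erase i)) k = 0 := by
      refine Finset.sum_eq_zero fun i hi => Finset.sum_eq_zero fun k _ => ?_
      rw [ih l (Nat.lt_succ_self l), mul_zero]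
      intro g hg
      have h2 := Finset.card_pos.2 ⟨i, hi⟩
      rw [card_pts, Finset.card_erase_of_mem hi] at hg
      exact hm g (by omega)
    have t2 : corr s l (z ::ₘ z ::ₘ pts zs K) = 0 := by
      refine hcorr l (Nat.lt_succ_self l) _ (fun g hg => ?_) z
      rw [Multiset.card_cons, card_pts] at hg
      exact hm (g + 1) (by omega)
    have t3 : ∑ L ∈ K.powerset, ∑ x ∈ Finset.HasAntidiagonal.antidiagonal (l + 1),
            corr s x.1 (z ::ₘ pts zs L) * corr s x.2 (z ::ₘ pts zs (K \ L)) = 0 := by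
      refine Finset.sum_eq_zero fun L hL => Finset.sum_eq_zero fun x hx => ?_
      have hx' := Finset.HasAntidiagonal.mem_antidiagonal.1 hx
      have hc := Finset.card_sdiff_add_card_eq_card (Finset.mem_powerset.1 hL)
      rcases Nat.eq_zero_or_pos x.1 with h1 | h1
      · rw [h1, corr_zero_cons, zero_mul]
      rcases Nat.eq_zero_or_pos x.2 with h2 | h2
      · rw [h2, corr_zero_cons, mul_zero]
      by_cases h3 : ∃ g, x.1 = 2 * g + L.card
      · rw [hcorr x.2 (by omega) (pts zs (K \ L)), mul_zero]
        intro g hg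
        obtain ⟨g', hg'⟩ := h3
        rw [card_pts] at hg
        exact hm (g + g') (by omega)
      · rw [hcorr x.1 (by omega) (pts zs L), zero_mul]
        intro g hg
        exact h3 ⟨g, by rw [hg, card_pts]⟩
    rw [t1, t2, t3]
    split_ifs with hl hK
    · exact absurd (by rw [hK, hl]; rfl) (hm 1)
    rotate_left
    · ring
    · have t4 : ∑ L ∈ K.powerset, firstVar s (pts zs L) * firstVar s (pts zs (K \ L)) = 0 := by
        refine Finset.sum_eq_zero fun L hL => ?_
        have hc := Finset.card_sdiff_add_card_eq_card (Finset.mem_powerset.1 hL)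
        by_cases h1 : L.card = 1
        · rw [firstVar_of_card_ne_one s (pts zs (K \ L)), mul_zero]
          rw [card_pts]
          intro h2
          exact hm 0 (by omega)
        · rw [firstVar_of_card_ne_one s (pts zs L), zero_mul]
          rwa [card_pts]
      rw [t4]; ring
  set P : Polynomial ℂ := ∑ k ∈ Finset.range (corrBound (l + 1)),
    Polynomial.C (corrCoeff s (l + 1) (pts zs K) k) * Polynomial.X ^ (k + 1) with hP
  set κ := corrCoeff s (l + 1) (pts zs K) 0
  -- What is left of the loop equation, in y = 1/(s z²). Every nonzero y arises from some z, so this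
  -- is an identity of polynomials, and y = 1 gives κ = 0.
  have hpoly : (Polynomial.X - 1) * P = Polynomial.C (-κ) * Polynomial.X := by
    apply Polynomial.funext
    intro y
    have hev : P.eval y = ∑ k ∈ Finset.range (corrBound (l + 1)),
        corrCoeff s (l + 1) (pts zs K) k * y ^ (k + 1) := by
      rw [hP, Polynomial.eval_finsetSum]; simp
    simp only [Polynomial.eval_mul, Polynomial.eval_sub, Polynomial.eval_X, Polynomial.eval_one,
      Polynomial.eval_C]
    by_cases hy : y = 0
    · rw [hev, hy]; simp
    obtain ⟨z, hz⟩ := IsAlgClosed.exists_pow_nat_eq (1 / (s * y)) two_pos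
    have hsy : s * y ≠ 0 := mul_ne_zero hs hy
    have hz0 : z ≠ 0 := by
      rintro rfl
      rw [zero_pow two_ne_zero] at hz
      exact one_div_ne_zero hsy hz.symm
    have h1 := key z hz0
    have h2 : 1 / (s * z ^ 2) = y := by rw [hz]; field_simp
    have h3 : s * z ^ 2 * y = 1 := by rw [hz]; field_simp
    have h4 : corr s (l + 1) (z ::ₘ pts zs K) = s ^ 3 * P.eval y := by
      rw [corr_cons, hev, Finset.mul_sum]
      refine Finset.sum_congr rfl fun k _ => ?_
      rw [ptCoeff, h2]; ring
    rw [h4] at h1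
    have h5 : s ^ 3 * ((y - 1) * P.eval y + κ * y) = 0 := by
      linear_combination y * h1 + s ^ 3 * P.eval y * h3
    linear_combination (mul_eq_zero.1 h5).resolve_left (pow_ne_zero 3 hs)
  have hκ : κ = 0 := by
    have := congrArg (Polynomial.eval 1) hpoly
    simpa using this.symm
  rw [hκ, neg_zero, Polynomial.C_0, zero_mul] at hpoly
  have hP0 : P = 0 := (mul_eq_zero.1 hpoly).resolve_left (Polynomial.X_sub_C_ne_zero 1)
  intro k
  rcases lt_or_ge k (corrBound (l + 1)) with hk | hk
  · have := congrArg (fun p => Polynomial.coeff p (k + 1)) hP0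
    simp only [hP, Polynomial.finsetSum_coeff, Polynomial.coeff_C_mul, Polynomial.coeff_X_pow,
      Polynomial.coeff_zero] at this
    rw [Finset.sum_eq_single k] at this
    · simpa using this
    · intro i _ hik
      rw [if_neg (by omega), mul_zero]
    · intro h; exact absurd (Finset.mem_range.2 hk) h
  · exact corrCoeff_eq_zero_of_le s _ hk

lemma corr_eq_zero {s : ℂ} (hs : s ≠ 0) (j : ℕ) (z : ℂ) (m : Multiset ℂ)
    (h : ∀ g, j ≠ 2 * g + m.card) : corr s j (z ::ₘ m) = 0 := by
  rw [corr_cons]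
  exact Finset.sum_eq_zero fun k _ => by rw [corrCoeff_eq_zero hs j m h, mul_zero]

end PainleveOne

end

noncomputable section
namespace PainleveOne

/-! ### Residues at the origin -/

open Filter Topology

/-- The residue of `f` at `0` exists and equals `c`. -/
def HasResidueZero (f : ℂ → ℂ) (c : ℂ) : Prop :=
  ∀ᶠ r : ℝ in 𝓝[>] 0, CircleIntegrable f 0 r ∧
    (∮ z in C(0, r), f z) = 2 * (Real.pi : ℂ) * Complex.I * c

lemma HasResidueZero.residueZero_eq {f : ℂ → ℂ} {c : ℂ} (h : HasResidueZero f c) :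
    residueZero f = c := by
  apply Filter.Tendsto.limUnder_eq
  apply tendsto_const_nhds.congr'
  filter_upwards [h] with r hr
  rw [hr.2, inv_mul_cancel_left₀ Complex.two_pi_I_ne_zero]

lemma HasResidueZero.add {f g : ℂ → ℂ} {c d : ℂ} (hf : HasResidueZero f c)
    (hg : HasResidueZero g d) : HasResidueZero (fun z => f z + g z) (c + d) := by
  filter_upwards [hf, hg] with r h1 h2
  refine ⟨h1.1.add h2.1, ?_⟩
  rw [circleIntegral.integral_add h1.1 h2.1, h1.2, h2.2]; ring

lemma HasResidueZero.const_mul {f : ℂ → ℂ} {c : ℂ} (a : ℂ) (hf : HasResidueZero f c) :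
    HasResidueZero (fun z => a * f z) (a * c) := by
  filter_upwards [hf] with r h1
  refine ⟨h1.1.const_fun_smul (a := a), ?_⟩
  rw [circleIntegral.integral_const_mul, h1.2]; ring

lemma HasResidueZero.congr {f g : ℂ → ℂ} {c : ℂ} (hf : HasResidueZero f c)
    (h : f =ᶠ[𝓝[≠] 0] g) : HasResidueZero g c := by
  obtain ⟨ε, hε, h'⟩ := Metric.mem_nhdsWithin_iff.1 h
  filter_upwards [hf, Ioo_mem_nhdsGT hε] with r h1 hr
  have heq : Set.EqOn f g (Metric.sphere 0 r) := by
    intro z hz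
    refine h' ⟨?_, ?_⟩
    · rw [Metric.mem_ball, Metric.mem_sphere.1 hz]; exact hr.2
    · rintro rfl
      rw [Metric.mem_sphere, dist_self] at hz
      exact hr.1.ne hz
  refine ⟨(circleIntegrable_congr (by rwa [abs_of_pos hr.1])).1 h1.1, ?_⟩
  rw [← circleIntegral.integral_congr hr.1.le heq, h1.2]

lemma HasResidueZero.sum {κ : Type*} {S : Finset κ} {f : κ → ℂ → ℂ} {c : κ → ℂ}
    (h : ∀ i ∈ S, HasResidueZero (f i) (c i)) :
    HasResidueZero (fun z => ∑ i ∈ S, f i z) (∑ i ∈ S, c i) := by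
  classical
  induction S using Finset.induction_on with
  | empty =>
    refine Filter.Eventually.of_forall fun r => ?_
    simp only [Finset.sum_empty, mul_zero]
    exact ⟨circleIntegrable_const 0 0 r, by simp [circleIntegral]⟩
  | insert a S ha ih =>
    simp only [Finset.sum_insert ha]
    exact (h a (Finset.mem_insert_self a S)).add
      (ih fun i hi => h i (Finset.mem_insert_of_mem hi))

lemma hasResidueZero_of_analyticAt {g : ℂ → ℂ} (hg : AnalyticAt ℂ g 0) : HasResidueZero g 0 := by
  obtain ⟨ε, hε, h⟩ := Metric.eventually_nhds_iff_ball.1 hg.eventually_analyticAt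
  filter_upwards [Ioo_mem_nhdsGT hε] with r hr
  have hsub : Metric.closedBall (0 : ℂ) r ⊆ Metric.ball 0 ε := Metric.closedBall_subset_ball hr.2
  have hc : ContinuousOn g (Metric.closedBall 0 r) :=
    fun z hz => (h z (hsub hz)).continuousAt.continuousWithinAt
  refine ⟨(hc.mono Metric.sphere_subset_closedBall).circleIntegrable hr.1.le, ?_⟩
  rw [mul_zero]
  exact Complex.circleIntegral_eq_zero_of_differentiable_on_off_countable hr.1.le
    Set.countable_empty hc fun z hz =>
      (h z (hsub (Metric.ball_subset_closedBall hz.1))).differentiableAt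

lemma hasResidueZero_zpow (n : ℤ) :
    HasResidueZero (fun z => z ^ n) (if n = -1 then 1 else 0) := by
  filter_upwards [self_mem_nhdsWithin] with r hr
  have hr' : (0 : ℝ) < r := hr
  constructor
  · have := (circleIntegrable_sub_zpow_iff (c := 0) (w := 0) (R := r) (n := n)).2
      (Or.inr (Or.inr (by simpa using (abs_pos.2 hr'.ne').ne)))
    simpa using this
  · split_ifs with h
    · have := circleIntegral.integral_sub_center_inv 0 hr'.ne'
      simp only [sub_zero] at this
      simp only [h, zpow_neg_one, this, mul_one]
    · have := circleIntegral.integral_sub_zpow_of_ne h 0 0 r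
      simp only [sub_zero] at this
      rw [this, mul_zero]

/-- The function `f` has a removable singularity at `0`. -/
def RegularZero (f : ℂ → ℂ) : Prop := ∃ g, AnalyticAt ℂ g 0 ∧ f =ᶠ[𝓝[≠] 0] g

lemma AnalyticAt.regularZero {g : ℂ → ℂ} (hg : AnalyticAt ℂ g 0) : RegularZero g :=
  ⟨g, hg, Filter.EventuallyEq.rfl⟩

lemma RegularZero.hasResidueZero {f : ℂ → ℂ} (hf : RegularZero f) : HasResidueZero f 0 := by
  obtain ⟨g, hg, h⟩ := hf
  exact (hasResidueZero_of_analyticAt hg).congr h.symm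

lemma RegularZero.congr {f g : ℂ → ℂ} (hf : RegularZero f) (h : f =ᶠ[𝓝[≠] 0] g) :
    RegularZero g := by
  obtain ⟨k, hk, h'⟩ := hf
  exact ⟨k, hk, h.symm.trans h'⟩

lemma RegularZero.add {f g : ℂ → ℂ} (hf : RegularZero f) (hg : RegularZero g) :
    RegularZero fun z => f z + g z := by
  obtain ⟨f', hf1, hf2⟩ := hf
  obtain ⟨g', hg1, hg2⟩ := hg
  exact ⟨_, hf1.add hg1, hf2.add hg2⟩

lemma RegularZero.mul {f g : ℂ → ℂ} (hf : RegularZero f) (hg : RegularZero g) :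
    RegularZero fun z => f z * g z := by
  obtain ⟨f', hf1, hf2⟩ := hf
  obtain ⟨g', hg1, hg2⟩ := hg
  exact ⟨_, hf1.mul hg1, hf2.mul hg2⟩

lemma RegularZero.const (c : ℂ) : RegularZero fun _ => c :=
  AnalyticAt.regularZero analyticAt_const

lemma RegularZero.sum {κ : Type*} {S : Finset κ} {f : κ → ℂ → ℂ}
    (h : ∀ i ∈ S, RegularZero (f i)) : RegularZero fun z => ∑ i ∈ S, f i z := by
  classical
  induction S using Finset.induction_on with
  | empty => simpa using RegularZero.const 0
  | insert a S ha ih =>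
    simp only [Finset.sum_insert ha]
    exact (h a (Finset.mem_insert_self a S)).add
      (ih fun i hi => h i (Finset.mem_insert_of_mem hi))

lemma eventually_ne_zero : ∀ᶠ z : ℂ in 𝓝[≠] 0, z ≠ 0 := self_mem_nhdsWithin

lemma eventually_ne {g : ℂ → ℂ} (hg : ContinuousAt g 0) (h0 : g 0 ≠ 0) :
    ∀ᶠ z : ℂ in 𝓝[≠] 0, g z ≠ 0 :=
  (hg.eventually_ne h0).filter_mono nhdsWithin_le_nhds

/-! ### The residue in the topological recursion -/

/-- The kernel z/(z₁² - z²) reproduces negative even powers. The induction rests on z²/(z₁² - z²) =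
z₁²/(z₁² - z²) - 1, whose last term contributes a pure power without residue. -/
lemma hasResidueZero_kernel_pow {z₁ : ℂ} (h : z₁ ≠ 0) (k : ℕ) :
    HasResidueZero (fun z => z / (z₁ ^ 2 - z ^ 2) * (1 / z ^ 2) ^ (k + 1))
      ((1 / z₁ ^ 2) ^ (k + 1)) := by
  have hne : ∀ᶠ z : ℂ in 𝓝[≠] 0, z₁ ^ 2 - z ^ 2 ≠ 0 :=
    eventually_ne (by fun_prop) (by simpa using h)
  have h0 : AnalyticAt ℂ (fun z : ℂ => z / (z₁ ^ 2 - z ^ 2)) 0 :=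
    analyticAt_id.div (by fun_prop) (by simpa using h)
  induction k with
  | zero =>
    have h1 := ((hasResidueZero_zpow (-1)).add
      (hasResidueZero_of_analyticAt h0)).const_mul (1 / z₁ ^ 2)
    rw [if_pos rfl, add_zero, mul_one] at h1
    rw [zero_add, pow_one]
    refine h1.congr ?_
    filter_upwards [hne, eventually_ne_zero] with z hz hz0
    rw [zpow_neg_one]; field_simp; ring
  | succ k ih =>
    have h1 := ((hasResidueZero_zpow (-(2 * k + 3))).add ih).const_mul (1 / z₁ ^ 2)
    rw [if_neg (by omega), zero_add, ← pow_succ'] at h1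
    refine h1.congr ?_
    filter_upwards [hne, eventually_ne_zero] with z hz hz0
    have e1 : z ^ (-(2 * (k : ℤ) + 3)) = z * (1 / z ^ 2) ^ (k + 2) := by
      rw [zpow_neg, show (2 * (k : ℤ) + 3) = ((2 * k + 3 : ℕ) : ℤ) by push_cast; ring,
        zpow_natCast, one_div, inv_pow, ← pow_mul]
      field_simp
      ring
    have e2 : (1 / z ^ 2) ^ (k + 1) = z ^ 2 * (1 / z ^ 2) ^ (k + 1 + 1) := by
      rw [pow_succ _ (k + 1)]; field_simp
    rw [e1, e2]
    generalize (1 / z ^ 2) ^ (k + 1 + 1) = t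
    field_simp
    ring

/-- The Laurent polynomial with coefficients `c`. -/
def laurent (s : ℂ) (M : ℕ) (c : ℕ → ℂ) (z : ℂ) : ℂ :=
  ∑ k ∈ Finset.range M, ptCoeff s z k * c k

lemma hasResidueZero_kernel_laurent (s : ℂ) (M : ℕ) (c : ℕ → ℂ) {z₁ : ℂ} (h : z₁ ≠ 0) :
    HasResidueZero (fun z => z / (z₁ ^ 2 - z ^ 2) * laurent s M c z) (laurent s M c z₁) := by
  have h1 := HasResidueZero.sum (S := Finset.range M) fun k _ =>
    (hasResidueZero_kernel_pow h k).const_mul (s ^ 3 * (1 / s) ^ (k + 1) * c k)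
  have e : ∀ z : ℂ, ∀ k, ptCoeff s z k * c k
      = s ^ 3 * (1 / s) ^ (k + 1) * c k * (1 / z ^ 2) ^ (k + 1) := by
    intro z k
    rw [ptCoeff, ← one_div_mul_one_div, mul_pow]; ring
  rw [laurent, Finset.sum_congr rfl fun k _ => e z₁ k]
  refine h1.congr (Filter.Eventually.of_forall fun z => ?_)
  simp only [laurent, Finset.mul_sum, e]
  exact Finset.sum_congr rfl fun k _ => by ring

/-- To evaluate the recursion it suffices to know the integrand modulo functions regular at 0. This
matches the loop equation, which is used only through its polar part. -/
lemma hasResidueZero_of_regular_sub (s : ℂ) (M : ℕ) (c : ℕ → ℂ) {z₁ : ℂ} (h : z₁ ≠ 0)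
    {P : ℂ → ℂ} (hP : RegularZero fun z => P z - (1 - s * z ^ 2) * laurent s M c z) :
    HasResidueZero (fun z => z / (z₁ ^ 2 - z ^ 2) * (P z / (1 - s * z ^ 2)))
      (laurent s M c z₁) := by
  have h0 : AnalyticAt ℂ (fun z : ℂ => z / (z₁ ^ 2 - z ^ 2)) 0 :=
    analyticAt_id.div (by fun_prop) (by simpa using h)
  have h1 : AnalyticAt ℂ (fun z : ℂ => 1 / (1 - s * z ^ 2)) 0 :=
    analyticAt_const.div (by fun_prop) (by simp)
  have h2 := (hasResidueZero_kernel_laurent s M c h).add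
    ((AnalyticAt.regularZero h0).mul ((AnalyticAt.regularZero h1).mul hP)).hasResidueZero
  rw [add_zero] at h2
  refine h2.congr ?_
  have hne : ∀ᶠ z : ℂ in 𝓝[≠] 0, 1 - s * z ^ 2 ≠ 0 := eventually_ne (by fun_prop) (by simp)
  filter_upwards [hne] with z hz
  generalize z / (z₁ ^ 2 - z ^ 2) = x
  generalize 1 - s * z ^ 2 = d at hz ⊢
  field_simp
  ring

end PainleveOne

end

noncomputable section
namespace PainleveOne

/-! ### The Eynard-Orantin differentials -/

open Filter Topology

/-- Here y(z) - y(-z) = 4z(z² - 3a) and z² - 3a = -(1 - s z²)/s. The minus sign from dz̄ = -dz is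
included. -/
lemma recKernel_mul {a s z z₁ Q : ℂ} (ha : 3 * a * s = 1) (hz : z ≠ 0)
    (h1 : z₁ ^ 2 - z ^ 2 ≠ 0) (h2 : 1 - s * z ^ 2 ≠ 0) :
    recKernel a z z₁ * -Q = z / (z₁ ^ 2 - z ^ 2) * (s / (8 * z ^ 2) * Q / (1 - s * z ^ 2)) := by
  have hd : deriv (xMap a) z = 2 * z := by
    have : HasDerivAt (xMap a) (2 * z) z := by
      unfold xMap
      simpa using ((hasDerivAt_id z).pow 2).sub_const (2 * a)
    exact this.deriv
  have hs : s ≠ 0 := by rintro rfl; simp at ha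
  have e1 : -z - z₁ ≠ 0 := by
    intro h; apply h1; linear_combination (-(z₁ - z)) * h
  have e2 : z - z₁ ≠ 0 := by
    intro h; apply h1; linear_combination (-(z₁ + z)) * h
  have e3 : z ^ 2 - 3 * a ≠ 0 := by
    intro h; apply h2; linear_combination (-s) * h - ha
  have e4 : yMap a z - yMap a (-z) = 4 * z * (z ^ 2 - 3 * a) := by simp only [yMap]; ring
  have e5 : -((-1 / (-z - z₁)) - (-1 / (z - z₁))) = 2 * z / (z₁ ^ 2 - z ^ 2) := by
    rw [div_sub_div _ _ e1 e2, ← neg_div, div_eq_div_iff (mul_ne_zero e1 e2) h1]; ring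
  have e6 : s * (z ^ 2 - 3 * a) = -(1 - s * z ^ 2) := by linear_combination -ha
  have e7 : z ^ 2 - 3 * a = -(1 - s * z ^ 2) / s := by rw [eq_div_iff hs, ← e6]; ring
  rw [recKernel, hd, e4, e5, e7]
  generalize 1 - s * z ^ 2 = d at h2 ⊢
  generalize z₁ ^ 2 - z ^ 2 = e at h1 ⊢
  field_simp
  ring

/-! #### Remainders of the Bergman kernel -/

lemma bergman_remainder {x ω : ℂ} (hω : ω ≠ 0) (h : ω - x ≠ 0) (N : ℕ) :
    (x + ω) / (ω - x) ^ 2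
      = ∑ m ∈ Finset.range N, (2 * (m : ℂ) + 1) * x ^ m / ω ^ (m + 1)
        + x ^ N * (((2 * N + 1) * ω - (2 * N - 1) * x) / (ω ^ N * (ω - x) ^ 2)) := by
  induction N with
  | zero => simp; ring
  | succ N ih =>
    rw [ih, Finset.sum_range_succ, add_assoc]
    congr 1
    push_cast
    field_simp
    ring

lemma bergman_add_bergman_neg {z w : ℂ} (h : w ^ 2 - z ^ 2 ≠ 0) :
    bergman z w + bergman (-z) w = 2 * ((z ^ 2 + w ^ 2) / (w ^ 2 - z ^ 2) ^ 2) := by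
  have e1 : z - w ≠ 0 := by
    intro h'; apply h; linear_combination (-(w + z)) * h'
  have e2 : -z - w ≠ 0 := by
    intro h'; apply h; linear_combination (-(w - z)) * h'
  rw [bergman, bergman, div_add_div _ _ (pow_ne_zero 2 e1) (pow_ne_zero 2 e2), ← mul_div_assoc,
    div_eq_div_iff (mul_ne_zero (pow_ne_zero 2 e1) (pow_ne_zero 2 e2)) (pow_ne_zero 2 h)]
  ring

lemma eventually_sub_ne {w : ℂ} (hw : w ≠ 0) : ∀ᶠ z : ℂ in 𝓝[≠] 0, w ^ 2 - z ^ 2 ≠ 0 :=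
  eventually_ne (by fun_prop) (by simpa using hw)

/-- The prefactor has a pole of order 2(k + 2) at z = 0, so the first k + 2 terms in z² produce the
whole polar part, and these are `genBeta`. -/
lemma regular_genBeta {s w : ℂ} (hs : s ≠ 0) (hw : w ≠ 0) (k : ℕ) : RegularZero fun z =>
    s / (8 * z ^ 2) * (bergman z w + bergman (-z) w) * ptCoeff s z k
      - s ^ 3 / 4 * genBeta s (1 / (s * z ^ 2)) w k := by
  have han : AnalyticAt ℂ (fun z : ℂ => s ^ 5 / 4 * (1 / s) ^ (k + 2)
      * (((2 * ((k + 2 : ℕ) : ℂ) + 1) * w ^ 2 - (2 * ((k + 2 : ℕ) : ℂ) - 1) * z ^ 2)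
        / ((w ^ 2) ^ (k + 2) * (w ^ 2 - z ^ 2) ^ 2))) 0 := by
    refine analyticAt_const.mul (AnalyticAt.div (by fun_prop) (by fun_prop) ?_)
    simp [hw]
  refine (AnalyticAt.regularZero han).congr ?_
  filter_upwards [eventually_sub_ne hw, eventually_ne_zero] with z hz hz0
  have h1 := bergman_remainder (pow_ne_zero 2 hw) hz (k + 2)
  rw [bergman_add_bergman_neg hz, h1]
  set R := ((2 * ((k + 2 : ℕ) : ℂ) + 1) * w ^ 2 - (2 * ((k + 2 : ℕ) : ℂ) - 1) * z ^ 2)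
        / ((w ^ 2) ^ (k + 2) * (w ^ 2 - z ^ 2) ^ 2)
  have h2 : genBeta s (1 / (s * z ^ 2)) w k = s ^ 2 * (1 / (s * z ^ 2)) ^ (k + 2)
      * ∑ m ∈ Finset.range (k + 2), (2 * (m : ℂ) + 1) * (z ^ 2) ^ m / (w ^ 2) ^ (m + 1) := by
    rw [genBeta, Finset.mul_sum]
    refine Finset.sum_congr rfl fun m hm => ?_
    have hm' := Finset.mem_range.1 hm
    have h3 : (1 / (s * z ^ 2)) ^ (k + 2)
        = (1 / (s * z ^ 2)) ^ (k + 2 - m) * (1 / (s * z ^ 2)) ^ m := by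
      rw [← pow_add]; congr 1; omega
    rw [h3, ptCoeff]
    generalize (1 / (s * z ^ 2)) ^ (k + 2 - m) = t
    rw [← one_div_mul_one_div, ← one_div_mul_one_div, mul_pow, mul_pow, div_eq_mul_inv _ ((w ^ 2) ^ _),
      one_div_pow, one_div_pow, one_div_pow, one_div_pow]
    field_simp
    ring
  rw [h2, ptCoeff]
  set S := ∑ m ∈ Finset.range (k + 2), (2 * (m : ℂ) + 1) * (z ^ 2) ^ m / (w ^ 2) ^ (m + 1)
  have h4 : (1 / s) ^ (k + 2) = (1 / (s * z ^ 2)) ^ (k + 2) * (z ^ 2) ^ (k + 2) := by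
    rw [← mul_pow]; congr 1; field_simp
  have h5 : s / (8 * z ^ 2) * (1 / (s * z ^ 2)) ^ (k + 1)
      = s ^ 2 / 8 * (1 / (s * z ^ 2)) ^ (k + 2) := by
    rw [pow_succ _ (k + 1)]; field_simp
  rw [h4]
  linear_combination (-(2 * s ^ 3 * (S + (z ^ 2) ^ (k + 2) * R))) * h5

/-- The sum is symmetrized in v and w because a single product divided by z² may also have a simple
pole. -/
lemma regular_bergman_mul {s v w : ℂ} (hs : s ≠ 0) (hv : v ≠ 0) (hw : w ≠ 0) :
    RegularZero fun z => s / (8 * z ^ 2) * (bergman z w * bergman (-z) v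
      + bergman z v * bergman (-z) w) - 1 / s ^ 5 * (s ^ 3 / 32 * (4 * (1 / (s * z ^ 2))))
        * (2 * (ptCoeff s w 0 * ptCoeff s v 0)) := by
  have han : AnalyticAt ℂ (fun z : ℂ => s / 4 * ((-z ^ 6 + 2 * (w ^ 2 + v ^ 2) * z ^ 4
      - ((w ^ 2 + v ^ 2) ^ 2 + (w * v) ^ 2) * z ^ 2 + 3 * (w ^ 2 + v ^ 2) * (w * v) ^ 2
      - 4 * (w * v) ^ 3) / ((w ^ 2 - z ^ 2) ^ 2 * (v ^ 2 - z ^ 2) ^ 2 * (w * v) ^ 2))) 0 := by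
    refine analyticAt_const.mul (AnalyticAt.div (by fun_prop) (by fun_prop) ?_)
    simp [hv, hw]
  refine (AnalyticAt.regularZero han).congr ?_
  filter_upwards [eventually_sub_ne hw, eventually_sub_ne hv, eventually_ne_zero] with z h1 h2 hz
  have b1 : bergman z w * bergman (-z) v = (z + w) ^ 2 * (v - z) ^ 2
      / ((w ^ 2 - z ^ 2) ^ 2 * (v ^ 2 - z ^ 2) ^ 2) := by
    have e1 : z - w ≠ 0 := by intro h'; apply h1; linear_combination (-(w + z)) * h'
    have e2 : -z - v ≠ 0 := by intro h'; apply h2; linear_combination (-(v - z)) * h'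
    rw [bergman, bergman, div_mul_div_comm, div_eq_div_iff
      (mul_ne_zero (pow_ne_zero 2 e1) (pow_ne_zero 2 e2))
      (mul_ne_zero (pow_ne_zero 2 h1) (pow_ne_zero 2 h2))]
    ring
  have b2 : bergman z v * bergman (-z) w = (z + v) ^ 2 * (w - z) ^ 2
      / ((w ^ 2 - z ^ 2) ^ 2 * (v ^ 2 - z ^ 2) ^ 2) := by
    have e1 : z - v ≠ 0 := by intro h'; apply h2; linear_combination (-(v + z)) * h'
    have e2 : -z - w ≠ 0 := by intro h'; apply h1; linear_combination (-(w - z)) * h'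
    rw [bergman, bergman, div_mul_div_comm, div_eq_div_iff
      (mul_ne_zero (pow_ne_zero 2 e1) (pow_ne_zero 2 e2))
      (mul_ne_zero (pow_ne_zero 2 h1) (pow_ne_zero 2 h2))]
    ring
  have b3 : 1 / s ^ 5 * (s ^ 3 / 32 * (4 * (1 / (s * z ^ 2))))
        * (2 * (ptCoeff s w 0 * ptCoeff s v 0)) = s / (4 * z ^ 2 * (w * v) ^ 2) := by
    simp only [ptCoeff, zero_add, pow_one]; field_simp; norm_num
  rw [b1, b2, b3]
  have d1 : (w ^ 2 - z ^ 2) ^ 2 * (v ^ 2 - z ^ 2) ^ 2 ≠ 0 :=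
    mul_ne_zero (pow_ne_zero 2 h1) (pow_ne_zero 2 h2)
  have d2 : (w ^ 2 - z ^ 2) ^ 2 * (v ^ 2 - z ^ 2) ^ 2
    = (z ^ 4 - (w ^ 2 + v ^ 2) * z ^ 2 + (w * v) ^ 2) ^ 2 := by ring
  generalize (w ^ 2 - z ^ 2) ^ 2 * (v ^ 2 - z ^ 2) ^ 2 = d at d1 d2 ⊢
  field_simp
  rw [d2]
  ring

/-! #### The two kinds of factors in the recursion -/

/-- The power of `s` in front of the differentials of genus `g`. -/
def scal (s : ℂ) (g : ℕ) : ℂ := s ^ (5 * g) / s ^ 5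

/-- The contribution of a stable differential. -/
def stTerm {n : ℕ} (s : ℂ) (zs : Fin n → ℂ) (g : ℕ) (K : Finset (Fin n)) (z : ℂ) : ℂ :=
  scal s g * corr s (2 * g + K.card) (z ::ₘ pts zs K)

/-- The contribution of the Bergman kernel. -/
def bgTerm {n : ℕ} (zs : Fin n → ℂ) (g : ℕ) (K : Finset (Fin n)) (z : ℂ) : ℂ :=
  if g = 0 then ∑ i, if K = {i} then bergman z (zs i) else 0 else 0

lemma stTerm_neg {n : ℕ} (s : ℂ) (zs : Fin n → ℂ) (g : ℕ) (K : Finset (Fin n)) (z : ℂ) :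
    stTerm s zs g K (-z) = stTerm s zs g K z := by
  rw [stTerm, stTerm, corr_neg_cons]

lemma term_eq_zero {n : ℕ} (s : ℂ) (zs : Fin n → ℂ) (g : ℕ) (K : Finset (Fin n)) (z : ℂ)
    (h : 2 * g + K.card = 0) : stTerm s zs g K z + bgTerm zs g K z = 0 := by
  have hK : K = ∅ := Finset.card_eq_zero.1 (by omega)
  rw [stTerm, h, corr_zero_cons, bgTerm, hK]
  simp

lemma pts_orderEmb {n : ℕ} (zs : Fin n → ℂ) (K : Finset (Fin n)) :
    pts (fun i => zs (K.orderEmbOfFin rfl i)) Finset.univ = pts zs K := by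
  have h : (Finset.univ.map (K.orderEmbOfFin rfl).toEmbedding) = K := by
    rw [Finset.map_eq_image]; exact K.image_orderEmbOfFin_univ rfl
  conv_rhs => rw [← h]
  rw [pts, pts, Finset.map_val, Multiset.map_map]
  rfl

lemma eoW_zero_one {a : ℂ} {m : ℕ} (hm : m = 1) (z : ℂ) (zs : Fin m → ℂ) :
    eoW a 0 m z zs = bergman z (zs ⟨0, by omega⟩) := by
  subst hm; rw [eoW]; rfl

/-- A factor is either a correlator or a Bergman kernel, the other term being zero. The uniform sum
lets the products in the recursion be expanded into four families; by `term_eq_zero` the excluded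
W_{0,1} contributes 0 to both. -/
lemma eoW_factor {a s : ℂ} {n : ℕ} {zs : Fin n → ℂ} {g : ℕ} {K : Finset (Fin n)} {z : ℂ}
    (ih : 2 ≤ 2 * g + K.card → eoW a g K.card z (fun i => zs (K.orderEmbOfFin rfl i))
      = scal s g * corr s (2 * g + K.card)
        (z ::ₘ pts (fun i => zs (K.orderEmbOfFin rfl i)) Finset.univ))
    (h : 1 ≤ 2 * g + K.card) :
    eoW a g K.card z (fun i => zs (K.orderEmbOfFin rfl i))
      = stTerm s zs g K z + bgTerm zs g K z := by
  rcases Nat.lt_or_ge 1 (2 * g + K.card) with h2 | h2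
  · rw [ih h2, pts_orderEmb, stTerm, bgTerm]
    split_ifs with hg
    · rw [Finset.sum_eq_zero, add_zero]
      intro i _
      rw [if_neg]
      rintro rfl
      rw [hg, Finset.card_singleton] at h2
      omega
    · rw [add_zero]
  · obtain rfl : g = 0 := by omega
    have hK : K.card = 1 := by omega
    have hst : stTerm s zs 0 K z = 0 := by
      rw [stTerm, show 2 * 0 + K.card = 1 by omega, corr_one_cons, mul_zero]
    rw [eoW_zero_one hK, hst, bgTerm, if_pos rfl, zero_add]
    obtain ⟨i, rfl⟩ := Finset.card_eq_one.1 hK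
    have hmem := Finset.orderEmbOfFin_mem ({i} : Finset (Fin n)) rfl ⟨0, by simp⟩
    rw [Finset.mem_singleton] at hmem
    rw [Finset.sum_eq_single i]
    · rw [if_pos rfl]
      congr 2
    · intro j _ hji
      rw [if_neg fun h => hji (Finset.singleton_injective h).symm]
    · intro h; exact absurd (Finset.mem_univ i) h

lemma eoW_succ {a : ℂ} {g n : ℕ} (h : 2 ≤ 2 * g + n) (z₁ : ℂ) (zs : Fin n → ℂ) :
    eoW a g n z₁ zs = residueZero fun z =>
      recKernel a z z₁ *
        -((if _h : 1 ≤ g then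
              eoW a (g - 1) (n + 1) z (Fin.cons (-z) zs : Fin (n + 1) → ℂ) else 0)
          + ∑ g₁ : Fin (g + 1), ∑ I : Finset (Fin n),
              if _h : 1 ≤ 2 * (g₁ : ℕ) + I.card ∧ 1 ≤ 2 * (g - (g₁ : ℕ)) + Iᶜ.card then
                eoW a g₁ I.card z (fun i => zs (I.orderEmbOfFin rfl i))
                  * eoW a (g - (g₁ : ℕ)) Iᶜ.card (-z) (fun i => zs (Iᶜ.orderEmbOfFin rfl i))
              else 0) := by
  rw [eoW]
  · rintro rfl rfl; omega
  · rintro rfl rfl; omega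

end PainleveOne

end

/-! ### Sums over splittings, and the identification of the Eynard-Orantin differentials -/

noncomputable section
namespace PainleveOne

open Filter Topology

section Sums

variable {n : ℕ} {s : ℂ} (zs : Fin n → ℂ) (g : ℕ) (z : ℂ)

lemma scal_mul_scal (hs : s ≠ 0) {g₁ g : ℕ} (h : g₁ ≤ g) :
    scal s g₁ * scal s (g - g₁) = scal s g / s ^ 5 := by
  obtain ⟨k, rfl⟩ := Nat.exists_eq_add_of_le h
  rw [Nat.add_sub_cancel_left, scal, scal, scal, mul_add, pow_add]
  field_simp

lemma scal_succ (hs : s ≠ 0) (g : ℕ) : scal s (g + 1) = s ^ 5 * scal s g := by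
  rw [scal, scal, mul_add, pow_add]; field_simp

/-- By the genus expansion only pairs of orders (2g₁ + |I|, 2g₂ + |Iᶜ|) contribute on the right;
these are the splittings of the genus. -/
lemma sum_stTerm_mul_stTerm (hs : s ≠ 0) :
    ∑ g₁ ∈ Finset.range (g + 1), ∑ I : Finset (Fin n),
        stTerm s zs g₁ I z * stTerm s zs (g - g₁) Iᶜ z
      = scal s g / s ^ 5 * ∑ I ∈ (Finset.univ : Finset (Fin n)).powerset,
        ∑ x ∈ Finset.HasAntidiagonal.antidiagonal (2 * g + n),
          corr s x.1 (z ::ₘ pts zs I) * corr s x.2 (z ::ₘ pts zs (Finset.univ \ I)) := by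
  rw [Finset.sum_comm, Finset.powerset_univ, Finset.mul_sum]
  refine Finset.sum_congr rfl fun I _ => ?_
  rw [← Finset.compl_eq_univ_sdiff, Finset.mul_sum]
  have hc : I.card + Iᶜ.card = n := by
    rw [Finset.card_add_card_compl, Fintype.card_fin]
  refine Finset.sum_of_injOn (fun g₁ => (2 * g₁ + I.card, 2 * (g - g₁) + Iᶜ.card)) ?_ ?_ ?_ ?_
  · intro i _ j _ hij
    have := congrArg Prod.fst hij
    simp only at this
    omega
  · intro i hi
    have hi' := Finset.mem_range.1 (Finset.mem_coe.1 hi)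
    refine Finset.mem_coe.2 (Finset.HasAntidiagonal.mem_antidiagonal.2 ?_)
    simp only
    omega
  · intro x hx hx'
    have hx1 := Finset.HasAntidiagonal.mem_antidiagonal.1 hx
    by_cases h1 : ∃ g₁, x.1 = 2 * g₁ + I.card
    · by_cases h2 : ∃ g₂, x.2 = 2 * g₂ + Iᶜ.card
      · obtain ⟨g₁, h1⟩ := h1
        obtain ⟨g₂, h2⟩ := h2
        exfalso
        apply hx'
        refine ⟨g₁, Finset.mem_coe.2 (Finset.mem_range.2 (by omega)), ?_⟩
        ext <;> simp only <;> omega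
      · rw [corr_eq_zero hs x.2 z (pts zs Iᶜ) fun g' hg' => h2 ⟨g', by rw [hg', card_pts]⟩]
        ring
    · rw [corr_eq_zero hs x.1 z (pts zs I) fun g' hg' => h1 ⟨g', by rw [hg', card_pts]⟩]
      ring
  · intro i hi
    rw [← scal_mul_scal hs (Nat.lt_succ_iff.1 (Finset.mem_range.1 hi)), stTerm, stTerm]
    ring

lemma sum_ite_singleton (f : Fin n → Finset (Fin n) → ℂ) :
    ∑ I : Finset (Fin n), ∑ i, (if I = {i} then f i I else 0) = ∑ i, f i {i} := by
  rw [Finset.sum_comm]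
  exact Finset.sum_congr rfl fun i _ => by simp

lemma sum_ite_compl_singleton (f : Fin n → Finset (Fin n) → ℂ) :
    ∑ I : Finset (Fin n), ∑ i, (if Iᶜ = {i} then f i I else 0) = ∑ i, f i {i}ᶜ := by
  rw [Finset.sum_comm]
  refine Finset.sum_congr rfl fun i _ => ?_
  rw [Finset.sum_eq_single {i}ᶜ]
  · rw [compl_compl, if_pos rfl]
  · intro I _ hI
    exact if_neg fun h => hI (by rw [← h, compl_compl])
  · intro h; exact absurd (Finset.mem_univ _) h

lemma sum_bgTerm_mul_stTerm :
    ∑ g₁ ∈ Finset.range (g + 1), ∑ I : Finset (Fin n),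
        bgTerm zs g₁ I z * stTerm s zs (g - g₁) Iᶜ z
      = ∑ i, bergman z (zs i) * stTerm s zs g {i}ᶜ z := by
  rw [Finset.sum_eq_single 0]
  · simp only [bgTerm, if_true, Finset.sum_mul, ite_mul, zero_mul, Nat.sub_zero]
    exact sum_ite_singleton fun i I => bergman z (zs i) * stTerm s zs g Iᶜ z
  · intro g₁ _ hg
    simp [bgTerm, hg]
  · intro h; exact absurd (Finset.mem_range.2 (Nat.succ_pos g)) h

lemma sum_stTerm_mul_bgTerm :
    ∑ g₁ ∈ Finset.range (g + 1), ∑ I : Finset (Fin n),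
        stTerm s zs g₁ I z * bgTerm zs (g - g₁) Iᶜ (-z)
      = ∑ i, bergman (-z) (zs i) * stTerm s zs g {i}ᶜ z := by
  rw [Finset.sum_eq_single g]
  · simp only [bgTerm, Nat.sub_self, if_true, Finset.mul_sum, mul_ite, mul_zero]
    refine (sum_ite_compl_singleton fun i I => stTerm s zs g I z * bergman (-z) (zs i)).trans ?_
    exact Finset.sum_congr rfl fun i _ => mul_comm _ _
  · intro g₁ hg hne
    have := Finset.mem_range.1 hg
    have h0 : g - g₁ ≠ 0 := by omega
    simp [bgTerm, h0]
  · intro h; exact absurd (Finset.mem_range.2 (Nat.lt_succ_self g)) h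

lemma sum_bgTerm_mul_bgTerm :
    ∑ g₁ ∈ Finset.range (g + 1), ∑ I : Finset (Fin n),
        bgTerm zs g₁ I z * bgTerm zs (g - g₁) Iᶜ (-z)
      = if g = 0 then ∑ i, ∑ j, (if ({i}ᶜ : Finset (Fin n)) = {j} then
          bergman z (zs i) * bergman (-z) (zs j) else 0) else 0 := by
  rw [Finset.sum_eq_single 0]
  · simp only [Nat.sub_zero]
    by_cases hg : g = 0
    · simp only [bgTerm, if_true, hg, Finset.sum_mul, ite_mul, zero_mul]
      rw [sum_ite_singleton fun i I => bergman z (zs i) * ∑ j, if Iᶜ = {j} then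
        bergman (-z) (zs j) else 0]
      simp only [Finset.mul_sum, mul_ite, mul_zero]
    · simp [bgTerm, hg]
  · intro g₁ _ hg
    simp [bgTerm, hg]
  · intro h; exact absurd (Finset.mem_range.2 (Nat.succ_pos g)) h

lemma firstVar_pts (K : Finset (Fin n)) :
    firstVar s (pts zs K) = ∑ i, if K = {i} then ptCoeff s (zs i) 0 else 0 := by
  by_cases h : K.card = 1
  · obtain ⟨i, rfl⟩ := Finset.card_eq_one.1 h
    rw [Finset.sum_eq_single i]
    · have : pts zs {i} = zs i ::ₘ 0 := rfl
      rw [this, firstVar_cons, if_pos rfl, if_pos rfl]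
    · intro j _ hji
      rw [if_neg fun h => hji (Finset.singleton_injective h).symm]
    · intro h; exact absurd (Finset.mem_univ i) h
  · rw [firstVar_of_card_ne_one s _ (by rwa [card_pts]), Finset.sum_eq_zero]
    intro i _
    rw [if_neg]
    rintro rfl
    exact h (Finset.card_singleton i)

lemma sum_firstVar : ∑ I ∈ (Finset.univ : Finset (Fin n)).powerset,
      firstVar s (pts zs I) * firstVar s (pts zs (Finset.univ \ I))
    = ∑ i, ∑ j, (if ({i}ᶜ : Finset (Fin n)) = {j} then
        ptCoeff s (zs i) 0 * ptCoeff s (zs j) 0 else 0) := by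
  simp only [Finset.powerset_univ, ← Finset.compl_eq_univ_sdiff, firstVar_pts, Finset.sum_mul,
    ite_mul, zero_mul]
  rw [sum_ite_singleton fun i I => ptCoeff s (zs i) 0 * ∑ j, if Iᶜ = {j} then
        ptCoeff s (zs j) 0 else 0]
  simp only [Finset.mul_sum, mul_ite, mul_zero]

lemma sum_compl_symm (f : Fin n → Fin n → ℂ) :
    ∑ i, ∑ j, (if ({i}ᶜ : Finset (Fin n)) = {j} then f i j else 0)
      = ∑ i, ∑ j, (if ({i}ᶜ : Finset (Fin n)) = {j} then (f i j + f j i) / 2 else 0) := by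
  have h : ∑ i, ∑ j, (if ({i}ᶜ : Finset (Fin n)) = {j} then f i j else 0)
      = ∑ i, ∑ j, (if ({i}ᶜ : Finset (Fin n)) = {j} then f j i else 0) := by
    rw [Finset.sum_comm]
    refine Finset.sum_congr rfl fun i _ => Finset.sum_congr rfl fun j _ => ?_
    have : ({j}ᶜ : Finset (Fin n)) = {i} ↔ ({i}ᶜ : Finset (Fin n)) = {j} := by
      rw [compl_eq_comm]
    simp only [this]
  have h2 : ∑ i, ∑ j, (if ({i}ᶜ : Finset (Fin n)) = {j} then (f i j + f j i) / 2 else 0)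
      = (∑ i, ∑ j, (if ({i}ᶜ : Finset (Fin n)) = {j} then f i j else 0)
        + ∑ i, ∑ j, (if ({i}ᶜ : Finset (Fin n)) = {j} then f j i else 0)) / 2 := by
    simp only [← Finset.sum_add_distrib, Finset.sum_div]
    refine Finset.sum_congr rfl fun i _ => Finset.sum_congr rfl fun j _ => ?_
    split_ifs <;> simp
  rw [h2, ← h]; ring

end Sums

lemma regular_bgTerm_mul {n : ℕ} {s : ℂ} (hs : s ≠ 0) (zs : Fin n → ℂ) (hzs : ∀ i, zs i ≠ 0)
    (g : ℕ) : RegularZero fun z => s / (8 * z ^ 2) * (∑ g₁ ∈ Finset.range (g + 1),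
      ∑ I : Finset (Fin n), bgTerm zs g₁ I z * bgTerm zs (g - g₁) Iᶜ (-z))
      - scal s g * (if 2 * g + n = 2 then s ^ 3 / 32 * (4 * (1 / (s * z ^ 2)))
        * (∑ I ∈ (Finset.univ : Finset (Fin n)).powerset,
          firstVar s (pts zs I) * firstVar s (pts zs (Finset.univ \ I))) else 0) := by
  simp only [sum_bgTerm_mul_bgTerm, sum_firstVar]
  have hcard : ∀ i j : Fin n, ({i}ᶜ : Finset (Fin n)) = {j} → n = 2 := by
    intro i j h
    have h1 := Finset.card_compl_add_card ({i} : Finset (Fin n))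
    rw [h, Finset.card_singleton, Finset.card_singleton, Fintype.card_fin] at h1
    exact h1.symm
  by_cases hn : n = 2
  · by_cases hg : g = 0
    · simp only [if_pos hg, if_pos (show 2 * g + n = 2 by omega)]
      have hsc : scal s g = 1 / s ^ 5 := by rw [hg, scal, mul_zero, pow_zero]
      have h1 : RegularZero fun z => ∑ i, ∑ j, (if ({i}ᶜ : Finset (Fin n)) = {j} then
          1 / 2 * (s / (8 * z ^ 2) * (bergman z (zs i) * bergman (-z) (zs j)
          + bergman z (zs j) * bergman (-z) (zs i))
          - 1 / s ^ 5 * (s ^ 3 / 32 * (4 * (1 / (s * z ^ 2))))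
          * (2 * (ptCoeff s (zs i) 0 * ptCoeff s (zs j) 0))) else 0) := by
        refine RegularZero.sum fun i _ => RegularZero.sum fun j _ => ?_
        split_ifs
        · exact (RegularZero.const _).mul (regular_bergman_mul hs (hzs j) (hzs i))
        · exact RegularZero.const 0
      refine h1.congr (Filter.Eventually.of_forall fun z => ?_)
      simp only
      rw [sum_compl_symm fun i j => bergman z (zs i) * bergman (-z) (zs j), hsc]
      simp only [Finset.mul_sum, ← Finset.sum_sub_distrib]
      refine Finset.sum_congr rfl fun i _ => Finset.sum_congr rfl fun j _ => ?_
      split_ifs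
      · ring
      · simp
    · simp only [if_neg hg, if_neg (show ¬ 2 * g + n = 2 by omega)]
      simpa using RegularZero.const 0
  · have h0 : ∀ f : Fin n → Fin n → ℂ,
        ∑ i, ∑ j, (if ({i}ᶜ : Finset (Fin n)) = {j} then f i j else 0) = 0 := fun f =>
      Finset.sum_eq_zero fun i _ => Finset.sum_eq_zero fun j _ =>
        if_neg fun h => hn (hcard i j h)
    simp only [h0, mul_zero, ite_self, sub_self]
    exact RegularZero.const 0

lemma pts_cons {n : ℕ} (w : ℂ) (zs : Fin n → ℂ) :
    pts (Fin.cons w zs : Fin (n + 1) → ℂ) Finset.univ = w ::ₘ pts zs Finset.univ := by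
  simp only [pts, Fin.univ_val_map, List.ofFn_succ, Fin.cons_zero, Fin.cons_succ]
  rfl

/-- The differentials with their correlators, by induction on `2 g + n`. -/
def EoFormula (a s : ℂ) (g n : ℕ) : Prop :=
  ∀ z zs, z ≠ 0 → (∀ i, zs i ≠ 0) →
    eoW a g n z zs = scal s g * corr s (2 * g + n) (z ::ₘ pts zs Finset.univ)

/-- For g = 1 and n = 0 the term is W_{0,2}(z, -z), without a correlator; it accounts for the purely
constant term of the loop equation, the one coming from `virA 1`. -/
lemma first_term_eq {a s : ℂ} (hs : s ≠ 0) {g n l : ℕ} (hl : 2 * g + n = l + 1) (h2 : 1 ≤ l)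
    (ih : ∀ g' n', 2 ≤ 2 * g' + n' → 2 * g' + n' < 2 * g + n → EoFormula a s g' n')
    {z : ℂ} (hz : z ≠ 0) {zs : Fin n → ℂ} (hzs : ∀ i, zs i ≠ 0) :
    s / (8 * z ^ 2) * (if _h : 1 ≤ g then
              eoW a (g - 1) (n + 1) z (Fin.cons (-z) zs : Fin (n + 1) → ℂ) else 0)
      = scal s g * ((8 * s ^ 4 * z ^ 2)⁻¹ * corr s l (z ::ₘ z ::ₘ pts zs Finset.univ)
        + if l = 1 then s ^ 3 / 32 * (1 / (s * z ^ 2)) ^ 2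
          * (if (Finset.univ : Finset (Fin n)) = ∅ then 1 else 0) else 0) := by
  have hcard : (Finset.univ : Finset (Fin n)).card = n := by simp
  split_ifs with hg hl1 hn hl1 hn
  · rw [hn, Finset.card_empty] at hcard
    obtain rfl : n = 0 := hcard.symm
    obtain rfl : g = 1 := by omega
    rw [Nat.sub_self, eoW_zero_one rfl, hl1, corr_one_cons, scal]
    have : (Fin.cons (-z) zs : Fin 1 → ℂ) ⟨0, by omega⟩ = -z := rfl
    rw [this, bergman]
    have h3 : z - -z = 2 * z := by ring
    rw [h3]
    field_simp
    ring
  · exfalso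
    apply hn
    rw [← Finset.card_eq_zero, hcard]
    omega
  · have hl2 : 2 * (g - 1) + (n + 1) = l := by omega
    rw [ih (g - 1) (n + 1) (by omega) (by omega) z _ hz, hl2, pts_cons, Multiset.cons_swap,
      corr_neg_cons]
    · obtain ⟨k, rfl⟩ : ∃ k, g = k + 1 := ⟨g - 1, by omega⟩
      rw [Nat.add_sub_cancel, scal_succ hs]
      field_simp
      ring
    · intro i
      refine Fin.cases ?_ (fun j => ?_) i
      · simpa using hz
      · simpa using hzs j
  · rw [hn, Finset.card_empty] at hcard
    omega
  · rw [corr_eq_zero hs l z]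
    · ring
    · intro g' hg'
      rw [Multiset.card_cons, card_pts, hcard] at hg'
      omega
  · rw [corr_eq_zero hs l z]
    · ring
    · intro g' hg'
      rw [Multiset.card_cons, card_pts, hcard] at hg'
      omega

/-- Strong induction on 2g + n. The integrand differs from (1 - s z²) times the expected Laurent
polynomial by a function regular at 0, which is the content of the loop equation. -/
theorem eoW_eq {a s : ℂ} (ha : 3 * a * s = 1) (N : ℕ) :
    ∀ g n, 2 * g + n = N → 2 ≤ N → EoFormula a s g n := by
  have hs : s ≠ 0 := by rintro rfl; simp at ha
  induction N using Nat.strong_induction_on with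
  | _ N IH =>
  intro g n hN h2 z₁ zs hz₁ hzs
  have ih : ∀ g' n', 2 ≤ 2 * g' + n' → 2 * g' + n' < 2 * g + n → EoFormula a s g' n' :=
    fun g' n' h1 h3 => IH _ (by omega) g' n' rfl h1
  obtain ⟨l, hl⟩ : ∃ l, N = l + 1 := ⟨N - 1, by omega⟩
  have hterm : ∀ g' (K : Finset (Fin n)) (z : ℂ), z ≠ 0 → 2 * g' + K.card < 2 * g + n →
      1 ≤ 2 * g' + K.card → eoW a g' K.card z (fun i => zs (K.orderEmbOfFin rfl i))
        = stTerm s zs g' K z + bgTerm zs g' K z := by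
    intro g' K z hz hlt h1
    exact eoW_factor (fun h3 => ih g' K.card h3 hlt z _ hz fun i => hzs _) h1
  have hsum : ∀ z : ℂ, z ≠ 0 → (∑ g₁ : Fin (g + 1), ∑ I : Finset (Fin n),
      if _h : 1 ≤ 2 * (g₁ : ℕ) + I.card ∧ 1 ≤ 2 * (g - (g₁ : ℕ)) + Iᶜ.card then
        eoW a g₁ I.card z (fun i => zs (I.orderEmbOfFin rfl i))
          * eoW a (g - (g₁ : ℕ)) Iᶜ.card (-z) (fun i => zs (Iᶜ.orderEmbOfFin rfl i))
      else 0)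
      = ∑ g₁ ∈ Finset.range (g + 1), ∑ I : Finset (Fin n),
          stTerm s zs g₁ I z * stTerm s zs (g - g₁) Iᶜ z
        + (∑ i, bergman z (zs i) * stTerm s zs g {i}ᶜ z
        + ∑ i, bergman (-z) (zs i) * stTerm s zs g {i}ᶜ z)
        + ∑ g₁ ∈ Finset.range (g + 1), ∑ I : Finset (Fin n),
          bgTerm zs g₁ I z * bgTerm zs (g - g₁) Iᶜ (-z) := by
    intro z hz
    rw [← sum_bgTerm_mul_stTerm, ← sum_stTerm_mul_bgTerm, ← Finset.sum_add_distrib,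
      ← Finset.sum_add_distrib, ← Finset.sum_add_distrib, Finset.sum_range]
    refine Finset.sum_congr rfl fun g₁ _ => ?_
    rw [← Finset.sum_add_distrib, ← Finset.sum_add_distrib, ← Finset.sum_add_distrib]
    refine Finset.sum_congr rfl fun I _ => ?_
    have hc : I.card + Iᶜ.card = n := by
      rw [Finset.card_add_card_compl, Fintype.card_fin]
    have hg₁ := g₁.2
    have hprod : stTerm s zs (g₁ : ℕ) I z * stTerm s zs (g - g₁) Iᶜ z
        + (bgTerm zs (g₁ : ℕ) I z * stTerm s zs (g - g₁) Iᶜ z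
          + stTerm s zs (g₁ : ℕ) I z * bgTerm zs (g - g₁) Iᶜ (-z))
        + bgTerm zs (g₁ : ℕ) I z * bgTerm zs (g - g₁) Iᶜ (-z)
        = (stTerm s zs (g₁ : ℕ) I z + bgTerm zs (g₁ : ℕ) I z)
          * (stTerm s zs (g - g₁) Iᶜ (-z) + bgTerm zs (g - g₁) Iᶜ (-z)) := by
      rw [stTerm_neg]; ring
    rw [hprod]
    split_ifs with h
    · rw [hterm g₁ I z hz (by omega) h.1, hterm (g - g₁) Iᶜ (-z) (neg_ne_zero.2 hz) (by omega) h.2]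
    · rcases not_and_or.1 h with h3 | h3
      · rw [term_eq_zero s zs g₁ I z (by omega), zero_mul]
      · rw [term_eq_zero s zs (g - g₁) Iᶜ (-z) (by omega), mul_zero]
  set Q : ℂ → ℂ := fun z => (if _h : 1 ≤ g then
      eoW a (g - 1) (n + 1) z (Fin.cons (-z) zs : Fin (n + 1) → ℂ) else 0)
    + ∑ g₁ : Fin (g + 1), ∑ I : Finset (Fin n),
      if _h : 1 ≤ 2 * (g₁ : ℕ) + I.card ∧ 1 ≤ 2 * (g - (g₁ : ℕ)) + Iᶜ.card then
        eoW a g₁ I.card z (fun i => zs (I.orderEmbOfFin rfl i))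
          * eoW a (g - (g₁ : ℕ)) Iᶜ.card (-z) (fun i => zs (Iᶜ.orderEmbOfFin rfl i))
      else 0 with hQ
  rw [eoW_succ (by omega : 2 ≤ 2 * g + n)]
  have hlaurent : ∀ z, scal s g * corr s (2 * g + n) (z ::ₘ pts zs Finset.univ)
      = laurent s (corrBound (2 * g + n))
        (fun k => scal s g * corrCoeff s (2 * g + n) (pts zs Finset.univ) k) z := by
    intro z
    rw [corr_cons, laurent, Finset.mul_sum]
    exact Finset.sum_congr rfl fun k _ => by ring
  rw [hlaurent]
  apply HasResidueZero.residueZero_eq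
  have hreg : RegularZero fun z => s / (8 * z ^ 2) * Q z - (1 - s * z ^ 2)
      * laurent s (corrBound (2 * g + n))
        (fun k => scal s g * corrCoeff s (2 * g + n) (pts zs Finset.univ) k) z := by
    have r1 := regular_bgTerm_mul hs zs hzs g
    have r2 : RegularZero fun z => ∑ i, ∑ k ∈ Finset.range (corrBound l),
        scal s g * corrCoeff s l (pts zs {i}ᶜ) k
          * (s / (8 * z ^ 2) * (bergman z (zs i) + bergman (-z) (zs i)) * ptCoeff s z k
            - s ^ 3 / 4 * genBeta s (1 / (s * z ^ 2)) (zs i) k) :=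
      RegularZero.sum fun i _ => RegularZero.sum fun k _ =>
        (RegularZero.const _).mul (regular_genBeta hs (hzs i) k)
    -- The ∂₀ term of the loop equation does not depend on z, hence does not affect the residue.
    have r3 := RegularZero.const (scal s g * s ^ 3
      * corrCoeff s (2 * g + n) (pts zs Finset.univ) 0)
    refine ((r1.add r2).add r3).congr ?_
    filter_upwards [eventually_ne_zero] with z hz
    have e1 := loop_corr hs hz zs Finset.univ l
    have e2 := first_term_eq hs (hN.trans hl) (by omega : 1 ≤ l) ih hz hzs
    have e3 := hsum z hz
    have e4 := sum_stTerm_mul_stTerm zs g z hs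
    have e5 : ∑ i, ∑ k ∈ Finset.range (corrBound l),
        scal s g * corrCoeff s l (pts zs {i}ᶜ) k
          * (s / (8 * z ^ 2) * (bergman z (zs i) + bergman (-z) (zs i)) * ptCoeff s z k
            - s ^ 3 / 4 * genBeta s (1 / (s * z ^ 2)) (zs i) k)
        = s / (8 * z ^ 2) * (∑ i, bergman z (zs i) * stTerm s zs g {i}ᶜ z
          + ∑ i, bergman (-z) (zs i) * stTerm s zs g {i}ᶜ z)
          - scal s g * (s ^ 3 / 4 * ∑ i, ∑ k ∈ Finset.range (corrBound l),
            genBeta s (1 / (s * z ^ 2)) (zs i) k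
              * corrCoeff s l (pts zs (Finset.univ.erase i)) k) := by
      rw [← Finset.sum_add_distrib, Finset.mul_sum, Finset.mul_sum, Finset.mul_sum,
        ← Finset.sum_sub_distrib]
      refine Finset.sum_congr rfl fun i _ => ?_
      have hi : 2 * g + ({i}ᶜ : Finset (Fin n)).card = l := by
        have h1 := Finset.card_compl_add_card ({i} : Finset (Fin n))
        rw [Finset.card_singleton, Fintype.card_fin] at h1
        omega
      have hi' : Finset.univ.erase i = ({i}ᶜ : Finset (Fin n)) := by
        ext j; simp
      rw [stTerm, hi, corr_cons, hi', Finset.mul_sum, Finset.mul_sum, Finset.mul_sum,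
        Finset.mul_sum, ← Finset.sum_add_distrib, Finset.mul_sum, Finset.mul_sum,
        ← Finset.sum_sub_distrib]
      exact Finset.sum_congr rfl fun k _ => by ring
    have e6 : s / (8 * z ^ 2) * (scal s g / s ^ 5) = scal s g * (8 * s ^ 4 * z ^ 2)⁻¹ := by
      field_simp
    rw [← hlaurent, e5]
    simp only [hQ]
    rw [hN, hl] at e4 ⊢
    have e7 : (l + 1 = 2) ↔ (l = 1) := by omega
    simp only [e7]
    by_cases hl1 : l = 1
    · simp only [if_pos hl1] at e1 e2 ⊢
      linear_combination (scal s g) * e1 - e2 - s / (8 * z ^ 2) * e3 - s / (8 * z ^ 2) * e4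
        - (∑ I ∈ (Finset.univ : Finset (Fin n)).powerset,
          ∑ x ∈ Finset.HasAntidiagonal.antidiagonal (l + 1),
            corr s x.1 (z ::ₘ pts zs I) * corr s x.2 (z ::ₘ pts zs (Finset.univ \ I))) * e6
    · simp only [if_neg hl1] at e1 e2 ⊢
      linear_combination (scal s g) * e1 - e2 - s / (8 * z ^ 2) * e3 - s / (8 * z ^ 2) * e4
        - (∑ I ∈ (Finset.univ : Finset (Fin n)).powerset,
          ∑ x ∈ Finset.HasAntidiagonal.antidiagonal (l + 1),
            corr s x.1 (z ::ₘ pts zs I) * corr s x.2 (z ::ₘ pts zs (Finset.univ \ I))) * e6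
  refine (hasResidueZero_of_regular_sub s _ _ hz₁ hreg).congr ?_
  have hne : ∀ᶠ z : ℂ in 𝓝[≠] 0, 1 - s * z ^ 2 ≠ 0 := eventually_ne (by fun_prop) (by simp)
  filter_upwards [eventually_ne_zero, eventually_sub_ne hz₁, hne] with z hz h3 h4
  exact (recKernel_mul ha hz h3 h4).symm

end PainleveOne

end

noncomputable section
namespace PainleveOne

/-! ### Contour integrals near infinity -/

open Filter Topology

/-- The integrals of `f` over large circles converge to `c`. -/
def HasContourInfinity (f : ℂ → ℂ) (c : ℂ) : Prop :=
  (∀ᶠ R : ℝ in atTop, CircleIntegrable f 0 R) ∧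
    Tendsto (fun R : ℝ => (2 * (Real.pi : ℂ) * Complex.I)⁻¹ * ∮ z in C(0, R), f z) atTop (𝓝 c)

lemma HasContourInfinity.contourInfinity_eq {f : ℂ → ℂ} {c : ℂ} (h : HasContourInfinity f c) :
    contourInfinity f = c := h.2.limUnder_eq

lemma HasContourInfinity.add {f g : ℂ → ℂ} {c d : ℂ} (hf : HasContourInfinity f c)
    (hg : HasContourInfinity g d) : HasContourInfinity (fun z => f z + g z) (c + d) := by
  refine ⟨?_, (hf.2.add hg.2).congr' ?_⟩
  · filter_upwards [hf.1, hg.1] with R h1 h2 using h1.add h2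
  · filter_upwards [hf.1, hg.1] with R h1 h2
    rw [circleIntegral.integral_add h1 h2, mul_add]

lemma HasContourInfinity.const_mul {f : ℂ → ℂ} {c : ℂ} (a : ℂ) (hf : HasContourInfinity f c) :
    HasContourInfinity (fun z => a * f z) (a * c) := by
  refine ⟨?_, (hf.2.const_mul a).congr fun R => ?_⟩
  · filter_upwards [hf.1] with R h1 using h1.const_fun_smul (a := a)
  · rw [circleIntegral.integral_const_mul]; ring

lemma HasContourInfinity.congr {f g : ℂ → ℂ} {c : ℂ} (hf : HasContourInfinity f c)
    (h : ∀ᶠ w : ℂ in 𝓝[≠] 0, f w⁻¹ = g w⁻¹) : HasContourInfinity g c := by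
  obtain ⟨ε, hε, h'⟩ := Metric.mem_nhdsWithin_iff.1 h
  have heq : ∀ R > ε⁻¹, 0 < R ∧ Set.EqOn f g (Metric.sphere 0 R) := by
    intro R hR
    have hR0 : 0 < R := (inv_pos.2 hε).trans hR
    refine ⟨hR0, fun z hz => ?_⟩
    rw [mem_sphere_zero_iff_norm] at hz
    have hz0 : z ≠ 0 := by rintro rfl; rw [norm_zero] at hz; exact hR0.ne hz
    have := @h' z⁻¹ ⟨by
      rw [mem_ball_zero_iff, norm_inv, hz]; exact inv_lt_of_inv_lt₀ hε hR, inv_ne_zero hz0⟩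
    simpa using this
  refine ⟨?_, hf.2.congr' ?_⟩
  · filter_upwards [hf.1, eventually_gt_atTop ε⁻¹] with R h1 hR
    exact (circleIntegrable_congr (by rw [abs_of_pos (heq R hR).1]; exact (heq R hR).2)).1 h1
  · filter_upwards [eventually_gt_atTop ε⁻¹] with R hR
    rw [circleIntegral.integral_congr (heq R hR).1.le (heq R hR).2]

lemma hasContourInfinity_zpow (n : ℤ) :
    HasContourInfinity (fun z => z ^ n) (if n = -1 then 1 else 0) := by
  constructor
  · filter_upwards [eventually_gt_atTop 0] with R hR
    have := (circleIntegrable_sub_zpow_iff (c := 0) (w := 0) (R := R) (n := n)).2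
      (Or.inr (Or.inr (by simpa using (abs_pos.2 hR.ne').ne)))
    simpa using this
  · refine tendsto_const_nhds.congr' ?_
    filter_upwards [eventually_gt_atTop 0] with R hR
    split_ifs with h
    · have := circleIntegral.integral_sub_center_inv 0 hR.ne'
      simp only [sub_zero] at this
      simp only [h, zpow_neg_one, this]
      rw [inv_mul_cancel₀ Complex.two_pi_I_ne_zero]
    · have := circleIntegral.integral_sub_zpow_of_ne h 0 0 R
      simp only [sub_zero] at this
      rw [this, mul_zero]

/-- The integrand is O(R⁻²) on a circle of length 2πR. -/
lemma hasContourInfinity_of_analyticAt {F : ℂ → ℂ} (hF : AnalyticAt ℂ F 0) :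
    HasContourInfinity (fun z => F z⁻¹ * z⁻¹ ^ 2) 0 := by
  obtain ⟨ε, hε, h⟩ := Metric.eventually_nhds_iff_ball.1
    (hF.eventually_analyticAt.and (hF.continuousAt.norm.eventually_lt continuousAt_const
      (lt_add_one ‖F 0‖)))
  have hsph : ∀ R > ε⁻¹, 0 < R ∧ ∀ z ∈ Metric.sphere (0 : ℂ) R, z ≠ 0 ∧ AnalyticAt ℂ F z⁻¹ ∧
      ‖F z⁻¹‖ < ‖F 0‖ + 1 := by
    intro R hR
    have hR0 : 0 < R := (inv_pos.2 hε).trans hR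
    refine ⟨hR0, fun z hz => ?_⟩
    rw [mem_sphere_zero_iff_norm] at hz
    have hz0 : z ≠ 0 := by rintro rfl; rw [norm_zero] at hz; exact hR0.ne hz
    exact ⟨hz0, h z⁻¹ (by
      rw [mem_ball_zero_iff, norm_inv, hz]; exact inv_lt_of_inv_lt₀ hε hR)⟩
  constructor
  · filter_upwards [eventually_gt_atTop ε⁻¹] with R hR
    obtain ⟨hR0, h1⟩ := hsph R hR
    refine ContinuousOn.circleIntegrable hR0.le fun z hz => ?_
    obtain ⟨hz0, h2, -⟩ := h1 z hz
    have h3 : ContinuousAt (fun z : ℂ => z⁻¹) z := continuousAt_inv₀ hz0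
    exact ((ContinuousAt.comp (f := fun z : ℂ => z⁻¹) h2.continuousAt h3).mul
      (h3.pow 2)).continuousWithinAt
  · suffices hlim0 : Tendsto (fun R : ℝ => ∮ z in C(0, R), F z⁻¹ * z⁻¹ ^ 2) atTop (𝓝 0) by
      simpa only [mul_zero] using hlim0.const_mul (2 * (Real.pi : ℂ) * Complex.I)⁻¹
    rw [tendsto_zero_iff_norm_tendsto_zero]
    have hlim : Tendsto (fun R : ℝ => 2 * Real.pi * (‖F 0‖ + 1) * R⁻¹) atTop (𝓝 0) := by
      simpa using tendsto_inv_atTop_zero.const_mul (2 * Real.pi * (‖F 0‖ + 1))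
    refine squeeze_zero' (Eventually.of_forall fun _ => norm_nonneg _) ?_ hlim
    filter_upwards [eventually_gt_atTop ε⁻¹] with R hR
    obtain ⟨hR0, h1⟩ := hsph R hR
    have h2 : ∀ z ∈ Metric.sphere (0 : ℂ) R,
        ‖F z⁻¹ * z⁻¹ ^ 2‖ ≤ (‖F 0‖ + 1) * R⁻¹ ^ 2 := by
      intro z hz
      rw [norm_mul, norm_pow, norm_inv, mem_sphere_zero_iff_norm.1 hz]
      exact mul_le_mul_of_nonneg_right (h1 z hz).2.2.le (by positivity)
    refine (circleIntegral.norm_integral_le_of_norm_le_const hR0.le h2).trans (le_of_eq ?_)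
    field_simp

/-! ### The free energy of genus zero -/

/-- The truncated Taylor polynomial of `(1 + 2 a w²)^{1/2}`. -/
def sqrtTaylor (a w : ℂ) : ℂ :=
  1 + a * w ^ 2 - a ^ 2 / 2 * w ^ 4 + a ^ 3 / 2 * w ^ 6 - 5 / 8 * a ^ 4 * w ^ 8
    + 7 / 8 * a ^ 5 * w ^ 10

/-- The difference from the Taylor polynomial is the difference of squares divided by the sum, and
the sum is nonzero near 0. Order 12 is needed because F_0 pairs ζ⁵ with the coefficient of ζ⁻⁶,
while y dx starts with ζ⁴. -/
lemma exists_sqrt_remainder (a : ℂ) : ∃ r : ℂ → ℂ, AnalyticAt ℂ r 0 ∧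
    ∀ᶠ w : ℂ in 𝓝[≠] 0, (1 + 2 * a * w ^ 2) ^ (1 / 2 : ℂ) = sqrtTaylor a w + w ^ 12 * r w := by
  set H : ℂ → ℂ := fun w => (1 + 2 * a * w ^ 2) ^ (1 / 2 : ℂ)
  have hH : AnalyticAt ℂ H 0 := AnalyticAt.cpow (by fun_prop) analyticAt_const (by simp)
  have hT : AnalyticAt ℂ (sqrtTaylor a) 0 := by unfold sqrtTaylor; fun_prop
  have hne : H 0 + sqrtTaylor a 0 ≠ 0 := by simp [H, sqrtTaylor]
  refine ⟨fun w => -(21 / 8 * a ^ 6 - 3 / 2 * a ^ 7 * w ^ 2 + 81 / 64 * a ^ 8 * w ^ 4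
    - 35 / 32 * a ^ 9 * w ^ 6 + 49 / 64 * a ^ 10 * w ^ 8) / (H w + sqrtTaylor a w),
    AnalyticAt.div (by fun_prop) (hH.add hT) hne, ?_⟩
  filter_upwards [eventually_ne (hH.add hT).continuousAt hne] with w hw
  have hw' : H w + sqrtTaylor a w ≠ 0 := hw
  have h1 : H w ^ 2 = 1 + 2 * a * w ^ 2 := by
    simp only [H]
    rw [← Complex.cpow_nat_mul]; norm_num
  change H w = _
  rw [← sub_eq_iff_eq_add', ← mul_div_assoc, eq_div_iff hw']
  have h2 : (H w - sqrtTaylor a w) * (H w + sqrtTaylor a w) = H w ^ 2 - sqrtTaylor a w ^ 2 := by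
    ring
  rw [h2, h1, sqrtTaylor]
  ring

lemma exists_ydxZeta_expansion (a : ℂ) : ∃ r : ℂ → ℂ, AnalyticAt ℂ r 0 ∧
    ∀ᶠ w : ℂ in 𝓝[≠] 0, ydxZeta a w⁻¹ = 4 * (w⁻¹) ^ (4 : ℤ) + -6 * a ^ 2
      + 4 * a ^ 3 * (w⁻¹) ^ (-2 : ℤ) + -9 / 2 * a ^ 4 * (w⁻¹) ^ (-4 : ℤ)
      + 6 * a ^ 5 * (w⁻¹) ^ (-6 : ℤ) + w ^ 8 * r w := by
  obtain ⟨r, hr, h⟩ := exists_sqrt_remainder a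
  refine ⟨fun w => -7 / 2 * a ^ 6 + 4 * (1 - a * w ^ 2) * r w, by fun_prop, ?_⟩
  filter_upwards [h, eventually_ne_zero] with w hw hw0
  have e1 : 2 * a / w⁻¹ ^ 2 = 2 * a * w ^ 2 := by field_simp
  rw [ydxZeta, e1]
  set K := (1 + 2 * a * w ^ 2) ^ (1 / 2 : ℂ) with hK
  have h1 : K ^ 2 = 1 + 2 * a * w ^ 2 := by
    rw [hK, ← Complex.cpow_nat_mul]; norm_num
  have e2 : yMap a (w⁻¹ * K) * (2 * w⁻¹) = 4 * K * (w⁻¹ ^ 4 - a * w⁻¹ ^ 2) := by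
    have e3 : (w⁻¹ * K) ^ 2 = w⁻¹ ^ 2 + 2 * a := by
      rw [mul_pow, h1]; field_simp
    rw [yMap, e3]; ring
  rw [e2, hw, sqrtTaylor]
  have z4 : (w⁻¹) ^ (4 : ℤ) = w⁻¹ ^ 4 := by norm_cast
  have z2 : (w⁻¹) ^ (-2 : ℤ) = w ^ 2 := by rw [zpow_neg, inv_zpow, inv_inv]; norm_cast
  have z4' : (w⁻¹) ^ (-4 : ℤ) = w ^ 4 := by rw [zpow_neg, inv_zpow, inv_inv]; norm_cast
  have z6 : (w⁻¹) ^ (-6 : ℤ) = w ^ 6 := by rw [zpow_neg, inv_zpow, inv_inv]; norm_cast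
  rw [z4, z2, z4', z6]
  generalize r w = t
  field_simp
  ring

lemma hasContourInfinity_ydxZeta (a : ℂ) {m : ℤ} (hm : m ≤ 6) :
    HasContourInfinity (fun ζ => ydxZeta a ζ * ζ ^ m)
      ((if m = -5 then 4 else 0) + (if m = -1 then -6 * a ^ 2 else 0)
        + (if m = 1 then 4 * a ^ 3 else 0) + (if m = 3 then -9 / 2 * a ^ 4 else 0)
        + (if m = 5 then 6 * a ^ 5 else 0)) := by
  obtain ⟨r, hr, h⟩ := exists_ydxZeta_expansion a
  obtain ⟨j, hj⟩ : ∃ j : ℕ, (j : ℤ) = 6 - m := ⟨(6 - m).toNat, Int.toNat_of_nonneg (by omega)⟩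
  have hF : AnalyticAt ℂ (fun w => r w * w ^ j) 0 := by fun_prop
  have h1 := (((((hasContourInfinity_zpow (m + 4)).const_mul 4).add
    ((hasContourInfinity_zpow m).const_mul (-6 * a ^ 2))).add
    ((hasContourInfinity_zpow (m - 2)).const_mul (4 * a ^ 3))).add
    ((hasContourInfinity_zpow (m - 4)).const_mul (-9 / 2 * a ^ 4))).add
    ((hasContourInfinity_zpow (m - 6)).const_mul (6 * a ^ 5)) |>.add
    (hasContourInfinity_of_analyticAt hF)
  have i1 : (m + 4 = -1) ↔ m = -5 := by omega
  have i2 : (m - 2 = -1) ↔ m = 1 := by omega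
  have i3 : (m - 4 = -1) ↔ m = 3 := by omega
  have i4 : (m - 6 = -1) ↔ m = 5 := by omega
  simp only [i1, i2, i3, i4, mul_ite, mul_one, mul_zero, add_zero] at h1
  refine h1.congr ?_
  filter_upwards [h, eventually_ne_zero] with w hw hw0
  have hw1 : w⁻¹ ≠ 0 := inv_ne_zero hw0
  rw [hw]
  have z8 : w ^ 8 * r w * w⁻¹ ^ m = r (w⁻¹)⁻¹ * (w⁻¹)⁻¹ ^ j * (w⁻¹)⁻¹ ^ 2 := by
    rw [inv_inv, inv_zpow', ← zpow_natCast w j, hj, zpow_sub₀ hw0, zpow_neg]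
    field_simp
  rw [← z8, zpow_add₀ hw1, show m - 2 = m + -2 by ring, show m - 4 = m + -4 by ring,
    show m - 6 = m + -6 by ring, zpow_add₀ hw1, zpow_add₀ hw1, zpow_add₀ hw1]
  ring

lemma polarPrimitive_eq (a ζ : ℂ) : polarPrimitive a ζ = 4 / 5 * ζ ^ 5 - 6 * a ^ 2 * ζ := by
  have h : ∀ k : ℕ, contourInfinity (fun w => ydxZeta a w / w ^ (k + 1))
      = (if (-(k + 1 : ℕ) : ℤ) = -5 then 4 else 0)
        + (if (-(k + 1 : ℕ) : ℤ) = -1 then -6 * a ^ 2 else 0)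
        + (if (-(k + 1 : ℕ) : ℤ) = 1 then 4 * a ^ 3 else 0)
        + (if (-(k + 1 : ℕ) : ℤ) = 3 then -9 / 2 * a ^ 4 else 0)
        + (if (-(k + 1 : ℕ) : ℤ) = 5 then 6 * a ^ 5 else 0) := by
    intro k
    have h1 := hasContourInfinity_ydxZeta a (m := (-(k + 1 : ℕ) : ℤ)) (by omega)
    rw [← h1.contourInfinity_eq]
    congr 1
  simp only [polarPrimitive, h, Finset.sum_range_succ, Finset.sum_range_zero]
  norm_num
  ring

/-- The terms (4/5)ζ⁵ and -6a²ζ of V meet the coefficients 6a⁵ of ζ⁻⁶ and 4a³ of ζ⁻² in y dx. -/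
lemma freeEnergyZero_eq (a : ℂ) : freeEnergyZero a = -(48 / 5) * a ^ 5 := by
  have h := ((hasContourInfinity_ydxZeta a (m := 5) (by norm_num)).const_mul (4 / 5)).add
    ((hasContourInfinity_ydxZeta a (m := 1) (by norm_num)).const_mul (-6 * a ^ 2))
  have h1 : (fun ζ => polarPrimitive a ζ * ydxZeta a ζ)
      = fun ζ => 4 / 5 * (ydxZeta a ζ * ζ ^ (5 : ℤ)) + -6 * a ^ 2 * (ydxZeta a ζ * ζ ^ (1 : ℤ)) := by
    ext ζ
    have z5 : ζ ^ (5 : ℤ) = ζ ^ 5 := by norm_cast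
    rw [polarPrimitive_eq, z5, zpow_one]; ring
  rw [freeEnergyZero, h1, h.contourInfinity_eq]
  norm_num
  ring

end PainleveOne

end

noncomputable section
namespace PainleveOne

open Filter Topology

/-! ### Free energies of higher genus -/

lemma corrCoeff_zero_multiset (s : ℂ) (m k : ℕ) :
    corrCoeff s (m + 1) 0 k = PowerSeries.coeff m (zDerivSeries k) := by
  rw [corrCoeff, multiDer_zero, constantCoeff_pderiv_freeF]

lemma zDerivSeries_succ_sub (m d : ℕ) : PowerSeries.coeff (m + 1) (zDerivSeries d)
    - PowerSeries.coeff (m + 1) (zDerivSeries (d + 1))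
      = MvPolynomial.constantCoeff (vir d (zCoeff m)) := by
  rw [← shiftDiff_zCoeff_succ, shiftDiff, map_sub]
  simp [zDerivSeries]

lemma constantCoeff_virB (d : ℕ) (p : TimeRing) :
    MvPolynomial.constantCoeff (virB d p) = 0 := by
  obtain ⟨M, hM⟩ := exists_vars_bound p
  rw [derivation_eq_sum _ fun k hk => pderiv_eq_zero_of_bound hM hk, map_sum]
  refine Finset.sum_eq_zero fun k _ => ?_
  rw [virB, MvPolynomial.mkDerivation_X]
  split_ifs <;> simp

lemma zDerivSeries_zero_eq_one (m : ℕ) : PowerSeries.coeff (m + 1) (zDerivSeries 0)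
    = PowerSeries.coeff (m + 1) (zDerivSeries 1) := by
  rw [← sub_eq_zero, zDerivSeries_succ_sub, vir, map_add, map_add, constantCoeff_virB, virC_zero,
    virA_zero]
  simp

/-- At the origin `vir 1` Z reduces to 1/32 times Z, which is 1 there; so the constraint d = 1 has
no right-hand side from order 2 on. -/
lemma zDerivSeries_one_eq_two (m : ℕ) : PowerSeries.coeff (m + 2) (zDerivSeries 1)
    = PowerSeries.coeff (m + 2) (zDerivSeries 2) := by
  rw [← sub_eq_zero, zDerivSeries_succ_sub, vir, map_add, map_add, constantCoeff_virB, virC_one,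
    map_mul, constantCoeff_zCoeff]
  simp

lemma laurent_of_le {s : ℂ} {M M' : ℕ} (h : M ≤ M') {c : ℕ → ℂ} (hc : ∀ k, M ≤ k → c k = 0)
    (z : ℂ) : laurent s M c z = laurent s M' c z :=
  Finset.sum_subset (Finset.range_subset_range.2 h) fun k _ hk => by
    rw [hc k (by simpa using hk), mul_zero]

lemma hasResidueZero_pow_mul_laurent {s : ℂ} (hs : s ≠ 0) {M : ℕ} (c : ℕ → ℂ) {j : ℕ}
    (hj : j < M) : HasResidueZero (fun z => z ^ (2 * j + 1) * laurent s M c z)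
      (s ^ 3 / s ^ (j + 1) * c j) := by
  have h1 := HasResidueZero.sum (S := Finset.range M) fun k _ =>
    (hasResidueZero_zpow ((2 * j + 1 : ℕ) - (2 * (k + 1) : ℕ))).const_mul
      (s ^ 3 / s ^ (k + 1) * c k)
  have h2 : ∑ k ∈ Finset.range M, s ^ 3 / s ^ (k + 1) * c k
      * (if ((2 * j + 1 : ℕ) - (2 * (k + 1) : ℕ) : ℤ) = -1 then 1 else 0)
      = s ^ 3 / s ^ (j + 1) * c j := by
    rw [Finset.sum_eq_single j]
    · rw [if_pos (by push_cast; ring), mul_one]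
    · intro k _ hk
      rw [if_neg (by push_cast; omega), mul_zero]
    · intro h; exact absurd (Finset.mem_range.2 hj) h
  rw [h2] at h1
  refine h1.congr ?_
  filter_upwards [eventually_ne_zero] with z hz
  rw [laurent, Finset.mul_sum]
  refine Finset.sum_congr rfl fun k _ => ?_
  rw [zpow_sub₀ hz, zpow_natCast, zpow_natCast, ptCoeff, one_div_pow, mul_pow, ← pow_mul]
  field_simp

lemma hasResidueZero_laurent (s : ℂ) (M : ℕ) (c : ℕ → ℂ) :
    HasResidueZero (fun z => laurent s M c z) 0 := by
  have h1 := HasResidueZero.sum (S := Finset.range M) fun k _ =>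
    (hasResidueZero_zpow (-(2 * (k + 1) : ℕ))).const_mul (s ^ 3 * (1 / s) ^ (k + 1) * c k)
  have h2 : ∑ k ∈ Finset.range M, s ^ 3 * (1 / s) ^ (k + 1) * c k
      * (if (-(2 * (k + 1) : ℕ) : ℤ) = -1 then 1 else 0) = 0 := by
    refine Finset.sum_eq_zero fun k _ => ?_
    rw [if_neg (by push_cast; omega), mul_zero]
  rw [h2] at h1
  refine h1.congr (Filter.Eventually.of_forall fun z => ?_)
  simp only [laurent]
  refine Finset.sum_congr rfl fun k _ => ?_
  rw [zpow_neg, zpow_natCast, ptCoeff, ← one_div_mul_one_div, mul_pow, one_div_pow (z ^ 2),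
    ← pow_mul, one_div]
  ring

/-- The powers z⁵ and z³ of Φ pick the Laurent coefficients c₂ and c₁ of W_{g,1}, both equal to the
one-point number c₀, and 4/5 - 4as = 4/5 - 4/3 = -8/15. The base point drops out because W_{g,1} is
even in z and has no residue. -/
lemma freeEnergyHigher_eq {a s : ℂ} (ha : 3 * a * s = 1) (z₀ : ℂ) (g : ℕ) :
    freeEnergyHigher a z₀ (g + 2) = 4 / (15 * ((g : ℂ) + 1))
      * PowerSeries.coeff (2 * g + 3) (zDerivSeries 0) * s ^ (5 * (g + 1)) := by
  have hs : s ≠ 0 := by rintro rfl; simp at ha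
  set M := corrBound (2 * g + 4) + 3
  set c : ℕ → ℂ := corrCoeff s (2 * g + 4) 0 with hc
  have hW : ∀ z, z ≠ 0 → eoW a (g + 2) 0 z ![] = scal s (g + 2) * laurent s M c z := by
    intro z hz
    rw [eoW_eq ha _ (g + 2) 0 rfl (by omega) z ![] hz (fun i => i.elim0)]
    have h1 : pts (![] : Fin 0 → ℂ) Finset.univ = 0 := rfl
    rw [h1, show 2 * (g + 2) + 0 = 2 * g + 4 by ring, corr_cons]
    congr 1
    exact laurent_of_le (by omega) (fun k hk => corrCoeff_eq_zero_of_le s 0 hk) z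
  have h1 := (((hasResidueZero_pow_mul_laurent hs c (j := 2) (by omega : 2 < M)).const_mul
    (4 / 5 * scal s (g + 2))).add
    ((hasResidueZero_pow_mul_laurent hs c (j := 1) (by omega : 1 < M)).const_mul
    (-4 * a * scal s (g + 2)))).add ((hasResidueZero_laurent s M c).const_mul
      (-(4 / 5 * z₀ ^ 5 - 4 * a * z₀ ^ 3) * scal s (g + 2)))
  have h2 := h1.congr (g := fun z => phi a z₀ z * eoW a (g + 2) 0 z ![]) (by
    filter_upwards [eventually_ne_zero] with z hz
    rw [hW z hz, phi]; ring)
  have e0 : c 1 = PowerSeries.coeff (2 * g + 3) (zDerivSeries 0) := by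
    rw [zDerivSeries_zero_eq_one, hc, corrCoeff_zero_multiset]
  have e1 : c 2 = PowerSeries.coeff (2 * g + 3) (zDerivSeries 0) := by
    rw [zDerivSeries_zero_eq_one, zDerivSeries_one_eq_two (2 * g + 1), hc,
      corrCoeff_zero_multiset]
  rw [freeEnergyHigher, h2.residueZero_eq, e0, e1]
  have hg : ((g : ℂ) + 1) ≠ 0 := Nat.cast_add_one_ne_zero g
  have hsc : scal s (g + 2) = s ^ (5 * (g + 1)) := by
    rw [scal, show 5 * (g + 2) = 5 * (g + 1) + 5 by ring, pow_add]; field_simp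
  have hg2 : (2 : ℂ) - 2 * ((g + 2 : ℕ) : ℂ) = -(2 * ((g : ℂ) + 1)) := by push_cast; ring
  rw [hsc, hg2]
  have has : a = 1 / (3 * s) := by
    rw [eq_div_iff (by simpa using hs)]; linear_combination ha
  rw [has]
  generalize s ^ (5 * (g + 1)) = t
  field_simp
  ring

/-! ### Dependence on the time -/

/-- The inverse of `3 q₀`. -/
def sPar (q₀ : ℂ → ℂ) (t : ℂ) : ℂ := 1 / (3 * q₀ t)

/-- `q₀` is a holomorphic branch of `√(-t/6)` on the open set `U`. -/
structure IsBranch (U : Set ℂ) (q₀ : ℂ → ℂ) : Prop where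
  isOpen : IsOpen U
  zero_notMem : (0 : ℂ) ∉ U
  differentiableOn : DifferentiableOn ℂ q₀ U
  sq_eq : ∀ t ∈ U, 6 * q₀ t ^ 2 + t = 0

namespace IsBranch

variable {U : Set ℂ} {q₀ : ℂ → ℂ} {t : ℂ}

lemma ne_zero (h : IsBranch U q₀) (ht : t ∈ U) : q₀ t ≠ 0 := by
  intro h0
  have := h.sq_eq t ht
  rw [h0] at this
  have ht0 : t = 0 := by simpa using this
  exact h.zero_notMem (ht0 ▸ ht)

lemma hasDerivAt (h : IsBranch U q₀) (ht : t ∈ U) : HasDerivAt q₀ (-1 / (12 * q₀ t)) t := by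
  have hU := h.isOpen.mem_nhds ht
  have h1 := (h.differentiableOn.differentiableAt hU).hasDerivAt
  have h2 : HasDerivAt (fun t => 6 * q₀ t ^ 2 + t) (6 * (2 * q₀ t ^ (2 - 1) * deriv q₀ t) + 1) t :=
    ((h1.pow 2).const_mul 6).add (hasDerivAt_id t)
  have h3 : HasDerivAt (fun t => 6 * q₀ t ^ 2 + t) 0 t := by
    refine (hasDerivAt_const t (0 : ℂ)).congr_of_eventuallyEq ?_
    filter_upwards [hU] with x hx using h.sq_eq x hx
  have h4 := h2.unique h3
  have h5 : deriv q₀ t = -1 / (12 * q₀ t) := by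
    rw [eq_div_iff (mul_ne_zero (by norm_num) (h.ne_zero ht))]
    norm_num at h4
    linear_combination h4
  rwa [h5] at h1

lemma sPar_ne_zero (h : IsBranch U q₀) (ht : t ∈ U) : sPar q₀ t ≠ 0 :=
  one_div_ne_zero (mul_ne_zero (by norm_num) (h.ne_zero ht))

lemma mul_sPar (h : IsBranch U q₀) (ht : t ∈ U) : 3 * q₀ t * sPar q₀ t = 1 :=
  mul_one_div_cancel (mul_ne_zero (by norm_num) (h.ne_zero ht))

lemma hasDerivAt_sPar (h : IsBranch U q₀) (ht : t ∈ U) :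
    HasDerivAt (sPar q₀) (3 / 4 * sPar q₀ t ^ 3) t := by
  have h0 := h.ne_zero ht
  have h1 := ((h.hasDerivAt ht).const_mul 3).fun_inv (mul_ne_zero (by norm_num) h0)
  have h2 : sPar q₀ = fun t => (3 * q₀ t)⁻¹ := by ext t; rw [sPar, one_div]
  rw [h2]
  refine h1.congr_deriv ?_
  field_simp
  norm_num

lemma hasDerivAt_sPar_pow (h : IsBranch U q₀) (ht : t ∈ U) (n : ℕ) :
    HasDerivAt (fun t => sPar q₀ t ^ n) (3 / 4 * n * sPar q₀ t ^ (n + 2)) t := by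
  refine ((h.hasDerivAt_sPar ht).fun_pow n).congr_deriv ?_
  cases n with
  | zero => simp
  | succ n =>
    rw [Nat.add_sub_cancel]; ring

lemma hasDerivAt_profile (h : IsBranch U q₀) (ht : t ∈ U) (k : ℕ) :
    HasDerivAt (fun t => 3 * q₀ t * sPar q₀ t ^ (5 * k))
      (3 / 4 * (5 * k - 1) * sPar q₀ t ^ (5 * k + 1)) t := by
  have h0 := h.ne_zero ht
  have hs := h.sPar_ne_zero ht
  have h1 := ((h.hasDerivAt ht).const_mul 3).mul (h.hasDerivAt_sPar_pow ht (5 * k))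
  refine HasDerivAt.congr_deriv h1 ?_
  have e1 : q₀ t = 1 / (3 * sPar q₀ t) := by rw [sPar]; field_simp
  simp only [e1]
  push_cast
  field_simp
  ring

/-- Homogeneity: q_{2k} is `alpha k` times s^{5k-1}, written with 3q₀ = 1/s to avoid a negative
exponent. Two t-derivatives give (9/16)(25k² - 1) s^{5k+3}, the factor in the recursion for `alpha`.
-/
lemma qCoeff_eq (h : IsBranch U q₀) (k : ℕ) : ∀ t ∈ U,
    qCoeff q₀ k t = alpha k * (3 * q₀ t * sPar q₀ t ^ (5 * k)) := by
  induction k using Nat.strong_induction_on with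
  | _ k ih =>
  intro t ht
  cases k with
  | zero => rw [qCoeff, alpha]; simp
  | succ k =>
    have h1 : Set.EqOn (qCoeff q₀ k) (fun t => alpha k * (3 * q₀ t * sPar q₀ t ^ (5 * k))) U :=
      fun x hx => ih k (Nat.lt_succ_self k) x hx
    have h2 : Set.EqOn (deriv (qCoeff q₀ k))
        (fun t => alpha k * (3 / 4 * (5 * k - 1) * sPar q₀ t ^ (5 * k + 1))) U :=
      fun x hx => (h1.deriv h.isOpen hx).trans ((h.hasDerivAt_profile hx k).const_mul _).deriv
    have h3 := (h2.deriv h.isOpen ht).trans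
      (((h.hasDerivAt_sPar_pow ht (5 * k + 1)).const_mul _).const_mul _).deriv
    have h4 : ∀ i : Fin k, qCoeff q₀ (i + 1) t * qCoeff q₀ (k - i) t
        = (3 * q₀ t) ^ 2 * sPar q₀ t ^ (5 * k + 5) * (alpha (i + 1) * alpha (k - i)) := by
      intro i
      have hi := i.2
      rw [ih (i + 1) (by omega) t ht, ih (k - i) (by omega) t ht]
      have : sPar q₀ t ^ (5 * k + 5)
          = sPar q₀ t ^ (5 * ((i : ℕ) + 1)) * sPar q₀ t ^ (5 * (k - (i : ℕ))) := by
        rw [← pow_add]; congr 1; omega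
      rw [this]; ring
    rw [qCoeff, alpha]
    beta_reduce
    rw [h3, Finset.sum_congr rfl fun i _ => h4 i, ← Finset.mul_sum]
    have e1 : q₀ t = 1 / (3 * sPar q₀ t) := by
      have := h.ne_zero ht
      rw [sPar]; field_simp
    have hs := h.sPar_ne_zero ht
    simp only [e1]
    generalize (∑ i : Fin k, alpha (i + 1) * alpha (k - i)) = S
    push_cast
    field_simp
    ring

lemma deriv_qCoeff (h : IsBranch U q₀) (k : ℕ) (ht : t ∈ U) :
    deriv (qCoeff q₀ k) t = alpha k * (3 / 4 * (5 * k - 1) * sPar q₀ t ^ (5 * k + 1)) := by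
  have h1 : Set.EqOn (qCoeff q₀ k) (fun t => alpha k * (3 * q₀ t * sPar q₀ t ^ (5 * k))) U :=
    fun x hx => h.qCoeff_eq k x hx
  exact (h1.deriv h.isOpen ht).trans ((h.hasDerivAt_profile ht k).const_mul _).deriv

end IsBranch

end PainleveOne

end

noncomputable section
namespace PainleveOne

open Filter Topology PowerSeries

/-! ### The Hamiltonian of the formal solution -/

/-- Evaluation of the coefficients of a formal series at the point `t`. -/
def evalAt (t : ℂ) : (ℂ → ℂ)⟦X⟧ →+* ℂ⟦X⟧ := PowerSeries.map (Pi.evalRingHom (fun _ => ℂ) t)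

lemma coeff_evalAt (t : ℂ) (f : (ℂ → ℂ)⟦X⟧) (n : ℕ) :
    coeff n (evalAt t f) = coeff n f t := by
  simp [evalAt]

/-- The genus one number, read off from order r² of the Hamiltonian identity and the first two
coefficients of the formal solution. -/
lemma zDerivSeries_one_zero : coeff 1 (zDerivSeries 0) = 1 / 32 := by
  have h := congrArg (coeff 2) hamiltonian_eq_zDerivSeries
  have e0 : coeff 0 qNum = 1 / 3 := by rw [coeff_qNum, if_pos (by decide), alpha]
  have e1 : coeff 1 qNum = 0 := by rw [coeff_qNum, if_neg (by decide)]
  have e2 : coeff 2 qNum = -9 / 64 * (1 / 3) := by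
    rw [coeff_qNum, if_pos (by decide), alpha, alpha]; simp; norm_num
  have hC (n : ℕ) [n.AtLeastTwo] : (OfNat.ofNat n : ℂ⟦X⟧) = C (OfNat.ofNat n : ℂ) :=
    (map_ofNat _ _).symm
  rw [hC 27, hC 15, hC 6, hC 6912, hC 2304, hC 512, hC 3456] at h
  have hX : ∀ f : ℂ⟦X⟧, coeff 2 (C 27 * X ^ 2 * f) = 27 * coeff 0 f := by
    intro f
    rw [mul_assoc, coeff_C_mul, show (2 : ℕ) = 0 + 2 from rfl, coeff_X_pow_mul]
  rw [map_sub, map_add, map_sub, hX, coeff_C_mul, coeff_C_mul, coeff_C_mul, coeff_succ_X_mul,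
    coeff_C, pow_two, pow_succ, pow_two, coeff_mul, coeff_mul] at h
  simp only [Finset.Nat.antidiagonal_succ, Finset.Nat.antidiagonal_zero, coeff_mul,
    Finset.map_singleton, Finset.sum_cons, Finset.sum_singleton, Finset.map_cons,
    Function.Embedding.prodMap, Function.Embedding.coeFn_mk, Prod.map,
    Nat.succ_eq_add_one, Function.Embedding.refl_apply] at h
  have e3 : coeff 0 (serEuler qNum) = 0 := by rw [coeff_serEuler]; simp
  simp only [map_sub, coeff_C_mul, e0, e1, e2, e3] at h
  norm_num at h
  linear_combination (-1 / 3456) * h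

namespace IsBranch

variable {U : Set ℂ} {q₀ : ℂ → ℂ} {t : ℂ}

/-- The scaling variable is r = s^{5/2} ħ; the square root ρ of s makes the exponent integral, and
its sign is immaterial since q is even in ħ. -/
lemma evalAt_qSeries (h : IsBranch U q₀) (ht : t ∈ U) {ρ : ℂ} (hρ : ρ ^ 2 = sPar q₀ t) :
    evalAt t (qSeries q₀) = C (sPar q₀ t)⁻¹ * rescale (ρ ^ 5) qNum := by
  ext1 n
  rw [coeff_evalAt, coeff_C_mul, coeff_rescale, coeff_qNum, qSeries, coeff_mk]
  split_ifs with hn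
  · obtain ⟨k, rfl⟩ := hn
    rw [show (k + k) / 2 = k by omega, h.qCoeff_eq k t ht, ← hρ,
      show 3 * q₀ t = (ρ ^ 2)⁻¹ from ?_]
    · ring
    · rw [hρ]; exact eq_inv_of_mul_eq_one_left (h.mul_sPar ht)
  · simp

lemma evalAt_pSeries (h : IsBranch U q₀) (ht : t ∈ U) {ρ : ℂ} (hρ : ρ ^ 2 = sPar q₀ t) :
    evalAt t (pSeries q₀)
      = X * (C (sPar q₀ t / 8) * rescale (ρ ^ 5) (15 * serEuler qNum - 6 * qNum)) := by
  have hX : evalAt t (pSeries q₀) = X * evalAt t (ddt (qSeries q₀)) := by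
    rw [pSeries, map_mul]; congr 1; exact PowerSeries.map_X _
  have h15 : (15 * serEuler qNum - 6 * qNum) = C 15 * serEuler qNum - C 6 * qNum := by
    rw [map_ofNat, map_ofNat]
  rw [hX, h15]
  congr 1
  ext1 n
  rw [coeff_evalAt, coeff_C_mul, coeff_rescale, map_sub, coeff_C_mul, coeff_C_mul, coeff_serEuler,
    coeff_qNum, ddt, coeff_mk, qSeries, coeff_mk]
  split_ifs with hn
  · obtain ⟨k, rfl⟩ := hn
    rw [show (k + k) / 2 = k by omega, h.deriv_qCoeff k ht, ← hρ]
    push_cast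
    ring
  · have : deriv (0 : ℂ → ℂ) t = 0 := by
      exact congrFun (deriv_const' (𝕜 := ℂ) (F := ℂ) (0 : ℂ)) t
    rw [this]; simp

lemma evalAt_sigmaSeries (h : IsBranch U q₀) (ht : t ∈ U) {ρ : ℂ} (hρ : ρ ^ 2 = sPar q₀ t) :
    evalAt t (sigmaSeries q₀) = C ((sPar q₀ t)⁻¹ ^ 3)
      * rescale (ρ ^ 5) (C (4 / 27) + X * zDerivSeries 0) := by
  have hs := h.sPar_ne_zero ht
  have h1 : evalAt t (sigmaSeries q₀) = C (1 / 2) * evalAt t (pSeries q₀) ^ 2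
      - 2 * evalAt t (qSeries q₀) ^ 3 - C t * evalAt t (qSeries q₀) := by
    rw [sigmaSeries, hamiltonian, map_sub, map_sub, map_mul, map_mul, map_mul, map_pow, map_pow,
      map_ofNat]
    simp [evalAt]
  have h2 : t = -(2 / 3) * (sPar q₀ t)⁻¹ ^ 2 := by
    have e1 : q₀ t = 1 / (3 * sPar q₀ t) := by
      have := h.ne_zero ht
      rw [sPar]; field_simp
    have := h.sq_eq t ht
    rw [e1] at this
    field_simp at this ⊢
    linear_combination (1 / 3 : ℂ) * this
  have h3 := congrArg (fun f => C ((sPar q₀ t)⁻¹ ^ 3 / 3456) * rescale (ρ ^ 5) f)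
    hamiltonian_eq_zDerivSeries
  have hC : ∀ c : ℂ, rescale (ρ ^ 5) (C c) = C c := fun c => by
    ext n; rw [coeff_rescale, coeff_C]; split_ifs with hn <;> simp [hn]
  have k1 : C (1 / 2 : ℂ) * C (sPar q₀ t / 8) ^ 2
      = C ((sPar q₀ t)⁻¹ ^ 3 / 3456) * 27 * C (ρ ^ 5) ^ 2 := by
    rw [← map_ofNat C, ← map_pow, ← map_pow, ← map_mul, ← map_mul, ← map_mul, ← pow_mul,
      show 5 * 2 = 2 * 5 from rfl, pow_mul, hρ]
    congr 1; field_simp; norm_num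
  have k2 : (2 : ℂ⟦X⟧) * C (sPar q₀ t)⁻¹ ^ 3 = C ((sPar q₀ t)⁻¹ ^ 3 / 3456) * 6912 := by
    rw [← map_ofNat C, ← map_ofNat C 6912, ← map_pow, ← map_mul, ← map_mul]
    congr 1; ring
  have k3 : C t * C (sPar q₀ t)⁻¹ = -(C ((sPar q₀ t)⁻¹ ^ 3 / 3456) * 2304) := by
    rw [← map_ofNat C, ← map_mul, ← map_mul, ← map_neg]
    congr 1; nth_rewrite 1 [h2]; ring
  have k4 : C ((sPar q₀ t)⁻¹ ^ 3) = C ((sPar q₀ t)⁻¹ ^ 3 / 3456) * 3456 := by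
    rw [← map_ofNat C, ← map_mul]
    congr 1; ring
  have k5 : C ((sPar q₀ t)⁻¹ ^ 3) * C (4 / 27 : ℂ) = C ((sPar q₀ t)⁻¹ ^ 3 / 3456) * 512 := by
    rw [← map_ofNat C, ← map_mul, ← map_mul]
    congr 1; ring
  rw [h1, h.evalAt_qSeries ht hρ, h.evalAt_pSeries ht hρ, map_add, mul_add, hC, k5, k4]
  simp only [map_mul, map_sub, map_add, map_pow, map_ofNat, rescale_X] at h3 ⊢
  simp only [map_pow] at k1 k2 k3
  linear_combination h3 + X ^ 2 * (15 * rescale (ρ ^ 5) (serEuler qNum)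
    - 6 * rescale (ρ ^ 5) qNum) ^ 2 * k1 - rescale (ρ ^ 5) qNum ^ 3 * k2
    - rescale (ρ ^ 5) qNum * k3

end IsBranch

end PainleveOne

end

noncomputable section
namespace PainleveOne

open Filter Topology PowerSeries

/-! ### The derivatives of the free energies -/

/-- The genus expansion without further points: the one-point function of F lives in even orders,
and the index here is lower by one. -/
lemma coeff_zDerivSeries_zero_of_even (n : ℕ) :
    coeff (2 * n) (zDerivSeries 0) = 0 := by
  rw [← corrCoeff_zero_multiset 1]
  exact corrCoeff_eq_zero one_ne_zero _ _ (fun g => by rw [Multiset.card_zero]; omega) _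

namespace IsBranch

variable {U : Set ℂ} {q₀ : ℂ → ℂ} {t : ℂ}

lemma coeff_sigmaSeries_zero (h : IsBranch U q₀) (ht : t ∈ U) :
    coeff 0 (sigmaSeries q₀) t = 4 * q₀ t ^ 3 := by
  obtain ⟨ρ, hρ⟩ := IsAlgClosed.exists_pow_nat_eq (sPar q₀ t) two_pos
  rw [← coeff_evalAt, h.evalAt_sigmaSeries ht hρ, coeff_C_mul, coeff_rescale, map_add]
  have := h.ne_zero ht
  simp [sPar]
  field_simp
  norm_num

lemma coeff_sigmaSeries_succ (h : IsBranch U q₀) (ht : t ∈ U) {ρ : ℂ} (hρ : ρ ^ 2 = sPar q₀ t)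
    (n : ℕ) : coeff (n + 1) (sigmaSeries q₀) t
      = (sPar q₀ t)⁻¹ ^ 3 * (ρ ^ (5 * (n + 1)) * coeff n (zDerivSeries 0)) := by
  rw [← coeff_evalAt, h.evalAt_sigmaSeries ht hρ, coeff_C_mul, coeff_rescale, map_add, coeff_C,
    if_neg n.succ_ne_zero, zero_add, coeff_succ_X_mul, ← pow_mul]

lemma coeff_sigmaSeries_odd (h : IsBranch U q₀) (ht : t ∈ U) (n : ℕ) :
    coeff (2 * n + 1) (sigmaSeries q₀) t = 0 := by
  obtain ⟨ρ, hρ⟩ := IsAlgClosed.exists_pow_nat_eq (sPar q₀ t) two_pos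
  rw [h.coeff_sigmaSeries_succ ht hρ, coeff_zDerivSeries_zero_of_even, mul_zero, mul_zero]

lemma coeff_sigmaSeries_even (h : IsBranch U q₀) (ht : t ∈ U) (g : ℕ) :
    coeff (2 * (g + 1)) (sigmaSeries q₀) t
      = sPar q₀ t ^ (5 * g + 2) * coeff (2 * g + 1) (zDerivSeries 0) := by
  obtain ⟨ρ, hρ⟩ := IsAlgClosed.exists_pow_nat_eq (sPar q₀ t) two_pos
  have hs := h.sPar_ne_zero ht
  rw [show 2 * (g + 1) = 2 * g + 1 + 1 by ring, h.coeff_sigmaSeries_succ ht hρ,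
    show 5 * (2 * g + 1 + 1) = 2 * (5 * g + 2 + 3) by ring, pow_mul, hρ, pow_add _ (5 * g + 2) 3]
  field_simp

lemma hasDerivAt_freeEnergyZero (h : IsBranch U q₀) (ht : t ∈ U) :
    HasDerivAt (fun t => freeEnergyZero (q₀ t)) (coeff 0 (sigmaSeries q₀) t) t := by
  simp only [freeEnergyZero_eq]
  refine (((h.hasDerivAt ht).fun_pow 5).const_mul (-(48 / 5))).congr_deriv ?_
  rw [h.coeff_sigmaSeries_zero ht]
  have := h.ne_zero ht
  field_simp
  ring

lemma hasDerivAt_freeEnergyHigher (h : IsBranch U q₀) (ht : t ∈ U) (z₀ : ℂ) (g : ℕ) :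
    HasDerivAt (fun t => freeEnergyHigher (q₀ t) z₀ (g + 2))
      (coeff (2 * (g + 2)) (sigmaSeries q₀) t) t := by
  have h1 : (fun t => freeEnergyHigher (q₀ t) z₀ (g + 2)) =ᶠ[𝓝 t]
      fun t => 4 / (15 * ((g : ℂ) + 1)) * coeff (2 * g + 3) (zDerivSeries 0)
        * sPar q₀ t ^ (5 * (g + 1)) := by
    filter_upwards [h.isOpen.mem_nhds ht] with x hx
    exact freeEnergyHigher_eq (h.mul_sPar hx) z₀ g
  refine HasDerivAt.congr_of_eventuallyEq ?_ h1
  refine ((h.hasDerivAt_sPar_pow ht (5 * (g + 1))).const_mul _).congr_deriv ?_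
  rw [show g + 2 = g + 1 + 1 from rfl, h.coeff_sigmaSeries_even ht,
    show 2 * (g + 1) + 1 = 2 * g + 3 by ring]
  have hg : ((g : ℂ) + 1) ≠ 0 := Nat.cast_add_one_ne_zero g
  push_cast
  field_simp
  ring

end IsBranch

/-- The integrand is -1/(8z³); hence the Bergman tau-function does not contribute to dF₁/dt. -/
lemma residueZero_bergman_div (a : ℂ) :
    residueZero (fun z => -bergman z (-z) / deriv (xMap a) z) = 0 := by
  have h1 := (hasResidueZero_zpow (-3)).const_mul (-1 / 8)
  rw [if_neg (by norm_num), mul_zero] at h1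
  refine (h1.congr ?_).residueZero_eq
  filter_upwards [eventually_ne_zero] with z hz
  have h2 : deriv (xMap a) z = 2 * z := by
    have : HasDerivAt (xMap a) ((2 : ℕ) * z ^ (2 - 1) * 1) z := by
      exact ((hasDerivAt_id z).fun_pow 2).sub_const (2 * a)
    rw [this.deriv]; simp
  rw [h2, bergman, zpow_neg, show (3 : ℤ) = (3 : ℕ) from rfl, zpow_natCast]
  field_simp
  ring

lemma deriv_yMap_zero (a : ℂ) : deriv (yMap a) 0 = -6 * a := by
  have h1 : HasDerivAt (yMap a) _ 0 :=
    ((hasDerivAt_id (0 : ℂ)).const_mul 2).mul (((hasDerivAt_id (0 : ℂ)).pow 2).sub_const (3 * a))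
  rw [h1.deriv]
  simp
  ring

/-- A continuous logarithm of a differentiable function is differentiable. -/
lemma hasDerivAt_of_exp_eq {f l : ℂ → ℂ} {f' t : ℂ} (hl : ContinuousAt l t)
    (hf : HasDerivAt f f' t) (h : ∀ᶠ x in 𝓝 t, Complex.exp (l x) = f x) :
    HasDerivAt l (f' / f t) t := by
  have ht := h.self_of_nhds
  have h0 : f t ≠ 0 := ht ▸ Complex.exp_ne_zero _
  -- The ratio f(x)/f(t) is close to 1, so the principal logarithm applies; by continuity it equals
  -- l(x) - l(t), whichever branch l is.
  have h1 : HasDerivAt (fun x => Complex.log (f x / f t)) (f' / f t / (f t / f t)) t :=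
    (hf.div_const (f t)).clog (by rw [div_self h0]; exact Complex.one_mem_slitPlane)
  rw [div_self h0, div_one] at h1
  refine (h1.add_const (l t)).congr_of_eventuallyEq ?_
  have h2 : Tendsto (fun x => (l x - l t).im) (𝓝 t) (𝓝 0) := by
    have : ContinuousAt (fun x => (l x - l t).im) t :=
      Complex.continuous_im.continuousAt.comp (hl.sub continuousAt_const)
    simpa [ContinuousAt] using this
  filter_upwards [h, h2 (Ioo_mem_nhds (neg_lt_zero.2 Real.pi_pos) Real.pi_pos)] with x hx hx2
  rw [← hx, ← ht, ← Complex.exp_sub, Complex.log_exp hx2.1 hx2.2.le, sub_add_cancel]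

namespace IsBranch

variable {U : Set ℂ} {q₀ : ℂ → ℂ} {t : ℂ}

lemma hasDerivAt_freeEnergyOne (h : IsBranch U q₀) (ht : t ∈ U) {F₁ : ℂ → ℂ}
    (hF : IsFreeEnergyOne U q₀ F₁) : HasDerivAt F₁ (coeff 2 (sigmaSeries q₀) t) t := by
  obtain ⟨lt, ly, h1, h2, h3, h4⟩ := hF
  have hU := h.isOpen.mem_nhds ht
  have e1 := h1 t ht
  rw [residueZero_bergman_div, zero_mul] at e1
  have e2 := hasDerivAt_of_exp_eq (h2.continuousAt hU) ((h.hasDerivAt ht).const_mul (-6)) (by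
    filter_upwards [hU] with x hx
    rw [h3 x hx, deriv_yMap_zero])
  have e3 : F₁ =ᶠ[𝓝 t] fun t => -(1 / 2) * lt t - 1 / 24 * ly t := by
    filter_upwards [hU] with x hx using h4 x hx
  refine (((e1.const_mul (-(1 / 2))).sub (e2.const_mul (1 / 24))).congr_deriv ?_
    ).congr_of_eventuallyEq e3
  rw [show 2 = 2 * (0 + 1) from rfl, h.coeff_sigmaSeries_even ht, show 2 * 0 + 1 = 1 from rfl,
    show 5 * 0 + 2 = 2 from rfl, zDerivSeries_one_zero, sPar]
  have := h.ne_zero ht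
  field_simp
  norm_num

lemma hasDerivAt_closedFreeEnergy (h : IsBranch U q₀) {F₁ : ℂ → ℂ}
    (hF : IsFreeEnergyOne U q₀ F₁) (z₀ : ℂ) (g : ℕ) (ht : t ∈ U) :
    HasDerivAt (closedFreeEnergy q₀ F₁ z₀ g) (coeff (2 * g) (sigmaSeries q₀) t) t := by
  match g with
  | 0 => exact h.hasDerivAt_freeEnergyZero ht
  | 1 => exact h.hasDerivAt_freeEnergyOne ht hF
  | g + 2 => exact h.hasDerivAt_freeEnergyHigher ht z₀ g

lemma isLogTau_freeEnergySeries (h : IsBranch U q₀) {F : ℕ → ℂ → ℂ}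
    (hF : ∀ g, ∀ t ∈ U, HasDerivAt (F g) (coeff (2 * g) (sigmaSeries q₀) t) t) :
    IsLogTau U q₀ (freeEnergySeries F) := by
  intro t ht n
  rw [freeEnergySeries, HahnSeries.coeff_single_mul, one_mul, sub_neg_eq_add,
    PowerSeries.coeff_coe, PowerSeries.coeff_coe]
  split_ifs with hn
  -- Orders of ħ below -2, where both sides vanish.
  · exact hasDerivAt_const t (0 : ℂ)
  rw [coeff_mk]
  obtain ⟨k, hk | hk⟩ := Nat.even_or_odd' (n + 2).natAbs
  · rw [hk, if_pos (even_two_mul k), Nat.mul_div_cancel_left k two_pos]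
    exact hF k t ht
  · rw [hk, if_neg (Nat.not_even_two_mul_add_one k), h.coeff_sigmaSeries_odd ht]
    exact hasDerivAt_const t (0 : ℂ)

end IsBranch

end PainleveOne

end

theorem theorem3p5 (U : Set ℂ) (hU : IsOpen U) (hU0 : (0 : ℂ) ∉ U)
    (q₀ : ℂ → ℂ) (hq : DifferentiableOn ℂ q₀ U) (hq₀ : ∀ t ∈ U, 6 * q₀ t ^ 2 + t = 0)
    (F₁ : ℂ → ℂ) (hF₁ : PainleveOne.IsFreeEnergyOne U q₀ F₁) (z₀ : ℂ) :
    (∀ g : ℕ, ∀ t ∈ U,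
      HasDerivAt (PainleveOne.closedFreeEnergy q₀ F₁ z₀ g)
        (PowerSeries.coeff (2 * g) (PainleveOne.sigmaSeries q₀) t) t) ∧
    PainleveOne.IsLogTau U q₀
      (PainleveOne.freeEnergySeries (PainleveOne.closedFreeEnergy q₀ F₁ z₀)) := by
  have h : PainleveOne.IsBranch U q₀ := ⟨hU, hU0, hq, hq₀⟩
  exact ⟨fun g _ ht => h.hasDerivAt_closedFreeEnergy hF₁ z₀ g ht,
    h.isLogTau_freeEnergySeries fun g _ ht => h.hasDerivAt_closedFreeEnergy hF₁ z₀ g ht⟩
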